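/- **Setting.** Let $n\ge 1$, $0<\mu\le n$, $0<\gamma\le 1$, $\kappa\in\mathbb R$, $0\le\nu\le1$, $\rho\ge0$ (constant in time), and let $\ell_<$ satisfy $0\le \ell_<<n/2$ and $\ell_<>n/2-\mu$. Put $\lambda=\mu-n+2$, $\bar\lambda=\max(\lambda,1)$ and $f(\xi)=\exp\big(\rho\max(|\xi|^\nu,1)\big)$. With $\widehat u$ the unitary Fourier transform $\widehat u(\xi)=(2\pi)^{-n/2}\int e^{-ix\cdot\xi}u(x)\,dx$, and for tempered distributions on $\mathbb R^n$ whose Fourier transform is locally integrable, define $$|w|_k^2=\int_{|\xi|>1}|\xi|^{2k}f^2|\widehat w|^2\,d\xi+\int_{|\xi|\le1}f^2|\widehat w|^2\,d\xi\quad(w\in K^k_\rho),$$ $$|\varphi|_\ell^2=\int_{|\xi|>1}|\xi|^{2(\ell+2)}f^2|\widehat\varphi|^2\,d\xi+\int_{|\xi|\le1}|\xi|^{2\ell_<}f^2|\widehat\varphi|^2\,d\xi\quad(\varphi\in Y^\ell_\rho),$$ and let $\mathcal Y^{k,\ell}_\rho(I)$ be the space of bounded continuous functions from $I$ to $K^k_\rho\oplus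 Y^\ell_\rho$. The auxiliary system for a complex $w$ and a real $\varphi$ is $$\partial_t w=\frac{i}{2t^2}\Delta w+\frac1{2t^2}\big(2\nabla\varphi\cdot\nabla+(\Delta\varphi)\big)w,\qquad \partial_t\varphi=\frac1{2t^2}|\nabla\varphi|^2+t^{-\gamma}g_0(w,w),\tag{1}$$ where $g_0(w_1,w_2)=\kappa\,\mathrm{Re}\,|\nabla|^{\mu-n}(w_1\overline{w_2})$. Given $w_+$ and an integer $p\ge0$, let $w_0=w_+$ and let $w_{m+1},\varphi_m$ $(0\le m\le p)$ be the solution on $[1,\infty)$ of $$\partial_t w_{m+1}=\frac1{2t^2}\sum_{j=0}^m\big(2\nabla\varphi_j\cdot\nabla+(\Delta\varphi_j)\big)w_{m-j},\qquad w_{m+1}(\infty)=0,$$ $$\partial_t\varphi_m=\frac1{2t^2}\sum_{j=0}^{m-1}\nabla\varphi_j\cdot\nabla\varphi_{m-1-j}+t^{-\gamma}\sum_{j=0}^m g_0(w_j,w_{m-j}),\qquad \varphi_m(1)=0,$$ and put $W_m=\sum_{j\le m}w_j$, $\phi_m=\sum_{j\le m}\varphi_j$. For a function $h_0$ on $[1,\infty)$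 let $h(t)=\int_1^\infty\max(t,s)^{-1}h_0'(s)\,ds$ and $$N_m(t)=\int_1^t h_0'h^m\,ds,\quad Q_m(t)=\int_1^\infty \max(t,s)^{-1}h_0'(s)h(s)^m\,ds,\quad P_m(t)=\int_1^\infty h(\max(t,s))\,h_0'(s)h(s)^m\,ds .$$ **Proposition 5.3.** Let $p\ge0$ be an integer, let $(k,\ell,k_0)$ satisfy $$k>\tfrac n2+(p-2)\bar\lambda+\max(\lambda,0),\quad k\ge k_0-\bar\lambda+2,\quad \ell\ge k_0-\lambda,\quad k_0>\tfrac n2,\quad k_0\ge(p+2)\bar\lambda-1,$$ and let $k_m=k_0-m\bar\lambda$, $\ell_m=k_0-\lambda-m\bar\lambda$ for $0\le m\le p+1$. Let $h_0$ be a $\mathcal C^1$ positive increasing function on $[1,\infty)$ with $t^{-2}h_0,\ t^{-1}h_0'\in L^1([1,\infty))$ and $t^{-\gamma}\le c\,h_0'$ for a constant $c$, and let $T\ge2$. Then there is a function $A$ of two real variables, depending only on $n,\mu,\gamma,\kappa,\ell_<,p,k,\ell,k_0,h_0,c,T$ (and not on $\nu$, $\rho$ or the solution), such that the following holds. Let $(w,\varphi)$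 be a solution of (1) on $[T,\infty)$ with $(w,h_0^{-1}\varphi)\in\mathcal Y^{k,\ell}_\rho([T,\infty))$, and let $a=\sup_{t\ge T}|w(t)|_k$, $b=\sup_{t\ge T}h_0(t)^{-1}|\varphi(t)|_\ell$. Then there is $w_+\in K^k_\rho$ such that $w(t)\to w_+$ strongly in $K^{k'}_\rho$ for every $k'<k$ as $t\to\infty$; the functions $w_{m+1},\varphi_m$ $(0\le m\le p)$ associated with $w_+$ exist; and for $0\le m\le p$ and all $t\ge T$ $$|w(t)-W_m(t)|_{k_{m+1}}\le A(a,b)\,Q_m(t),\qquad |\varphi(t)-\phi_m(t)|_{\ell_{m+1}}\le A(a,b)\,N_{m+1}(t).$$ If in addition $(p+2)\gamma>1$ and $P_p(1)<\infty$, then $\varphi(t)-\phi_p(t)$ converges strongly in $Y^{\ell_{p+1}}_\rho$ as $t\to\infty$ to some $\psi_+\in Y^{\ell_{p+1}}_\rho$, and for all $t\ge T$ $$|\varphi(t)-\phi_p(t)-\psi_+|_{\ell_{p+1}}\le A(a,b)\,P_p(t).$$ -/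

import Mathlib

open MeasureTheory Filter Topology Set
open scoped SchwartzMap FourierTransform LineDeriv Laplacian ENNReal

noncomputable section

namespace GinibreVelo

/-- Euclidean space `ℝⁿ`. -/
abbrev Sp (n : ℕ) := EuclideanSpace ℝ (Fin n)

/-- Complex tempered distributions on `ℝⁿ`. -/
abbrev TD (n : ℕ) := 𝓢'(Sp n, ℂ)

/-! ### Fourier transform -/

/-- `g` is a locally integrable function which is the Fourier transform `û` of the tempered
distribution `u`, for the unitary normalisation
`û(ξ) = (2π)^(-n/2) ∫ exp(-i x·ξ) u(x) dx`, in which `∇` becomes multiplication by `iξ`.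
The Mathlib transform `𝓕 u (η) = ∫ exp(-2πi x·η) u(x) dx` is `(2π)^(n/2) û(2πη)`. -/
def HasFourier {n : ℕ} (u : TD n) (g : Sp n → ℂ) : Prop :=
  LocallyIntegrable g ∧
  (∀ θ : 𝓢(Sp n, ℂ), Integrable fun η : Sp n => θ η * g ((2 * Real.pi) • η)) ∧
  ∀ θ : 𝓢(Sp n, ℂ), 𝓕 u θ =
    ((2 * Real.pi) ^ ((n : ℝ) / 2) : ℝ) * ∫ η : Sp n, θ η * g ((2 * Real.pi) • η)

open Classical in
/-- The Fourier transform `û` of a tempered distribution with locally integrable Fourier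
transform (unique almost everywhere). -/
def fhat {n : ℕ} (u : TD n) : Sp n → ℂ :=
  if h : ∃ g, HasFourier u g then h.choose else 0

open Classical in
/-- The (unique) tempered distribution with Fourier transform `g`. -/
def ofFourier {n : ℕ} (g : Sp n → ℂ) : TD n :=
  if h : ∃ u : TD n, HasFourier u g then h.choose else 0

/-! ### Operations on tempered distributions -/

open Classical in
/-- The product `u v`, characterised by `(u v)^ = (2π)^(-n/2) û * v̂`, for distributions whose
Fourier transforms are functions with almost everywhere absolutely convergent convolution. -/
def mul {n : ℕ} (u v : TD n) : TD n :=
  if ∀ᵐ ξ : Sp n, Integrable (fun η : Sp n => fhat u (ξ - η) * fhat v η) then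
    ofFourier fun ξ => ((2 * Real.pi) ^ (-(n : ℝ) / 2) : ℝ) *
      ∫ η : Sp n, fhat u (ξ - η) * fhat v η
  else 0

/-- The complex conjugate of a Schwartz function. -/
def conjS {n : ℕ} : 𝓢(Sp n, ℂ) →L[ℝ] 𝓢(Sp n, ℂ) :=
  SchwartzMap.postcompCLM (Complex.conjCLE : ℂ →L[ℝ] ℂ)

/-- The complex conjugate of a tempered distribution, `⟨ū, θ⟩ = conj ⟨u, conj θ⟩`. -/
def conjD {n : ℕ} (u : TD n) : TD n :=
  ContinuousLinearMap.toPointwiseConvergenceCLM _ _ _ _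
    { toFun := fun θ => (starRingEnd ℂ) (u (conjS θ))
      map_add' := fun θ₁ θ₂ => by simp
      map_smul' := fun c θ => by
        have h : conjS (c • θ) = (starRingEnd ℂ c) • conjS θ := by
          ext x
          simp [conjS]
        simp [h]
      cont := Complex.continuous_conj.comp
        ((ContinuousLinearMap.continuous (u : 𝓢(Sp n, ℂ) →L[ℂ] ℂ)).comp conjS.continuous) }

/-- The real part `(u + ū) / 2`. -/
def reD {n : ℕ} (u : TD n) : TD n := (1 / 2 : ℂ) • (u + conjD u)

/-- The operator `|∇|^s`, i.e. multiplication by `|ξ|^s` in Fourier variables. -/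
def absNabla {n : ℕ} (s : ℝ) (u : TD n) : TD n :=
  ofFourier fun ξ => ((‖ξ‖ ^ s : ℝ) : ℂ) * fhat u ξ

/-- The partial derivative `∂ᵢ u`. -/
def pd {n : ℕ} (i : Fin n) (u : TD n) : TD n := ∂_{EuclideanSpace.single i (1 : ℝ)} u

/-- `∇u · ∇v`. -/
def gradDot {n : ℕ} (u v : TD n) : TD n := ∑ i, mul (pd i u) (pd i v)

/-- `(2 ∇φ · ∇ + (Δφ)) w`. -/
def transport {n : ℕ} (φ w : TD n) : TD n := (2 : ℂ) • gradDot φ w + mul (Δ φ) w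

/-- `g₀(w₁, w₂) = κ Re |∇|^(μ - n) w₁ w̄₂`. -/
def g0 {n : ℕ} (κ μ : ℝ) (w₁ w₂ : TD n) : TD n :=
  (κ : ℂ) • reD (absNabla (μ - n) (mul w₁ (conjD w₂)))

/-! ### Gevrey spaces -/

/-- The weight `f(ξ) |ξ|^hi` for `|ξ| > 1` and `f(ξ) |ξ|^lo` for `|ξ| ≤ 1`, where
`f(ξ) = exp(ρ (|ξ|^ν ∨ 1))`. -/
def weight {n : ℕ} (ρ ν hi lo : ℝ) (ξ : Sp n) : ℝ :=
  Real.exp (ρ * max (‖ξ‖ ^ ν) 1) * (if 1 < ‖ξ‖ then ‖ξ‖ ^ hi else ‖ξ‖ ^ lo)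

open Classical in
/-- The `L²` norm of `û` times the weight; it is `∞` if `û` is not a locally integrable function. -/
def gevreyNorm {n : ℕ} (ρ ν hi lo : ℝ) (u : TD n) : ℝ≥0∞ :=
  if ∃ g, HasFourier u g then
    eLpNorm (fun ξ => (weight ρ ν hi lo ξ : ℂ) * fhat u ξ) 2 volume
  else ⊤

/-- The norm `|w|_k` of `K_ρ^k`; `w` belongs to `K_ρ^k` iff it is finite. -/
def KNorm {n : ℕ} (ρ ν k : ℝ) (w : TD n) : ℝ≥0∞ := gevreyNorm ρ ν k 0 w

/-- The norm `|φ|_ℓ` of `Y_ρ^ℓ`, with low frequency exponent `ℓ_< = llow`;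
`φ` belongs to `Y_ρ^ℓ` iff it is finite. -/
def YNorm {n : ℕ} (ρ ν llow l : ℝ) (φ : TD n) : ℝ≥0∞ := gevreyNorm ρ ν (l + 2) llow φ

/-- `(w, φ) ∈ (𝒞 ∩ L^∞)(I, K_ρ^k ⊕ Y_ρ^ℓ)`, with `ρ` independent of time. -/
structure MemCalY {n : ℕ} (ρ ν llow k l : ℝ) (I : Set ℝ) (w φ : ℝ → TD n) : Prop where
  bdd_w : ⨆ t ∈ I, KNorm ρ ν k (w t) < ⊤
  bdd_φ : ⨆ t ∈ I, YNorm ρ ν llow l (φ t) < ⊤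
  cont_w : ∀ t ∈ I, Tendsto (fun s => KNorm ρ ν k (w s - w t)) (𝓝[I] t) (𝓝 0)
  cont_φ : ∀ t ∈ I, Tendsto (fun s => YNorm ρ ν llow l (φ s - φ t)) (𝓝[I] t) (𝓝 0)

/-! ### The auxiliary system and its asymptotic functions -/

/-- `∂_t u = R` in `𝓢'` on the interval `I`. -/
def HasTimeDeriv {n : ℕ} (I : Set ℝ) (u R : ℝ → TD n) : Prop :=
  ∀ t ∈ I, ∀ θ : 𝓢(Sp n, ℂ), HasDerivWithinAt (fun s => u s θ) (R t θ) I t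

/-- `(w, φ)`, with `φ` real, solves on `I` the auxiliary system
`∂_t w = i (2t²)⁻¹ Δw + (2t²)⁻¹ (2 ∇φ·∇ + (Δφ)) w`,
`∂_t φ = (2t²)⁻¹ |∇φ|² + t^(-γ) g₀(w, w)`. -/
structure IsAuxSolution {n : ℕ} (κ μ γ : ℝ) (I : Set ℝ) (w φ : ℝ → TD n) : Prop where
  real_φ : ∀ t ∈ I, conjD (φ t) = φ t
  eq_w : HasTimeDeriv I w fun t =>
    (Complex.I * (2 * t ^ 2 : ℂ)⁻¹) • Δ (w t) + (2 * t ^ 2 : ℂ)⁻¹ • transport (φ t) (w t)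
  eq_φ : HasTimeDeriv I φ fun t =>
    (2 * t ^ 2 : ℂ)⁻¹ • gradDot (φ t) (φ t) + ((t ^ (-γ) : ℝ) : ℂ) • g0 κ μ (w t) (w t)

/-- `w_0 = w₊, w_1, …, w_{p+1}` and `φ_0, …, φ_p` solve on `[1, ∞)` the asymptotic system
`∂_t w_{m+1} = (2t²)⁻¹ ∑_{0≤j≤m} (2 ∇φ_j·∇ + (Δφ_j)) w_{m-j}`,
`∂_t φ_m = (2t²)⁻¹ ∑_{0≤j≤m-1} ∇φ_j·∇φ_{m-1-j} + t^(-γ) ∑_{0≤j≤m} g₀(w_j, w_{m-j})`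
for `0 ≤ m ≤ p`, with `w_{m+1}(∞) = 0` and `φ_m(1) = 0`. -/
structure IsAsymptoticFamily {n : ℕ} (κ μ γ : ℝ) (p : ℕ) (wplus : TD n)
    (wm φm : ℕ → ℝ → TD n) : Prop where
  w_zero : ∀ t ∈ Ici (1 : ℝ), wm 0 t = wplus
  eq_w : ∀ m ≤ p, HasTimeDeriv (Ici 1) (wm (m + 1)) fun t =>
    (2 * t ^ 2 : ℂ)⁻¹ • ∑ j ∈ Finset.range (m + 1), transport (φm j t) (wm (m - j) t)
  w_infty : ∀ m ≤ p, Tendsto (wm (m + 1)) atTop (𝓝 0)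
  eq_φ : ∀ m ≤ p, HasTimeDeriv (Ici 1) (φm m) fun t =>
    (2 * t ^ 2 : ℂ)⁻¹ • ∑ j ∈ Finset.range m, gradDot (φm j t) (φm (m - 1 - j) t) +
      ((t ^ (-γ) : ℝ) : ℂ) • ∑ j ∈ Finset.range (m + 1), g0 κ μ (wm j t) (wm (m - j) t)
  φ_one : ∀ m ≤ p, φm m 1 = 0

/-- `w₊ ∈ K_ρ^k` is the limit of `w(t)` as `t → ∞`, strongly in `K_ρ^k'` for every `k' < k`. -/
def IsAsymptoticState {n : ℕ} (ρ ν k : ℝ) (w : ℝ → TD n) (wplus : TD n) : Prop :=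
  KNorm ρ ν k wplus < ⊤ ∧
    ∀ k' < k, Tendsto (fun t => KNorm ρ ν k' (w t - wplus)) atTop (𝓝 0)

/-! ### Estimating functions of time, in terms of `d = h₀'` -/

/-- `h(t) = ∫_1^∞ (t ∨ s)⁻¹ h₀'(s) ds`. -/
def hFun (d : ℝ → ℝ) (t : ℝ) : ℝ := ∫ s in Ioi 1, (max t s)⁻¹ * d s

/-- `N_m(t) = ∫_1^t h₀'(s) h(s)^m ds`. -/
def NFun (d : ℝ → ℝ) (m : ℕ) (t : ℝ) : ℝ := ∫ s in (1)..t, d s * hFun d s ^ m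

/-- `Q_m(t) = ∫_1^∞ (t ∨ s)⁻¹ h₀'(s) h(s)^m ds`. -/
def QFun (d : ℝ → ℝ) (m : ℕ) (t : ℝ) : ℝ := ∫ s in Ioi 1, (max t s)⁻¹ * d s * hFun d s ^ m

/-- `P_m(t) = ∫_1^∞ h(t ∨ s) h₀'(s) h(s)^m ds`. -/
def PFun (d : ℝ → ℝ) (m : ℕ) (t : ℝ) : ℝ :=
  ∫ s in Ioi 1, hFun d (max t s) * d s * hFun d s ^ m

/-- `P_m(1) = ∫_1^∞ h₀'(s) h(s)^(m+1) ds < ∞`. -/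
def PFinite (d : ℝ → ℝ) (m : ℕ) : Prop :=
  IntegrableOn (fun s => d s * hFun d s ^ (m + 1)) (Ioi 1)

end GinibreVelo

end

noncomputable section

namespace GinibreVelo

/-! ### Distributions with locally integrable Fourier transform -/

/-! The expansion comes from dropping the dispersive term `iΔw/(2t²)` and solving the rest order by
order. After the first m terms of each expansion are subtracted, the nonlinear terms regroup into a
convolution sum of the same shape as the source of the next correction, with some factors replaced
by remainders (`bilin_remainder`). One set of estimates therefore serves corrections and remainders.
The dispersive term is `O(t⁻²)` two derivatives lower, and it is absorbed by `t⁻² N_m(t)` on `[T,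
∞)` because `N_m(T) > 0`.

Space. In the scale with exponents `k_m` and `ℓ_m`, the transport term and the quadratic gradient
term raise the total index by one, while `g0` preserves it; this is the structure `Scheme`, built in
`exists_scheme`. All three rest on one weighted convolution estimate, `exists_mul_bound`: the weight
at `ξ` is at most the product of the weights at `ξ - η` and `η` times a sum of square integrable
functions of a single variable. Since `0 ≤ ν ≤ 1`, the exponential factor is submultiplicative, so
no constant depends on `ρ` or `ν`.

Time. Corrections satisfy `φ_m = O(N_m)` and `w_{m+1} = O(Q_m)`. Integrating `t⁻² N_m` from infinity
gives exactly `Q_m`. The phase source at order m+1 is bounded by `t⁻² N_0 N_m + h₀'(Q_m + h^(m+1))`;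
the explicit function `phaseBound`, itself at most `5 N_{m+1}`, has a derivative dominating it
(`le_phaseRate`). Its increments are also at most `5 P_m`, which yields the limit `ψ₊`.

Weak formulation. The equations hold only against test functions. The weighted norm is dual to
`testNorm` on Schwartz functions, with constant one (`enorm_fourier_le`,
`exists_gevreyNorm_le_of_functional`). Hence the mean value inequality, limits and time integrals
all reduce to scalar statements for each test function.

The induction alternates `φ_0, w_1, φ_1, w_2, …`. Amplitudes are integrated backwards from infinity;
phases are integrated forwards, from 1 for the corrections and from `T` for the remainders.
`Scheme.exists_remBound` carries this induction and `Scheme.exists_asymptotics` collects the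
consequences. -/

theorem quasiMeasurePreserving_two_pi_smul (n : ℕ) :
    Measure.QuasiMeasurePreserving (fun η : Sp n => (2 * Real.pi) • η) volume volume := by
  refine ⟨measurable_const_smul _, ?_⟩
  rw [Measure.map_addHaar_smul volume (by positivity)]
  exact Measure.smul_absolutelyContinuous

theorem quasiMeasurePreserving_inv_two_pi_smul (n : ℕ) :
    Measure.QuasiMeasurePreserving (fun η : Sp n => (2 * Real.pi)⁻¹ • η) volume volume := by
  refine ⟨measurable_const_smul _, ?_⟩
  rw [Measure.map_addHaar_smul volume (by positivity)]
  exact Measure.smul_absolutelyContinuous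

theorem smul_inv_two_pi {n : ℕ} (ξ : Sp n) : (2 * Real.pi) • ((2 * Real.pi)⁻¹ • ξ) = ξ :=
  smul_inv_smul₀ (by positivity) ξ

theorem inv_two_pi_smul {n : ℕ} (ξ : Sp n) : (2 * Real.pi)⁻¹ • ((2 * Real.pi) • ξ) = ξ :=
  inv_smul_smul₀ (by positivity) ξ

theorem HasFourier.congr {n : ℕ} {u : TD n} {g g' : Sp n → ℂ} (h : HasFourier u g)
    (hg : g =ᵐ[volume] g') : HasFourier u g' := by
  have h2 : (fun η : Sp n => g ((2 * Real.pi) • η)) =ᵐ[volume] fun η => g' ((2 * Real.pi) • η) :=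
    (quasiMeasurePreserving_two_pi_smul n).ae_eq_comp hg
  have h3 (θ : 𝓢(Sp n, ℂ)) : (fun η : Sp n => θ η * g ((2 * Real.pi) • η)) =ᵐ[volume]
      fun η => θ η * g' ((2 * Real.pi) • η) := by
    filter_upwards [h2] with η hη
    rw [hη]
  refine ⟨h.1.congr hg, fun θ => (h.2.1 θ).congr (h3 θ), fun θ => ?_⟩
  rw [h.2.2 θ, integral_congr_ae (h3 θ)]

theorem locallyIntegrable_comp_smul {n : ℕ} {g : Sp n → ℂ} (hg : LocallyIntegrable g) {a : ℝ}
    (ha : a ≠ 0) : LocallyIntegrable fun η : Sp n => g (a • η) := by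
  rw [locallyIntegrable_iff]
  intro K hK
  have h1 : IntegrableOn g ((fun η : Sp n => a • η) '' K) :=
    (locallyIntegrable_iff.1 hg) _ (hK.image (continuous_const_smul _))
  rw [← integrable_indicator_iff (hK.image (continuous_const_smul _)).measurableSet] at h1
  rw [← integrable_indicator_iff hK.measurableSet]
  have h2 := h1.comp_smul ha
  refine h2.congr (Eventually.of_forall fun η => ?_)
  have : a • η ∈ (fun η : Sp n => a • η) '' K ↔ η ∈ K :=
    (smul_right_injective _ ha).mem_set_image
  change ((fun η : Sp n => a • η) '' K).indicator g (a • η) = _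
  by_cases hη : η ∈ K
  · rw [Set.indicator_of_mem (this.2 hη), Set.indicator_of_mem hη]
  · rw [Set.indicator_of_notMem (fun h => hη (this.1 h)), Set.indicator_of_notMem hη]

theorem HasFourier.locallyIntegrable_scaled {n : ℕ} {u : TD n} {g : Sp n → ℂ}
    (h : HasFourier u g) : LocallyIntegrable fun η : Sp n => g ((2 * Real.pi) • η) :=
  locallyIntegrable_comp_smul h.1 (by positivity)

/-- Real smooth compactly supported functions already separate locally integrable functions. The
equality obtained at the points `2πη` is carried back by the inverse dilation, which preserves null
sets. -/
theorem HasFourier.ae_eq {n : ℕ} {u : TD n} {g g' : Sp n → ℂ} (h : HasFourier u g)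
    (h' : HasFourier u g') : g =ᵐ[volume] g' := by
  have hc : (((2 * Real.pi) ^ ((n : ℝ) / 2) : ℝ) : ℂ) ≠ 0 := by
    have : (0 : ℝ) < (2 * Real.pi) ^ ((n : ℝ) / 2) := by positivity
    exact_mod_cast this.ne'
  have key : ∀ᵐ η : Sp n, g ((2 * Real.pi) • η) - g' ((2 * Real.pi) • η) = 0 := by
    apply ae_eq_zero_of_integral_contDiff_smul_eq_zero
      (h.locallyIntegrable_scaled.sub h'.locallyIntegrable_scaled)
    intro θ hθ hθc
    have hg₁ : HasCompactSupport (Complex.ofRealCLM ∘ θ) := hθc.comp_left rfl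
    have hg₂ : ContDiff ℝ (⊤ : ℕ∞) (Complex.ofRealCLM ∘ θ) := by fun_prop
    have e1 := h.2.2 (hg₁.toSchwartzMap hg₂)
    have e2 := h'.2.2 (hg₁.toSchwartzMap hg₂)
    have e3 := mul_left_cancel₀ hc (e1.symm.trans e2)
    have i1 := h.2.1 (hg₁.toSchwartzMap hg₂)
    have i2 := h'.2.1 (hg₁.toSchwartzMap hg₂)
    have e4 : (∫ η : Sp n, hg₁.toSchwartzMap hg₂ η * g ((2 * Real.pi) • η) -
        hg₁.toSchwartzMap hg₂ η * g' ((2 * Real.pi) • η)) = 0 := by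
      rw [integral_sub i1 i2, e3, sub_self]
    rw [← e4]
    congr 1 with η
    simp [mul_sub]
  have := (quasiMeasurePreserving_inv_two_pi_smul n).ae key
  filter_upwards [this] with ξ hξ
  rw [smul_inv_two_pi] at hξ
  exact sub_eq_zero.1 hξ

theorem fourier_injective {n : ℕ} {u v : TD n} (h : 𝓕 u = 𝓕 v) : u = v := by
  have h' := congrArg (fun w : TD n => (𝓕⁻ w : TD n)) h
  simpa using h'

theorem HasFourier.unique {n : ℕ} {u v : TD n} {g : Sp n → ℂ} (h : HasFourier u g)
    (h' : HasFourier v g) : u = v := by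
  apply fourier_injective
  ext θ
  rw [h.2.2, h'.2.2]

theorem HasFourier.fhat_self {n : ℕ} {u : TD n} {g : Sp n → ℂ} (h : HasFourier u g) :
    HasFourier u (fhat u) := by
  have h' : ∃ g, HasFourier u g := ⟨g, h⟩
  rw [fhat, dif_pos h']
  exact h'.choose_spec

theorem HasFourier.fhat_ae_eq {n : ℕ} {u : TD n} {g : Sp n → ℂ} (h : HasFourier u g) :
    fhat u =ᵐ[volume] g :=
  h.fhat_self.ae_eq h

theorem HasFourier.ofFourier_eq {n : ℕ} {u : TD n} {g : Sp n → ℂ} (h : HasFourier u g) :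
    ofFourier g = u := by
  have h' : ∃ u, HasFourier u g := ⟨u, h⟩
  rw [ofFourier, dif_pos h']
  exact h'.choose_spec.unique h

theorem HasFourier.add {n : ℕ} {u v : TD n} {g g' : Sp n → ℂ} (h : HasFourier u g)
    (h' : HasFourier v g') : HasFourier (u + v) (fun ξ => g ξ + g' ξ) := by
  refine ⟨h.1.add h'.1, fun θ => ?_, fun θ => ?_⟩
  · simp_rw [mul_add]
    exact (h.2.1 θ).add (h'.2.1 θ)
  · simp_rw [mul_add]
    rw [integral_add (h.2.1 θ) (h'.2.1 θ), mul_add, ← h.2.2, ← h'.2.2]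
    rfl

theorem HasFourier.smul {n : ℕ} {u : TD n} {g : Sp n → ℂ} (c : ℂ) (h : HasFourier u g) :
    HasFourier (c • u) (fun ξ => c * g ξ) := by
  have e (θ : 𝓢(Sp n, ℂ)) (η : Sp n) :
      θ η * (c * g ((2 * Real.pi) • η)) = c * (θ η * g ((2 * Real.pi) • η)) := by ring
  refine ⟨h.1.smul c, fun θ => ?_, fun θ => ?_⟩
  · simp_rw [e]
    exact (h.2.1 θ).const_mul c
  · simp_rw [e]
    rw [integral_const_mul, mul_left_comm, ← h.2.2]
    rfl

theorem HasFourier.sub {n : ℕ} {u v : TD n} {g g' : Sp n → ℂ} (h : HasFourier u g)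
    (h' : HasFourier v g') : HasFourier (u - v) (fun ξ => g ξ - g' ξ) := by
  have := h.add (h'.smul (-1))
  have e : u - v = u + (-1 : ℂ) • v := by
    ext θ
    change u θ - v θ = u θ + (-1 : ℂ) * v θ
    ring
  rw [e]
  simpa [sub_eq_add_neg] using this

theorem HasFourier.zero (n : ℕ) : HasFourier (0 : TD n) (fun _ => 0) := by
  refine ⟨locallyIntegrable_const 0, fun θ => by simp, fun θ => by simp⟩

theorem HasFourier.sum {n : ℕ} {ι : Type*} (s : Finset ι) {u : ι → TD n} {g : ι → Sp n → ℂ}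
    (h : ∀ i ∈ s, HasFourier (u i) (g i)) :
    HasFourier (∑ i ∈ s, u i) (fun ξ => ∑ i ∈ s, g i ξ) := by
  classical
  induction s using Finset.induction_on with
  | empty => simpa using HasFourier.zero n
  | insert a s ha ih =>
    simp_rw [Finset.sum_insert ha]
    exact (h a (by simp)).add (ih fun i hi => h i (by simp [hi]))

theorem HasFourier.pd {n : ℕ} {u : TD n} {g : Sp n → ℂ} (i : Fin n) (h : HasFourier u g) :
    HasFourier (pd i u) (fun ξ => Complex.I * (ξ i : ℂ) * g ξ) := by
  have hT : (fun x : Sp n => ((inner ℝ x (EuclideanSpace.single i (1 : ℝ)) : ℝ) : ℂ)).HasTemperateGrowth := by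
    fun_prop
  have key (θ : 𝓢(Sp n, ℂ)) (η : Sp n) :
      θ η * (Complex.I * ((((2 * Real.pi) • η) i : ℝ) : ℂ) * g ((2 * Real.pi) • η)) =
      (2 * Real.pi * Complex.I) * (SchwartzMap.smulLeftCLM ℂ
        (fun x : Sp n => ((inner ℝ x (EuclideanSpace.single i (1 : ℝ)) : ℝ) : ℂ)) θ η
          * g ((2 * Real.pi) • η)) := by
    rw [SchwartzMap.smulLeftCLM_apply_apply hT]
    simp [EuclideanSpace.inner_single_right]
    ring
  refine ⟨?_, fun θ => ?_, fun θ => ?_⟩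
  · have hc : Continuous fun ξ : Sp n => Complex.I * (ξ i : ℂ) := by fun_prop
    exact h.1.continuous_mul hc
  · simp_rw [key]
    exact (h.2.1 _).const_mul _
  · simp_rw [key]
    rw [integral_const_mul, GinibreVelo.pd, TemperedDistribution.fourier_lineDerivOp_eq,
      mul_left_comm, ← h.2.2]
    rfl

theorem laplacian_eq_sum_pd {n : ℕ} (u : TD n) :
    Δ u = ∑ i, GinibreVelo.pd i (GinibreVelo.pd i u) := by
  rw [TemperedDistribution.laplacian_eq_sum (EuclideanSpace.basisFun (Fin n) ℝ)]
  simp [GinibreVelo.pd]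

theorem HasFourier.laplacian {n : ℕ} {u : TD n} {g : Sp n → ℂ} (h : HasFourier u g) :
    HasFourier (Δ u) (fun ξ => -((‖ξ‖ ^ 2 : ℝ) : ℂ) * g ξ) := by
  rw [laplacian_eq_sum_pd]
  convert HasFourier.sum Finset.univ fun i _ => (h.pd i).pd i using 2 with ξ
  rw [EuclideanSpace.norm_sq_eq, Complex.ofReal_sum, neg_mul, Finset.sum_mul,
    ← Finset.sum_neg_distrib]
  refine Finset.sum_congr rfl fun i _ => ?_
  simp only [Real.norm_eq_abs, sq_abs, Complex.ofReal_pow]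
  linear_combination (-((ξ i : ℂ) ^ 2 * g ξ)) * Complex.I_sq

/-- The Schwartz function `x ↦ conj θ(-x)`. -/
def reflConj {n : ℕ} (θ : 𝓢(Sp n, ℂ)) : 𝓢(Sp n, ℂ) :=
  conjS (SchwartzMap.compCLMOfContinuousLinearEquiv ℂ (ContinuousLinearEquiv.neg ℝ (M := Sp n)) θ)

theorem reflConj_apply {n : ℕ} (θ : 𝓢(Sp n, ℂ)) (x : Sp n) :
    reflConj θ x = (starRingEnd ℂ) (θ (-x)) := by
  simp [reflConj, conjS]

/-- Conjugating the exponential is compensated by `x ↦ -x`. This moves the conjugation in `conjD`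
across the Fourier transform. -/
theorem fourier_reflConj {n : ℕ} (θ : 𝓢(Sp n, ℂ)) : 𝓕 (reflConj θ) = conjS (𝓕 θ) := by
  ext ξ
  have : conjS (𝓕 θ) ξ = (starRingEnd ℂ) (𝓕 θ ξ) := by simp [conjS]
  rw [this, SchwartzMap.fourier_coe, SchwartzMap.fourier_coe, Real.fourier_eq', Real.fourier_eq',
    ← integral_conj, ← integral_neg_eq_self]
  congr 1 with x
  have h2 : (starRingEnd ℂ) 2 = 2 := Complex.conj_ofNat 2
  simp [reflConj_apply, ← Complex.exp_conj, h2]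

theorem HasFourier.conjD {n : ℕ} {u : TD n} {g : Sp n → ℂ} (h : HasFourier u g) :
    HasFourier (conjD u) (fun ξ => (starRingEnd ℂ) (g (-ξ))) := by
  have key (θ : 𝓢(Sp n, ℂ)) (η : Sp n) :
      θ η * (starRingEnd ℂ) (g (-((2 * Real.pi) • η))) =
      (starRingEnd ℂ) (reflConj θ (-η) * g ((2 * Real.pi) • (-η))) := by
    simp [reflConj_apply]
  refine ⟨?_, fun θ => ?_, fun θ => ?_⟩
  · have h1 := locallyIntegrable_comp_smul h.1 (a := -1) (by norm_num)
    rw [locallyIntegrable_iff] at h1 ⊢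
    intro K hK
    have h2 := (Complex.conjCLE : ℂ →L[ℝ] ℂ).integrable_comp (h1 K hK)
    simpa [IntegrableOn] using h2
  · simp_rw [key]
    have := (h.2.1 (reflConj θ)).comp_neg
    exact (Complex.conjCLE : ℂ →L[ℝ] ℂ).integrable_comp this
  · simp_rw [key]
    rw [integral_conj, integral_neg_eq_self (fun η : Sp n => reflConj θ η * g ((2 * Real.pi) • η))]
    have e := h.2.2 (reflConj θ)
    have e2 : 𝓕 (GinibreVelo.conjD u) θ = (starRingEnd ℂ) (u (conjS (𝓕 θ))) := rfl
    rw [e2, ← fourier_reflConj, ← TemperedDistribution.fourier_apply, e, map_mul, Complex.conj_ofReal]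

/-! ### Weights -/

/-- The weight for `ρ = 0`: `|ξ|^hi` for `|ξ| > 1` and `|ξ|^lo` for `|ξ| ≤ 1`. -/
def powWeight {n : ℕ} (hi lo : ℝ) (ξ : Sp n) : ℝ := if 1 < ‖ξ‖ then ‖ξ‖ ^ hi else ‖ξ‖ ^ lo

theorem weight_eq {n : ℕ} (ρ ν hi lo : ℝ) (ξ : Sp n) :
    weight ρ ν hi lo ξ = Real.exp (ρ * max (‖ξ‖ ^ ν) 1) * powWeight hi lo ξ := rfl

theorem powWeight_nonneg {n : ℕ} (hi lo : ℝ) (ξ : Sp n) : 0 ≤ powWeight hi lo ξ := by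
  unfold powWeight
  split_ifs <;> positivity

theorem powWeight_pos {n : ℕ} (hi lo : ℝ) {ξ : Sp n} (h : ξ ≠ 0) : 0 < powWeight hi lo ξ := by
  have : 0 < ‖ξ‖ := norm_pos_iff.2 h
  unfold powWeight
  split_ifs <;> positivity

theorem powWeight_add {n : ℕ} (h l h' l' : ℝ) {ξ : Sp n} (hξ : ξ ≠ 0) :
    powWeight (h + h') (l + l') ξ = powWeight h l ξ * powWeight h' l' ξ := by
  have : 0 < ‖ξ‖ := norm_pos_iff.2 hξ
  unfold powWeight
  split_ifs <;> rw [Real.rpow_add this]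

theorem powWeight_neg {n : ℕ} (h l : ℝ) (ξ : Sp n) :
    powWeight (-h) (-l) ξ = (powWeight h l ξ)⁻¹ := by
  unfold powWeight
  split_ifs <;> rw [Real.rpow_neg (norm_nonneg _)]

theorem powWeight_same {n : ℕ} (s : ℝ) (ξ : Sp n) : powWeight s s ξ = ‖ξ‖ ^ s := by
  simp [powWeight]

theorem powWeight_mono {n : ℕ} {h h' : ℝ} (hh : h ≤ h') (l : ℝ) (ξ : Sp n) :
    powWeight h l ξ ≤ powWeight h' l ξ := by
  unfold powWeight
  split_ifs with h1
  · exact Real.rpow_le_rpow_of_exponent_le h1.le hh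
  · exact le_rfl

theorem measurable_powWeight {n : ℕ} (hi lo : ℝ) : Measurable (powWeight hi lo : Sp n → ℝ) := by
  unfold powWeight
  exact Measurable.ite (measurableSet_lt measurable_const measurable_norm)
    (by fun_prop) (by fun_prop)

theorem measurable_weight {n : ℕ} (ρ ν hi lo : ℝ) : Measurable (weight ρ ν hi lo : Sp n → ℝ) := by
  have h := measurable_powWeight (n := n) hi lo
  have h2 : Measurable fun ξ : Sp n => Real.exp (ρ * max (‖ξ‖ ^ ν) 1) := by fun_prop
  exact h2.mul h

theorem weight_nonneg {n : ℕ} (ρ ν hi lo : ℝ) (ξ : Sp n) : 0 ≤ weight ρ ν hi lo ξ :=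
  mul_nonneg (Real.exp_pos _).le (powWeight_nonneg _ _ _)

theorem weight_pos {n : ℕ} (ρ ν hi lo : ℝ) {ξ : Sp n} (h : ξ ≠ 0) : 0 < weight ρ ν hi lo ξ :=
  mul_pos (Real.exp_pos _) (powWeight_pos _ _ h)

theorem powWeight_le_weight {n : ℕ} {ρ : ℝ} (hρ : 0 ≤ ρ) (ν hi lo : ℝ) (ξ : Sp n) :
    powWeight hi lo ξ ≤ weight ρ ν hi lo ξ := by
  rw [weight_eq]
  refine le_mul_of_one_le_left (powWeight_nonneg _ _ _) (Real.one_le_exp ?_)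
  positivity

theorem ae_ne_zero {n : ℕ} (hn : 0 < n) : ∀ᵐ ξ : Sp n, ξ ≠ 0 := by
  have : Nonempty (Fin n) := ⟨⟨0, hn⟩⟩
  exact Measure.ae_ne volume 0

/-- Polar coordinates reduce this to `r^(n-1+lo)` on `(0, 1]` and `r^(n-1+hi)` on `(1, ∞)`. -/
theorem integrable_powWeight {n : ℕ} (hn : 0 < n) {hi lo : ℝ} (h1 : hi < -(n : ℝ))
    (h2 : -(n : ℝ) < lo) : Integrable (powWeight hi lo : Sp n → ℝ) := by
  have : Nonempty (Fin n) := ⟨⟨0, hn⟩⟩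
  have := (integrable_fun_norm_addHaar (E := Sp n) volume
    (f := fun r : ℝ => if 1 < r then r ^ hi else r ^ lo)).2
  refine this ?_
  rw [finrank_euclideanSpace_fin, ← Ioc_union_Ioi_eq_Ioi zero_le_one]
  have hn1 : ((n - 1 : ℕ) : ℝ) = n - 1 := by
    rw [Nat.cast_sub (by omega), Nat.cast_one]
  refine IntegrableOn.union ?_ ?_
  · have h3 : IntegrableOn (fun r : ℝ => r ^ ((n : ℝ) - 1 + lo)) (Ioc 0 1) := by
      rw [← intervalIntegrable_iff_integrableOn_Ioc_of_le zero_le_one]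
      exact intervalIntegral.intervalIntegrable_rpow' (by linarith)
    refine h3.congr_fun (fun r hr => ?_) measurableSet_Ioc
    simp only [not_lt.2 hr.2, if_false, smul_eq_mul]
    rw [Real.rpow_add hr.1, ← hn1, Real.rpow_natCast]
  · have h3 : IntegrableOn (fun r : ℝ => r ^ ((n : ℝ) - 1 + hi)) (Ioi 1) :=
      integrableOn_Ioi_rpow_of_lt (by linarith) one_pos
    refine h3.congr_fun (fun r hr => ?_) measurableSet_Ioi
    have hr' : (1 : ℝ) < r := hr
    simp only [hr', if_true, smul_eq_mul]
    rw [Real.rpow_add (by linarith), ← hn1, Real.rpow_natCast]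

theorem memLp_powWeight {n : ℕ} (hn : 0 < n) {hi lo : ℝ} (h1 : hi < -((n : ℝ) / 2))
    (h2 : -((n : ℝ) / 2) < lo) : MemLp (powWeight hi lo : Sp n → ℝ) 2 := by
  rw [memLp_two_iff_integrable_sq (measurable_powWeight _ _).aestronglyMeasurable]
  have := integrable_powWeight hn (hi := hi + hi) (lo := lo + lo) (by linarith) (by linarith)
  refine this.congr ?_
  filter_upwards [ae_ne_zero hn] with ξ hξ
  rw [powWeight_add _ _ _ _ hξ, sq]

theorem inv_one_add_pow_mul_powWeight_le {n : ℕ} (M : ℕ) (hi lo : ℝ) (ξ : Sp n) :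
    ((1 + ‖ξ‖) ^ M)⁻¹ * powWeight hi lo ξ ≤ powWeight (hi - M) lo ξ := by
  unfold powWeight
  split_ifs with h
  · rw [Real.rpow_sub (by linarith), Real.rpow_natCast, div_eq_inv_mul]
    gcongr
    linarith
  · refine mul_le_of_le_one_left (by positivity) (inv_le_one_of_one_le₀ ?_)
    exact one_le_pow₀ (by linarith [norm_nonneg ξ])

/-! ### Functions of moderate growth are Fourier transforms -/

theorem norm_schwartz_mul_pow_le {n : ℕ} (M : ℕ) (θ : 𝓢(Sp n, ℂ)) (η : Sp n) :
    ‖θ η‖ * (1 + ‖(2 * Real.pi) • η‖) ^ M ≤ (2 * Real.pi) ^ M * 2 ^ M *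
      ((Finset.Iic (M, 0)).sup (schwartzSeminormFamily ℂ (Sp n) ℂ)) θ := by
  have h := SchwartzMap.one_add_le_sup_seminorm_apply (𝕜 := ℂ) (m := (M, 0)) (k := M) (n := 0)
    le_rfl le_rfl θ η
  rw [norm_iteratedFDeriv_zero] at h
  have h1 : 1 + ‖(2 * Real.pi) • η‖ ≤ (2 * Real.pi) * (1 + ‖η‖) := by
    rw [norm_smul, Real.norm_of_nonneg (by positivity)]
    nlinarith [Real.pi_gt_three]
  calc ‖θ η‖ * (1 + ‖(2 * Real.pi) • η‖) ^ M
      ≤ ‖θ η‖ * ((2 * Real.pi) * (1 + ‖η‖)) ^ M := by gcongr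
    _ = (2 * Real.pi) ^ M * ((1 + ‖η‖) ^ M * ‖θ η‖) := by rw [mul_pow]; ring
    _ ≤ _ := by
      rw [mul_assoc]
      exact mul_le_mul_of_nonneg_left h (by positivity)

/-- The decay of a Schwartz function beats the factor `(1 + |ξ|)^M`, so integration against `g` is
bounded by one Schwartz seminorm. It defines a tempered distribution, whose inverse Fourier
transform is the required one. -/
theorem exists_hasFourier_of_integrable {n : ℕ} {g : Sp n → ℂ} (M : ℕ)
    (h : Integrable fun ξ : Sp n => ((((1 + ‖ξ‖) ^ M)⁻¹ : ℝ) : ℂ) * g ξ) :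
    ∃ u : TD n, HasFourier u g := by
  have hs : Integrable fun η : Sp n => ((((1 + ‖(2 * Real.pi) • η‖) ^ M)⁻¹ : ℝ) : ℂ) *
      g ((2 * Real.pi) • η) := h.comp_smul (R := 2 * Real.pi) (by positivity)
  have hpos (ξ : Sp n) : (0 : ℝ) < (1 + ‖ξ‖) ^ M := by positivity
  have hloc : LocallyIntegrable g := by
    have hc : Continuous fun ξ : Sp n => (((1 + ‖ξ‖) ^ M : ℝ) : ℂ) := by fun_prop
    have := h.locallyIntegrable.continuous_mul hc
    refine this.congr (Eventually.of_forall fun ξ => ?_)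
    have := (hpos ξ).ne'
    change (((1 + ‖ξ‖) ^ M : ℝ) : ℂ) * (((((1 + ‖ξ‖) ^ M)⁻¹ : ℝ) : ℂ) * g ξ) = g ξ
    rw [← mul_assoc, ← Complex.ofReal_mul, mul_inv_cancel₀ this, Complex.ofReal_one, one_mul]
  set S : 𝓢(Sp n, ℂ) → ℝ := fun θ =>
    ((Finset.Iic (M, 0)).sup (schwartzSeminormFamily ℂ (Sp n) ℂ)) θ with hS
  have hb (θ : 𝓢(Sp n, ℂ)) (η : Sp n) : ‖θ η * g ((2 * Real.pi) • η)‖ ≤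
      (2 * Real.pi) ^ M * 2 ^ M * S θ * ‖((((1 + ‖(2 * Real.pi) • η‖) ^ M)⁻¹ : ℝ) : ℂ) *
      g ((2 * Real.pi) • η)‖ := by
    have h1 := norm_schwartz_mul_pow_le M θ η
    have h2 := hpos ((2 * Real.pi) • η)
    rw [norm_mul, norm_mul, Complex.norm_real, Real.norm_of_nonneg (by positivity), ← mul_assoc]
    gcongr
    rwa [← div_eq_mul_inv, le_div_iff₀ h2]
  have hi (θ : 𝓢(Sp n, ℂ)) : Integrable fun η : Sp n => θ η * g ((2 * Real.pi) • η) := by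
    refine Integrable.mono' (hs.norm.const_mul ((2 * Real.pi) ^ M * 2 ^ M * S θ)) ?_
      (Eventually.of_forall (hb θ))
    exact θ.continuous.aestronglyMeasurable.mul
      (hloc.aestronglyMeasurable.comp_quasiMeasurePreserving (quasiMeasurePreserving_two_pi_smul n))
  set c : ℂ := (((2 * Real.pi) ^ ((n : ℝ) / 2) : ℝ) : ℂ) with hc
  let L : 𝓢(Sp n, ℂ) →L[ℂ] ℂ := SchwartzMap.mkCLMtoNormedSpace (σ := RingHom.id ℂ)
    (fun θ => c * ∫ η : Sp n, θ η * g ((2 * Real.pi) • η))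
    (fun θ θ' => by
      simp only [add_apply, add_mul]
      rw [integral_add (hi θ) (hi θ'), mul_add])
    (fun a θ => by
      simp only [smul_apply, smul_eq_mul, mul_assoc, RingHom.id_apply]
      rw [integral_const_mul, mul_left_comm])
    ⟨Finset.Iic (M, 0), ‖c‖ * ((2 * Real.pi) ^ M * 2 ^ M * ∫ η : Sp n,
      ‖((((1 + ‖(2 * Real.pi) • η‖) ^ M)⁻¹ : ℝ) : ℂ) * g ((2 * Real.pi) • η)‖),
      mul_nonneg (norm_nonneg _) (mul_nonneg (by positivity)
        (integral_nonneg fun _ => norm_nonneg _)), fun θ => by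
      rw [norm_mul, mul_assoc]
      refine mul_le_mul_of_nonneg_left ?_ (norm_nonneg _)
      refine (norm_integral_le_integral_norm _).trans ?_
      refine (integral_mono (hi θ).norm (hs.norm.const_mul _) (hb θ)).trans ?_
      rw [integral_const_mul]
      apply le_of_eq
      ring⟩
  let v : TD n := ContinuousLinearMap.toPointwiseConvergenceCLM _ _ _ _ L
  refine ⟨𝓕⁻ v, hloc, hi, fun θ => ?_⟩
  have : 𝓕 (𝓕⁻ v) = v := FourierTransform.fourier_fourierInv_eq v
  rw [this]
  rfl

/-- By Cauchy–Schwarz against the inverse weight damped by `(1 + |ξ|)^(-M)`. Near the origin this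
needs `|ξ|^(-lo)` square integrable, that is `lo < n/2`; at infinity a large `M` suffices. -/
theorem exists_hasFourier_of_weight {n : ℕ} (hn : 0 < n) {ρ ν hi lo : ℝ} (hρ : 0 ≤ ρ)
    (hlo : lo < (n : ℝ) / 2) {g : Sp n → ℂ} (hg : AEStronglyMeasurable g)
    (h : eLpNorm (fun ξ => (weight ρ ν hi lo ξ : ℂ) * g ξ) 2 volume < ⊤) :
    ∃ u : TD n, HasFourier u g := by
  obtain ⟨M, hM⟩ := exists_nat_gt ((n : ℝ) / 2 - hi)
  have hF : MemLp (fun ξ => (weight ρ ν hi lo ξ : ℂ) * g ξ) 2 :=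
    ⟨(Complex.measurable_ofReal.comp (measurable_weight ρ ν hi lo)).aestronglyMeasurable.mul hg, h⟩
  have hP : MemLp (powWeight (-hi - M) (-lo) : Sp n → ℝ) 2 :=
    memLp_powWeight hn (by linarith) (by linarith)
  refine exists_hasFourier_of_integrable M ?_
  refine Integrable.mono' (hP.integrable_mul hF.norm) ?_ ?_
  · refine AEStronglyMeasurable.mul ?_ hg
    exact (by fun_prop : Measurable fun ξ : Sp n =>
      ((((1 + ‖ξ‖) ^ M)⁻¹ : ℝ) : ℂ)).aestronglyMeasurable
  · filter_upwards [ae_ne_zero hn] with ξ hξ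
    have h1 := inv_one_add_pow_mul_powWeight_le M (-hi) (-lo) ξ
    have h2 := powWeight_pos hi lo hξ
    have h3 := powWeight_le_weight hρ ν hi lo ξ
    simp only [Pi.mul_apply]
    rw [norm_mul, norm_mul, Complex.norm_real, Complex.norm_real,
      Real.norm_of_nonneg (by positivity), Real.norm_of_nonneg (weight_nonneg _ _ _ _ _)]
    calc ((1 + ‖ξ‖) ^ M)⁻¹ * ‖g ξ‖
        = ((1 + ‖ξ‖) ^ M)⁻¹ * powWeight (-hi) (-lo) ξ * (powWeight hi lo ξ * ‖g ξ‖) := by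
          rw [powWeight_neg]
          field_simp
      _ ≤ _ := by
          gcongr
          exact powWeight_nonneg _ _ _

/-! ### The weighted norms -/

theorem HasFourier.gevreyNorm_eq {n : ℕ} {u : TD n} {g : Sp n → ℂ} (h : HasFourier u g)
    (ρ ν hi lo : ℝ) :
    gevreyNorm ρ ν hi lo u = eLpNorm (fun ξ => (weight ρ ν hi lo ξ : ℂ) * g ξ) 2 volume := by
  rw [gevreyNorm, if_pos ⟨g, h⟩]
  refine eLpNorm_congr_ae ?_
  filter_upwards [h.fhat_ae_eq] with ξ hξ
  rw [hξ]

theorem hasFourier_fhat_of_lt_top {n : ℕ} {u : TD n} {ρ ν hi lo : ℝ}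
    (h : gevreyNorm ρ ν hi lo u < ⊤) : HasFourier u (fhat u) := by
  by_cases h' : ∃ g, HasFourier u g
  · exact h'.choose_spec.fhat_self
  · rw [gevreyNorm, if_neg h'] at h
    exact absurd h (lt_irrefl _)

/-- The dilation factor cancels the constant in `HasFourier`, so the duality between `gevreyNorm`
and `testNorm` holds without loss. -/
theorem eLpNorm_comp_two_pi {n : ℕ} {f : Sp n → ℂ} (hf : AEStronglyMeasurable f) :
    eLpNorm (fun η : Sp n => f ((2 * Real.pi) • η)) 2 volume =
      ENNReal.ofReal ((2 * Real.pi) ^ ((n : ℝ) / 2))⁻¹ * eLpNorm f 2 volume := by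
  have hm : Measure.map (fun η : Sp n => (2 * Real.pi) • η) volume =
      ENNReal.ofReal |((2 * Real.pi) ^ n)⁻¹| • (volume : Measure (Sp n)) := by
    have := Measure.map_addHaar_smul (volume : Measure (Sp n)) (r := 2 * Real.pi) (by positivity)
    simpa using this
  have h1 := eLpNorm_map_measure (p := 2) (g := f) (μ := (volume : Measure (Sp n)))
    (f := fun η : Sp n => (2 * Real.pi) • η) (by rw [hm]; exact hf.smul_measure _)
    (measurable_const_smul _).aemeasurable
  rw [hm, eLpNorm_smul_measure_of_ne_top (by norm_num)] at h1
  change _ = eLpNorm (fun η : Sp n => f ((2 * Real.pi) • η)) 2 volume at h1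
  rw [← h1, smul_eq_mul]
  congr 1
  rw [abs_of_pos (by positivity), ENNReal.ofReal_rpow_of_pos (by positivity)]
  congr 1
  rw [Real.inv_rpow (by positivity), ← Real.rpow_natCast, ← Real.rpow_mul (by positivity)]
  norm_num
  ring_nf

/-- The norm of a test function which is dual to `gevreyNorm`. -/
def testNorm {n : ℕ} (ρ ν hi lo : ℝ) (θ : 𝓢(Sp n, ℂ)) : ℝ≥0∞ :=
  eLpNorm (fun η : Sp n => (((weight ρ ν hi lo ((2 * Real.pi) • η))⁻¹ : ℝ) : ℂ) * θ η) 2 volume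

/-- The exponential only helps in the inverse weight, so it can be discarded. Schwartz decay handles
high frequencies for any `hi`, while low frequencies again require `lo < n/2`. -/
theorem memLp_test {n : ℕ} (hn : 0 < n) {ρ : ℝ} (ν hi : ℝ) {lo : ℝ} (hρ : 0 ≤ ρ)
    (hlo : lo < (n : ℝ) / 2) (θ : 𝓢(Sp n, ℂ)) :
    MemLp (fun η : Sp n => (((weight ρ ν hi lo ((2 * Real.pi) • η))⁻¹ : ℝ) : ℂ) * θ η) 2 := by
  obtain ⟨M, hM⟩ := exists_nat_gt ((n : ℝ) / 2 - hi)
  have hP : MemLp (fun ξ : Sp n => ((powWeight (-hi - M) (-lo) ξ : ℝ) : ℂ)) 2 :=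
    (memLp_powWeight hn (by linarith) (by linarith)).ofReal
  have hP2 : MemLp (fun η : Sp n => ((powWeight (-hi - M) (-lo) ((2 * Real.pi) • η) : ℝ) : ℂ)) 2 := by
    refine ⟨hP.1.comp_quasiMeasurePreserving (quasiMeasurePreserving_two_pi_smul n), ?_⟩
    rw [eLpNorm_comp_two_pi hP.1]
    exact ENNReal.mul_lt_top ENNReal.ofReal_lt_top hP.2
  refine hP2.of_le_mul (c := (2 * Real.pi) ^ M * 2 ^ M *
      ((Finset.Iic (M, 0)).sup (schwartzSeminormFamily ℂ (Sp n) ℂ)) θ) ?_ ?_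
  · refine AEStronglyMeasurable.mul ?_ θ.continuous.aestronglyMeasurable
    have := (measurable_weight (n := n) ρ ν hi lo).comp (measurable_const_smul (2 * Real.pi))
    exact (Complex.measurable_ofReal.comp this.inv).aestronglyMeasurable
  · filter_upwards [(quasiMeasurePreserving_two_pi_smul n).ae (ae_ne_zero hn)] with η hη
    set ξ := (2 * Real.pi) • η
    have h1 := norm_schwartz_mul_pow_le M θ η
    have h2 := powWeight_pos hi lo hη
    have h3 := powWeight_le_weight hρ ν hi lo ξ
    have h4 := inv_one_add_pow_mul_powWeight_le M (-hi) (-lo) ξ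
    rw [norm_mul, Complex.norm_real, Complex.norm_real,
      Real.norm_of_nonneg (inv_nonneg.2 (weight_nonneg _ _ _ _ _)),
      Real.norm_of_nonneg (powWeight_nonneg _ _ _)]
    calc (weight ρ ν hi lo ξ)⁻¹ * ‖θ η‖ ≤ (powWeight hi lo ξ)⁻¹ * ‖θ η‖ := by gcongr
      _ = (‖θ η‖ * (1 + ‖ξ‖) ^ M) * (((1 + ‖ξ‖) ^ M)⁻¹ * powWeight (-hi) (-lo) ξ) := by
          rw [powWeight_neg]
          have : (0 : ℝ) < 1 + ‖ξ‖ := by positivity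
          field_simp
      _ ≤ _ := by
          gcongr
          exact mul_nonneg (by positivity) (powWeight_nonneg _ _ _)

theorem testNorm_lt_top {n : ℕ} (hn : 0 < n) {ρ : ℝ} (ν hi : ℝ) {lo : ℝ} (hρ : 0 ≤ ρ)
    (hlo : lo < (n : ℝ) / 2) (θ : 𝓢(Sp n, ℂ)) : testNorm ρ ν hi lo θ < ⊤ :=
  (memLp_test hn ν hi hρ hlo θ).2

/-! ### Duality characterisation of the norms -/

theorem enorm_fourier_le {n : ℕ} (hn : 0 < n) {ρ ν hi lo : ℝ} {u : TD n}
    (hu : gevreyNorm ρ ν hi lo u < ⊤) (θ : 𝓢(Sp n, ℂ)) :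
    ‖𝓕 u θ‖ₑ ≤ gevreyNorm ρ ν hi lo u * testNorm ρ ν hi lo θ := by
  have h := hasFourier_fhat_of_lt_top hu
  have hW := (Complex.measurable_ofReal.comp
    (measurable_weight (n := n) ρ ν hi lo)).aestronglyMeasurable (μ := volume)
  have hm : AEStronglyMeasurable (fun ξ => (weight ρ ν hi lo ξ : ℂ) * fhat u ξ) volume :=
    hW.mul h.1.aestronglyMeasurable
  have hm2 : AEStronglyMeasurable (fun η : Sp n => (weight ρ ν hi lo ((2 * Real.pi) • η) : ℂ) *
      fhat u ((2 * Real.pi) • η)) volume :=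
    hm.comp_quasiMeasurePreserving (quasiMeasurePreserving_two_pi_smul n)
  have ht : AEStronglyMeasurable (fun η : Sp n =>
      (((weight ρ ν hi lo ((2 * Real.pi) • η))⁻¹ : ℝ) : ℂ) * θ η) volume := by
    refine AEStronglyMeasurable.mul ?_ θ.continuous.aestronglyMeasurable
    have := (measurable_weight (n := n) ρ ν hi lo).comp (measurable_const_smul (2 * Real.pi))
    exact (Complex.measurable_ofReal.comp this.inv).aestronglyMeasurable
  have h1 : (∫ η : Sp n, θ η * fhat u ((2 * Real.pi) • η)) = ∫ η : Sp n,
      ((((weight ρ ν hi lo ((2 * Real.pi) • η))⁻¹ : ℝ) : ℂ) * θ η) *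
        ((weight ρ ν hi lo ((2 * Real.pi) • η) : ℂ) * fhat u ((2 * Real.pi) • η)) := by
    refine integral_congr_ae ?_
    filter_upwards [(quasiMeasurePreserving_two_pi_smul n).ae (ae_ne_zero hn)] with η hη
    have : (weight ρ ν hi lo ((2 * Real.pi) • η) : ℂ) ≠ 0 := by
      exact_mod_cast (weight_pos ρ ν hi lo hη).ne'
    rw [Complex.ofReal_inv]
    field_simp
  have hpos : (0 : ℝ) < (2 * Real.pi) ^ ((n : ℝ) / 2) := by positivity
  rw [h.2.2 θ, h1, enorm_mul, h.gevreyNorm_eq]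
  have h2 := eLpNorm_le_eLpNorm_mul_eLpNorm_of_nnnorm (p := 2) (q := 2) (r := 1) ht hm2
    (fun a b => a * b) 1 (by simp)
  rw [eLpNorm_comp_two_pi hm] at h2
  refine (mul_le_mul_right ((enorm_integral_le_lintegral_enorm _).trans
    ((eLpNorm_one_eq_lintegral_enorm).symm.le.trans h2)) _).trans (le_of_eq ?_)
  have h3 : ‖(((2 * Real.pi) ^ ((n : ℝ) / 2) : ℝ) : ℂ)‖ₑ * ENNReal.ofReal ((2 * Real.pi) ^ ((n : ℝ) / 2))⁻¹ = 1 := by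
    rw [← ofReal_norm, Complex.norm_real, Real.norm_of_nonneg hpos.le,
      ← ENNReal.ofReal_mul hpos.le, mul_inv_cancel₀ hpos.ne', ENNReal.ofReal_one]
  rw [testNorm, ENNReal.coe_one, one_mul]
  rw [mul_left_comm, ← mul_assoc _ _ (eLpNorm _ _ _), h3, one_mul, mul_comm]

theorem norm_fourier_le {n : ℕ} (hn : 0 < n) {ρ ν hi lo : ℝ} {u : TD n} (hρ : 0 ≤ ρ)
    (hlo : lo < (n : ℝ) / 2) {C : ℝ} (hC : 0 ≤ C)
    (hu : gevreyNorm ρ ν hi lo u ≤ ENNReal.ofReal C) (θ : 𝓢(Sp n, ℂ)) :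
    ‖𝓕 u θ‖ ≤ C * (testNorm ρ ν hi lo θ).toReal := by
  have h := (enorm_fourier_le hn (hu.trans_lt ENNReal.ofReal_lt_top) θ).trans
    (mul_le_mul_left hu _)
  have h2 := ENNReal.toReal_mono
    (ENNReal.mul_lt_top ENNReal.ofReal_lt_top (testNorm_lt_top hn ν hi hρ hlo θ)).ne h
  rwa [ENNReal.toReal_mul, ENNReal.toReal_ofReal hC, toReal_enorm] at h2

/-- The converse half of the duality. A functional bounded by `testNorm` is a bounded functional on
the image of Schwartz space in `L²` under multiplication by the inverse weight. Hahn–Banach extends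
it without increasing the norm, and Riesz represents it by a square integrable function, from which
the Fourier transform is read off. -/
theorem exists_gevreyNorm_le_of_functional {n : ℕ} (hn : 0 < n) {ρ ν hi lo : ℝ} (hρ : 0 ≤ ρ)
    (hlo : lo < (n : ℝ) / 2) {C : ℝ} (hC : 0 ≤ C) (L : 𝓢(Sp n, ℂ) →ₗ[ℂ] ℂ)
    (hL : ∀ θ, ‖L θ‖ ≤ C * (testNorm ρ ν hi lo θ).toReal) :
    ∃ u : TD n, (∀ θ, 𝓕 u θ = L θ) ∧ gevreyNorm ρ ν hi lo u ≤ ENNReal.ofReal C := by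
  have hmem := memLp_test hn ν hi hρ hlo
  let S : 𝓢(Sp n, ℂ) →ₗ[ℂ] Lp ℂ 2 (volume : Measure (Sp n)) :=
    { toFun := fun θ => (hmem θ).toLp _
      map_add' := fun θ θ' => by
        rw [← MemLp.toLp_add]
        congr 1
        ext η
        simp [mul_add]
      map_smul' := fun a θ => by
        rw [RingHom.id_apply, ← MemLp.toLp_const_smul]
        congr 1
        ext η
        simp [mul_left_comm] }
  have hS (θ) : ‖S θ‖ = (testNorm ρ ν hi lo θ).toReal :=
    Lp.norm_toLp _ (hmem θ)
  -- The bound makes `L` vanish wherever `S` does, so `L` descends to the range of `S`.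
  have hker : LinearMap.ker S ≤ LinearMap.ker L := by
    intro θ hθ
    rw [LinearMap.mem_ker] at hθ ⊢
    have := hL θ
    rw [← hS, hθ, norm_zero, mul_zero] at this
    simpa using this
  let L' : LinearMap.range S →ₗ[ℂ] ℂ := ((LinearMap.ker S).liftQ L hker).comp
    S.quotKerEquivRange.symm.toLinearMap
  have hL' (θ) : L' ⟨S θ, LinearMap.mem_range_self S θ⟩ = L θ := by
    have : S.quotKerEquivRange.symm ⟨S θ, LinearMap.mem_range_self S θ⟩ = Submodule.Quotient.mk θ :=
      S.quotKerEquivRange_symm_apply_image θ _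
    simp only [L', LinearMap.comp_apply, LinearEquiv.coe_coe, this]
    rfl
  have hb : ∀ x, ‖L' x‖ ≤ C * ‖x‖ := by
    rintro ⟨x, θ, rfl⟩
    rw [hL']
    refine (hL θ).trans (le_of_eq ?_)
    rw [← hS]
    rfl
  obtain ⟨Λ, hΛ, hΛn⟩ := exists_extension_norm_eq (LinearMap.range S) (L'.mkContinuous C hb)
  have hΛC : ‖Λ‖ ≤ C := hΛn.trans_le (LinearMap.mkContinuous_norm_le _ hC _)
  set F : Lp ℂ 2 (volume : Measure (Sp n)) :=
    (InnerProductSpace.toDual ℂ (Lp ℂ 2 (volume : Measure (Sp n)))).symm Λ with hF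
  have hFn : ‖F‖ ≤ C := by rw [hF, LinearIsometryEquiv.norm_map]; exact hΛC
  have hLF (θ) : L θ = ∫ η : Sp n, θ η *
      ((((weight ρ ν hi lo ((2 * Real.pi) • η))⁻¹ : ℝ) : ℂ) * (starRingEnd ℂ) (F η)) := by
    have h1 : Λ (S θ) = L θ := by
      rw [← hL' θ]
      exact hΛ ⟨S θ, LinearMap.mem_range_self S θ⟩
    rw [← h1, ← InnerProductSpace.toDual_symm_apply, L2.inner_def]
    refine integral_congr_ae ?_
    filter_upwards [(hmem θ).coeFn_toLp] with η hη
    have : (S θ : Sp n → ℂ) η = (((weight ρ ν hi lo ((2 * Real.pi) • η))⁻¹ : ℝ) : ℂ) * θ η := hη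
    rw [this]
    simp only [RCLike.inner_apply]
    rw [← hF]
    ring
  set c : ℝ := (2 * Real.pi) ^ ((n : ℝ) / 2) with hc
  have hcpos : 0 < c := by positivity
  let G : Sp n → ℂ := fun ξ => (starRingEnd ℂ) (F ((2 * Real.pi)⁻¹ • ξ))
  have hGm : AEStronglyMeasurable G := by
    have := (Lp.aestronglyMeasurable F).comp_quasiMeasurePreserving
      (quasiMeasurePreserving_inv_two_pi_smul n)
    exact Complex.continuous_conj.comp_aestronglyMeasurable this
  -- The Riesz representative lives in the variable `η = ξ/(2π)`. Rescaling it and dividing by the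
  -- normalising constant makes the weighted norm of `g` equal to that of `F`.
  let g : Sp n → ℂ := fun ξ => ((c⁻¹ : ℝ) : ℂ) * ((((weight ρ ν hi lo ξ)⁻¹ : ℝ) : ℂ) * G ξ)
  have hgm : AEStronglyMeasurable g := by
    refine AEStronglyMeasurable.const_mul ?_ _
    refine AEStronglyMeasurable.mul ?_ hGm
    exact (Complex.measurable_ofReal.comp (measurable_weight ρ ν hi lo).inv).aestronglyMeasurable
  have hWg : (fun ξ => (weight ρ ν hi lo ξ : ℂ) * g ξ) =ᵐ[volume] ((c⁻¹ : ℝ) : ℂ) • G := by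
    filter_upwards [ae_ne_zero hn] with ξ hξ
    have : (weight ρ ν hi lo ξ : ℂ) ≠ 0 := by
      exact_mod_cast (weight_pos ρ ν hi lo hξ).ne'
    simp only [g, Complex.ofReal_inv, Pi.smul_apply, smul_eq_mul]
    field_simp
  have hGn : ENNReal.ofReal c⁻¹ * eLpNorm G 2 volume = eLpNorm F 2 volume := by
    rw [← eLpNorm_comp_two_pi hGm]
    refine eLpNorm_congr_norm_ae (Eventually.of_forall fun η => ?_)
    simp only [G, inv_two_pi_smul, RCLike.norm_conj]
  have hnorm : eLpNorm (fun ξ => (weight ρ ν hi lo ξ : ℂ) * g ξ) 2 volume ≤ ENNReal.ofReal C := by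
    rw [eLpNorm_congr_ae hWg, eLpNorm_const_smul, ← ofReal_norm, Complex.norm_real,
      Real.norm_of_nonneg (by positivity), hGn]
    rw [← ENNReal.ofReal_toReal (Lp.eLpNorm_ne_top F), ← Lp.norm_def]
    exact ENNReal.ofReal_le_ofReal hFn
  obtain ⟨u, hu⟩ := exists_hasFourier_of_weight hn hρ hlo hgm
    (hnorm.trans_lt ENNReal.ofReal_lt_top)
  refine ⟨u, fun θ => ?_, by rw [hu.gevreyNorm_eq]; exact hnorm⟩
  rw [hu.2.2, hLF, ← integral_const_mul]
  congr 1 with η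
  simp only [g, G, inv_two_pi_smul]
  have : (c : ℂ) ≠ 0 := by exact_mod_cast hcpos.ne'
  rw [← hc, Complex.ofReal_inv c]
  field_simp

theorem gevreyNorm_le_of_fourier {n : ℕ} (hn : 0 < n) {ρ ν hi lo : ℝ} (hρ : 0 ≤ ρ)
    (hlo : lo < (n : ℝ) / 2) {C : ℝ} (hC : 0 ≤ C) {u : TD n}
    (hu : ∀ θ, ‖𝓕 u θ‖ ≤ C * (testNorm ρ ν hi lo θ).toReal) :
    gevreyNorm ρ ν hi lo u ≤ ENNReal.ofReal C := by
  obtain ⟨v, hv, hvn⟩ := exists_gevreyNorm_le_of_functional hn hρ hlo hC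
    ((𝓕 u : 𝓢(Sp n, ℂ) →L[ℂ] ℂ) : 𝓢(Sp n, ℂ) →ₗ[ℂ] ℂ) hu
  have : v = u := fourier_injective (by ext θ; exact hv θ)
  rwa [← this]

/-! ### Algebra of the norms -/

theorem gevreyNorm_zero {n : ℕ} (ρ ν hi lo : ℝ) : gevreyNorm ρ ν hi lo (0 : TD n) = 0 := by
  rw [(HasFourier.zero n).gevreyNorm_eq]
  simp

theorem aestronglyMeasurable_weight_mul {n : ℕ} {ρ ν hi lo : ℝ} {g : Sp n → ℂ}
    (hg : AEStronglyMeasurable g) :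
    AEStronglyMeasurable (fun ξ => (weight ρ ν hi lo ξ : ℂ) * g ξ) volume :=
  (Complex.measurable_ofReal.comp (measurable_weight ρ ν hi lo)).aestronglyMeasurable.mul hg

theorem gevreyNorm_add_le {n : ℕ} (ρ ν hi lo : ℝ) (u v : TD n) :
    gevreyNorm ρ ν hi lo (u + v) ≤ gevreyNorm ρ ν hi lo u + gevreyNorm ρ ν hi lo v := by
  by_cases h : gevreyNorm ρ ν hi lo u < ⊤ ∧ gevreyNorm ρ ν hi lo v < ⊤
  · have h1 := hasFourier_fhat_of_lt_top h.1
    have h2 := hasFourier_fhat_of_lt_top h.2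
    rw [(h1.add h2).gevreyNorm_eq, h1.gevreyNorm_eq, h2.gevreyNorm_eq]
    simp_rw [mul_add]
    exact eLpNorm_add_le (aestronglyMeasurable_weight_mul h1.1.aestronglyMeasurable)
      (aestronglyMeasurable_weight_mul h2.1.aestronglyMeasurable) (by norm_num)
  · have : gevreyNorm ρ ν hi lo u + gevreyNorm ρ ν hi lo v = ⊤ := by
      rw [ENNReal.add_eq_top]
      by_contra h'
      push Not at h'
      exact h ⟨h'.1.lt_top, h'.2.lt_top⟩
    rw [this]
    exact le_top

theorem gevreyNorm_smul_le {n : ℕ} (ρ ν hi lo : ℝ) (c : ℂ) (u : TD n) :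
    gevreyNorm ρ ν hi lo (c • u) ≤ ‖c‖ₑ * gevreyNorm ρ ν hi lo u := by
  by_cases hc : c = 0
  · have : c • u = 0 := by rw [hc]; exact zero_smul ℂ u
    rw [this, gevreyNorm_zero]
    exact zero_le
  by_cases h : gevreyNorm ρ ν hi lo u < ⊤
  · have h1 := hasFourier_fhat_of_lt_top h
    rw [(h1.smul c).gevreyNorm_eq, h1.gevreyNorm_eq, ← eLpNorm_const_smul]
    refine le_of_eq (congrArg (fun f => eLpNorm f 2 volume) ?_)
    ext ξ
    simp only [Pi.smul_apply, smul_eq_mul]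
    ring
  · rw [not_lt_top_iff.1 h, ENNReal.mul_top (by simpa using hc)]
    exact le_top

theorem gevreyNorm_neg {n : ℕ} (ρ ν hi lo : ℝ) (u : TD n) :
    gevreyNorm ρ ν hi lo (-u) = gevreyNorm ρ ν hi lo u := by
  have key (v : TD n) : gevreyNorm ρ ν hi lo (-v) ≤ gevreyNorm ρ ν hi lo v := by
    have := gevreyNorm_smul_le ρ ν hi lo (-1) v
    have e : (-1 : ℂ) • v = -v := neg_one_smul ℂ v
    rw [e] at this
    simpa using this
  refine le_antisymm (key u) ?_
  simpa using key (-u)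

theorem gevreyNorm_sub_le {n : ℕ} (ρ ν hi lo : ℝ) (u v : TD n) :
    gevreyNorm ρ ν hi lo (u - v) ≤ gevreyNorm ρ ν hi lo u + gevreyNorm ρ ν hi lo v := by
  rw [sub_eq_add_neg, ← gevreyNorm_neg ρ ν hi lo v]
  exact gevreyNorm_add_le _ _ _ _ _ _

theorem gevreyNorm_sum_le {n : ℕ} {ι : Type*} (ρ ν hi lo : ℝ) (s : Finset ι) (u : ι → TD n) :
    gevreyNorm ρ ν hi lo (∑ i ∈ s, u i) ≤ ∑ i ∈ s, gevreyNorm ρ ν hi lo (u i) := by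
  classical
  induction s using Finset.induction_on with
  | empty => simp [gevreyNorm_zero]
  | insert a s ha ih =>
    rw [Finset.sum_insert ha, Finset.sum_insert ha]
    exact (gevreyNorm_add_le _ _ _ _ _ _).trans (by gcongr)

theorem gevreyNorm_mono {n : ℕ} (ρ ν lo : ℝ) {hi hi' : ℝ} (h : hi ≤ hi') (u : TD n) :
    gevreyNorm ρ ν hi lo u ≤ gevreyNorm ρ ν hi' lo u := by
  unfold gevreyNorm
  split_ifs
  · refine eLpNorm_mono fun ξ => ?_
    rw [norm_mul, norm_mul, Complex.norm_real, Complex.norm_real,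
      Real.norm_of_nonneg (weight_nonneg _ _ _ _ _), Real.norm_of_nonneg (weight_nonneg _ _ _ _ _),
      weight_eq, weight_eq]
    gcongr
    exact powWeight_mono h lo ξ
  · exact le_rfl

/-! ### Time integration -/

/-- Mean value inequality for the weighted norms. -/
theorem gevreyNorm_sub_le_of_hasTimeDeriv {n : ℕ} (hn : 0 < n) {ρ ν hi lo : ℝ} (hρ : 0 ≤ ρ)
    (hlo : lo < (n : ℝ) / 2) {t₀ s t : ℝ} (h0 : t₀ ≤ s) (hst : s ≤ t) {u R : ℝ → TD n}
    (hu : HasTimeDeriv (Ici t₀) u R) {B B' : ℝ → ℝ}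
    (hB : ∀ τ ∈ Icc s t, HasDerivWithinAt B (B' τ) (Ici τ) τ) (hBc : ContinuousOn B (Icc s t))
    (hB0 : ∀ τ ∈ Icc s t, 0 ≤ B' τ)
    (hR : ∀ τ ∈ Icc s t, gevreyNorm ρ ν hi lo (R τ) ≤ ENNReal.ofReal (B' τ)) :
    gevreyNorm ρ ν hi lo (u t - u s) ≤ ENNReal.ofReal (B t - B s) := by
  -- For a fixed test function this is the scalar mean value inequality with a bound proportional to
  -- `testNorm`. Duality then returns the norm estimate, without integrating `R` as a vector valued
  -- function.
  have key (θ : 𝓢(Sp n, ℂ)) :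
      ‖𝓕 (u t - u s) θ‖ ≤ (B t - B s) * (testNorm ρ ν hi lo θ).toReal := by
    have hd (τ) (hτ : τ ∈ Icc s t) :
        HasDerivWithinAt (fun τ => u τ (𝓕 θ) - u s (𝓕 θ)) (R τ (𝓕 θ)) (Ici t₀) τ :=
      (hu τ (h0.trans hτ.1) (𝓕 θ)).sub_const _
    have := image_norm_le_of_norm_deriv_right_le_deriv_boundary' (a := s) (b := t)
      (f := fun τ => u τ (𝓕 θ) - u s (𝓕 θ)) (f' := fun τ => R τ (𝓕 θ))
      (B := fun τ => (B τ - B s) * (testNorm ρ ν hi lo θ).toReal)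
      (B' := fun τ => B' τ * (testNorm ρ ν hi lo θ).toReal)
      (fun τ hτ => (hd τ hτ).continuousWithinAt.mono fun x hx => h0.trans hx.1)
      (fun τ hτ => (hd τ ⟨hτ.1, hτ.2.le⟩).mono fun x hx => h0.trans (hτ.1.trans hx))
      (by simp) ((hBc.sub continuousOn_const).mul continuousOn_const)
      (fun τ hτ => ((hB τ ⟨hτ.1, hτ.2.le⟩).sub_const _).mul_const _)
      (fun τ hτ => norm_fourier_le hn hρ hlo (hB0 τ ⟨hτ.1, hτ.2.le⟩) (hR τ ⟨hτ.1, hτ.2.le⟩) θ)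
    exact this ⟨hst, le_rfl⟩
  have hmono : B s ≤ B t := by
    have := image_norm_le_of_norm_deriv_right_le_deriv_boundary' (a := s) (b := t)
      (f := fun _ => (0 : ℝ)) (f' := fun _ => 0) (B := fun τ => B τ - B s) (B' := B')
      continuousOn_const (fun τ _ => hasDerivWithinAt_const _ _ _) (by simp)
      (hBc.sub continuousOn_const) (fun τ hτ => (hB τ ⟨hτ.1, hτ.2.le⟩).sub_const _)
      (fun τ hτ => by simpa using hB0 τ ⟨hτ.1, hτ.2.le⟩) (right_mem_Icc.2 hst)
    simpa using this
  exact gevreyNorm_le_of_fourier hn hρ hlo (sub_nonneg.2 hmono) key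

/-- The norm is lower semicontinuous for pointwise convergence. -/
theorem gevreyNorm_le_of_tendsto {n : ℕ} (hn : 0 < n) {ρ ν hi lo : ℝ} (hρ : 0 ≤ ρ)
    (hlo : lo < (n : ℝ) / 2) {ι : Type*} {F : Filter ι} [F.NeBot] {u : ι → TD n} {v : TD n}
    (h : ∀ θ, Tendsto (fun i => u i θ) F (𝓝 (v θ))) {C : ι → ℝ} {c : ℝ} (hC : Tendsto C F (𝓝 c))
    (hC0 : ∀ i, 0 ≤ C i) (hb : ∀ᶠ i in F, gevreyNorm ρ ν hi lo (u i) ≤ ENNReal.ofReal (C i)) :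
    gevreyNorm ρ ν hi lo v ≤ ENNReal.ofReal c := by
  refine gevreyNorm_le_of_fourier hn hρ hlo (ge_of_tendsto' hC hC0) fun θ => ?_
  refine le_of_tendsto_of_tendsto (h (𝓕 θ)).norm (hC.mul_const _) ?_
  filter_upwards [hb] with i hi
  exact norm_fourier_le hn hρ hlo (hC0 i) hi θ

/-- Norm convergence implies pointwise convergence. -/
theorem tendsto_apply_of_gevreyNorm {n : ℕ} (hn : 0 < n) {ρ ν hi lo : ℝ} (hρ : 0 ≤ ρ)
    (hlo : lo < (n : ℝ) / 2) {ι : Type*} {F : Filter ι} {u : ι → TD n} {v : TD n}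
    (h : Tendsto (fun i => gevreyNorm ρ ν hi lo (u i - v)) F (𝓝 0)) (θ : 𝓢(Sp n, ℂ)) :
    Tendsto (fun i => u i θ) F (𝓝 (v θ)) := by
  have h1 : Tendsto (fun i => gevreyNorm ρ ν hi lo (u i - v) * testNorm ρ ν hi lo (𝓕⁻ θ)) F
      (𝓝 0) := by
    have := ENNReal.Tendsto.mul_const h
      (Or.inr (testNorm_lt_top hn ν hi hρ hlo (𝓕⁻ θ)).ne)
    simpa using this
  rw [tendsto_iff_edist_tendsto_0]
  refine tendsto_of_tendsto_of_tendsto_of_le_of_le' tendsto_const_nhds h1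
    (Eventually.of_forall fun _ => zero_le) ?_
  filter_upwards [h.eventually (gt_mem_nhds ENNReal.zero_lt_top)] with i hi
  have := enorm_fourier_le hn hi (𝓕⁻ θ)
  rw [TemperedDistribution.fourier_apply, FourierTransform.fourier_fourierInv_eq] at this
  rw [edist_eq_enorm_sub]
  exact this

/-! ### Convolution inequalities -/

theorem lintegral_mul_sq_le {n : ℕ} {f g : Sp n → ℝ≥0∞} (hf : Measurable f) (hg : Measurable g) :
    (∫⁻ x, f x * g x) ^ 2 ≤ (∫⁻ x, f x ^ 2) * ∫⁻ x, g x ^ 2 := by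
  have h := ENNReal.lintegral_mul_le_Lp_mul_Lq (volume : Measure (Sp n)) Real.HolderConjugate.two_two
    hf.aemeasurable hg.aemeasurable
  simp only [Pi.mul_apply, ENNReal.rpow_two] at h
  calc (∫⁻ x, f x * g x) ^ 2
      ≤ ((∫⁻ x, f x ^ 2) ^ (1 / 2 : ℝ) * (∫⁻ x, g x ^ 2) ^ (1 / 2 : ℝ)) ^ 2 := by gcongr
    _ = _ := by
      rw [mul_pow, ← ENNReal.rpow_two, ← ENNReal.rpow_two, ← ENNReal.rpow_mul, ← ENNReal.rpow_mul]
      norm_num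

/-- Young's inequality from `L¹ * L²` to `L²`: write `A = √A √A`, apply Cauchy–Schwarz in `η`, then
exchange the integrals. -/
theorem lintegral_convolution_sq_le {n : ℕ} {A G : Sp n → ℝ≥0∞} (hA : Measurable A)
    (hG : Measurable G) :
    ∫⁻ ξ, (∫⁻ η, A (ξ - η) * G η) ^ 2 ≤ (∫⁻ x, A x) ^ 2 * ∫⁻ x, G x ^ 2 := by
  have hr (x) : A x ^ (1 / 2 : ℝ) * A x ^ (1 / 2 : ℝ) = A x := by
    rw [← ENNReal.rpow_add_of_nonneg _ _ (by norm_num) (by norm_num)]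
    norm_num
  have h1 (ξ : Sp n) : (∫⁻ η, A (ξ - η) * G η) ^ 2 ≤
      (∫⁻ x, A x) * ∫⁻ η, A (ξ - η) * G η ^ 2 := by
    have := lintegral_mul_sq_le (f := fun η => A (ξ - η) ^ (1 / 2 : ℝ))
      (g := fun η => A (ξ - η) ^ (1 / 2 : ℝ) * G η) (by fun_prop) (by fun_prop)
    simp only [← mul_assoc, sq, hr] at this
    rw [lintegral_sub_left_eq_self] at this
    refine (le_of_eq ?_).trans (this.trans (le_of_eq ?_))
    · rw [sq]
    · congr 2 with η
      rw [sq]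
      calc _ = (A (ξ - η) ^ (1 / 2 : ℝ) * A (ξ - η) ^ (1 / 2 : ℝ)) * (G η * G η) := by ring
        _ = _ := by rw [hr]
  calc ∫⁻ ξ, (∫⁻ η, A (ξ - η) * G η) ^ 2
      ≤ ∫⁻ ξ, (∫⁻ x, A x) * ∫⁻ η, A (ξ - η) * G η ^ 2 := lintegral_mono h1
    _ = (∫⁻ x, A x) * ∫⁻ ξ, ∫⁻ η, A (ξ - η) * G η ^ 2 := by
      rw [lintegral_const_mul _ (by fun_prop)]
    _ = (∫⁻ x, A x) * ∫⁻ η, ∫⁻ ξ, A (ξ - η) * G η ^ 2 := by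
      rw [lintegral_lintegral_swap]
      exact Measurable.aemeasurable (by fun_prop)
    _ = (∫⁻ x, A x) * ∫⁻ η, (∫⁻ x, A x) * G η ^ 2 := by
      congr 2 with η
      rw [lintegral_mul_const _ (by fun_prop), lintegral_sub_right_eq_self]
    _ = _ := by
      rw [lintegral_const_mul _ (by fun_prop)]
      ring

/-- With `σ` on `ξ - η` or on `η`, the product `σF` or `σG` is integrable and Young applies. With
`σ` on `ξ`, the convolution of `F` and `G` is bounded and `σ` supplies square integrability. The 9
comes from `(a + b + c)² ≤ 3(a² + b² + c²)`. -/
theorem lintegral_kernel_sq_le {n : ℕ} {σ F G : Sp n → ℝ≥0∞} (hσ : Measurable σ)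
    (hF : Measurable F) (hG : Measurable G) :
    ∫⁻ ξ, (∫⁻ η, (σ (ξ - η) + σ η + σ ξ) * (F (ξ - η) * G η)) ^ 2 ≤
      9 * (∫⁻ x, σ x ^ 2) * (∫⁻ x, F x ^ 2) * ∫⁻ x, G x ^ 2 := by
  have i1 : ∫⁻ ξ, (∫⁻ η, (σ (ξ - η) * F (ξ - η)) * G η) ^ 2 ≤
      (∫⁻ x, σ x ^ 2) * (∫⁻ x, F x ^ 2) * ∫⁻ x, G x ^ 2 := by
    refine (lintegral_convolution_sq_le (A := fun x => σ x * F x) (by fun_prop) hG).trans ?_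
    gcongr
    exact lintegral_mul_sq_le hσ hF
  have i2 : ∫⁻ ξ, (∫⁻ η, (σ η * G η) * F (ξ - η)) ^ 2 ≤
      (∫⁻ x, σ x ^ 2) * (∫⁻ x, F x ^ 2) * ∫⁻ x, G x ^ 2 := by
    have e (ξ : Sp n) : ∫⁻ η, (σ η * G η) * F (ξ - η) =
        ∫⁻ η, (σ (ξ - η) * G (ξ - η)) * F η := by
      rw [← lintegral_sub_left_eq_self _ ξ]
      simp
    simp_rw [e]
    refine (lintegral_convolution_sq_le (A := fun x => σ x * G x) (by fun_prop) hF).trans ?_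
    refine (mul_le_mul_left (lintegral_mul_sq_le hσ hG) _).trans (le_of_eq ?_)
    ring
  have i3 : ∫⁻ ξ, (σ ξ * ∫⁻ η, F (ξ - η) * G η) ^ 2 ≤
      (∫⁻ x, σ x ^ 2) * (∫⁻ x, F x ^ 2) * ∫⁻ x, G x ^ 2 := by
    have e (ξ : Sp n) : (∫⁻ η, F (ξ - η) * G η) ^ 2 ≤ (∫⁻ x, F x ^ 2) * ∫⁻ x, G x ^ 2 := by
      refine (lintegral_mul_sq_le (f := fun η => F (ξ - η)) (by fun_prop) hG).trans (le_of_eq ?_)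
      rw [lintegral_sub_left_eq_self (fun x => F x ^ 2) ξ]
    calc _ ≤ ∫⁻ ξ, σ ξ ^ 2 * ((∫⁻ x, F x ^ 2) * ∫⁻ x, G x ^ 2) := by
          refine lintegral_mono fun ξ => ?_
          rw [mul_pow]
          exact mul_le_mul_right (e ξ) _
      _ = _ := by rw [lintegral_mul_const _ (by fun_prop), mul_assoc]
  have hsq (a b c : ℝ≥0∞) : (a + b + c) ^ 2 ≤ 3 * a ^ 2 + 3 * b ^ 2 + 3 * c ^ 2 := by
    by_cases h : a = ⊤ ∨ b = ⊤ ∨ c = ⊤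
    · rcases h with h | h | h <;> simp [h]
    · push Not at h
      obtain ⟨ha, hb, hc⟩ := h
      lift a to NNReal using ha
      lift b to NNReal using hb
      lift c to NNReal using hc
      have : (a + b + c) ^ 2 ≤ 3 * a ^ 2 + 3 * b ^ 2 + 3 * c ^ 2 := by
        rw [← NNReal.coe_le_coe]
        push_cast
        nlinarith [sq_nonneg ((a : ℝ) - b), sq_nonneg ((a : ℝ) - c), sq_nonneg ((b : ℝ) - c)]
      exact_mod_cast this
  have hsplit (ξ : Sp n) : ∫⁻ η, (σ (ξ - η) + σ η + σ ξ) * (F (ξ - η) * G η) =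
      (∫⁻ η, (σ (ξ - η) * F (ξ - η)) * G η) + (∫⁻ η, (σ η * G η) * F (ξ - η)) +
        σ ξ * ∫⁻ η, F (ξ - η) * G η := by
    rw [← lintegral_const_mul _ (by fun_prop), ← lintegral_add_left (by fun_prop),
      ← lintegral_add_left (by fun_prop)]
    congr 1 with η
    ring
  simp_rw [hsplit]
  refine (lintegral_mono fun ξ => hsq _ _ _).trans ?_
  rw [lintegral_add_left (by fun_prop), lintegral_add_left (by fun_prop),
    lintegral_const_mul _ (by fun_prop), lintegral_const_mul _ (by fun_prop),
    lintegral_const_mul _ (by fun_prop)]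
  calc _ ≤ 3 * ((∫⁻ x, σ x ^ 2) * (∫⁻ x, F x ^ 2) * ∫⁻ x, G x ^ 2) +
        3 * ((∫⁻ x, σ x ^ 2) * (∫⁻ x, F x ^ 2) * ∫⁻ x, G x ^ 2) +
        3 * ((∫⁻ x, σ x ^ 2) * (∫⁻ x, F x ^ 2) * ∫⁻ x, G x ^ 2) := by gcongr
    _ = _ := by ring

/-! ### Products -/

/-- The Fourier transform of the product of distributions with transforms `g₁`, `g₂`. -/
def convF {n : ℕ} (g₁ g₂ : Sp n → ℂ) (ξ : Sp n) : ℂ :=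
  ((2 * Real.pi) ^ (-(n : ℝ) / 2) : ℝ) * ∫ η : Sp n, g₁ (ξ - η) * g₂ η

theorem ae_eq_convolution_integrand {n : ℕ} {g₁ g₂ f₁ f₂ : Sp n → ℂ} (h₁ : g₁ =ᵐ[volume] f₁)
    (h₂ : g₂ =ᵐ[volume] f₂) (ξ : Sp n) :
    (fun η => g₁ (ξ - η) * g₂ η) =ᵐ[volume] fun η => f₁ (ξ - η) * f₂ η := by
  have := (quasiMeasurePreserving_sub_left volume ξ).ae_eq_comp h₁
  filter_upwards [this, h₂] with η e1 e2
  simp only [Function.comp_apply] at e1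
  rw [e1, e2]

/-- The product `u v` is defined through absolutely convergent integrals. -/
structure ProdOK {n : ℕ} (u v : TD n) (g₁ g₂ : Sp n → ℂ) : Prop where
  left : HasFourier u g₁
  right : HasFourier v g₂
  int : ∀ᵐ ξ : Sp n, Integrable (fun η : Sp n => g₁ (ξ - η) * g₂ η)
  fourier : HasFourier (mul u v) (convF g₁ g₂)

/-- Convolution integrals do not see null sets, so any representatives of the transforms may replace
the chosen `fhat`. -/
theorem mul_eq_of_hasFourier {n : ℕ} {u v w : TD n} {g₁ g₂ : Sp n → ℂ} (hu : HasFourier u g₁)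
    (hv : HasFourier v g₂) (hi : ∀ᵐ ξ : Sp n, Integrable (fun η : Sp n => g₁ (ξ - η) * g₂ η))
    (hw : HasFourier w (convF g₁ g₂)) : mul u v = w := by
  have e := ae_eq_convolution_integrand hu.fhat_ae_eq hv.fhat_ae_eq
  have hi' : ∀ᵐ ξ : Sp n, Integrable (fun η : Sp n => fhat u (ξ - η) * fhat v η) := by
    filter_upwards [hi] with ξ hξ
    exact hξ.congr (e ξ).symm
  have e2 : convF (fhat u) (fhat v) = convF g₁ g₂ := by
    ext ξ
    rw [convF, convF, integral_congr_ae (e ξ)]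
  rw [mul, if_pos hi']
  rw [← e2] at hw
  exact hw.ofFourier_eq

/-- Linearity of `mul` is not automatic: without absolute convergence it takes its default value 0.
This is why linearity is later carried along with the bounds. -/
theorem ProdOK.sub_left {n : ℕ} {u u' v : TD n} {g₁ g₁' g₂ : Sp n → ℂ} (h : ProdOK u v g₁ g₂)
    (h' : ProdOK u' v g₁' g₂) : mul (u - u') v = mul u v - mul u' v := by
  refine mul_eq_of_hasFourier (h.left.sub h'.left) h.right ?_ ?_
  · filter_upwards [h.int, h'.int] with ξ h1 h2
    simp_rw [sub_mul]
    exact h1.sub h2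
  · refine (h.fourier.sub h'.fourier).congr ?_
    filter_upwards [h.int, h'.int] with ξ h1 h2
    simp only [convF, sub_mul]
    rw [integral_sub h1 h2, mul_sub]

theorem ProdOK.sub_right {n : ℕ} {u v v' : TD n} {g₁ g₂ g₂' : Sp n → ℂ} (h : ProdOK u v g₁ g₂)
    (h' : ProdOK u v' g₁ g₂') : mul u (v - v') = mul u v - mul u v' := by
  refine mul_eq_of_hasFourier h.left (h.right.sub h'.right) ?_ ?_
  · filter_upwards [h.int, h'.int] with ξ h1 h2
    simp_rw [mul_sub]
    exact h1.sub h2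
  · refine (h.fourier.sub h'.fourier).congr ?_
    filter_upwards [h.int, h'.int] with ξ h1 h2
    simp only [convF, mul_sub]
    rw [integral_sub h1 h2, mul_sub]

/-- Subadditivity of `r ↦ r^ν` for `0 ≤ ν ≤ 1` survives the maximum with 1. It makes the constants
of the product estimates independent of `ρ` and `ν`. -/
theorem weight_exp_submul {n : ℕ} {ρ ν : ℝ} (hρ : 0 ≤ ρ) (hν : 0 ≤ ν) (hν1 : ν ≤ 1) (ξ η : Sp n) :
    Real.exp (ρ * max (‖ξ‖ ^ ν) 1) ≤
      Real.exp (ρ * max (‖ξ - η‖ ^ ν) 1) * Real.exp (ρ * max (‖η‖ ^ ν) 1) := by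
  rw [← Real.exp_add, ← mul_add]
  gcongr
  have h1 : ‖ξ‖ ^ ν ≤ ‖ξ - η‖ ^ ν + ‖η‖ ^ ν := by
    refine le_trans ?_ (Real.rpow_add_le_add_rpow (norm_nonneg _) (norm_nonneg _) hν hν1)
    gcongr
    calc ‖ξ‖ = ‖ξ - η + η‖ := by simp
      _ ≤ _ := norm_add_le _ _
  refine max_le (h1.trans (add_le_add (le_max_left _ _) (le_max_left _ _))) ?_
  linarith [le_max_right (‖ξ - η‖ ^ ν) 1, le_max_right (‖η‖ ^ ν) 1]

theorem eLpNorm_two_sq {n : ℕ} (f : Sp n → ℂ) :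
    eLpNorm f 2 volume ^ 2 = ∫⁻ x, ‖f x‖ₑ ^ 2 := by
  rw [eLpNorm_eq_lintegral_rpow_enorm_toReal (by norm_num) (by norm_num), ← ENNReal.rpow_two,
    ← ENNReal.rpow_mul]
  norm_num

/-- The product in weighted spaces under a pointwise bound on the weights. -/
theorem exists_mul_bound {n : ℕ} (hn : 0 < n) {hi lo h₁ l₁ h₂ l₂ : ℝ}
    (hlo : lo < (n : ℝ) / 2) {σ : Sp n → ℝ} (hσm : Measurable σ) (hσ0 : ∀ ξ, 0 ≤ σ ξ)
    (hσ : MemLp σ 2) (hK : ∀ ξ η : Sp n, ξ ≠ 0 → η ≠ 0 → ξ - η ≠ 0 → powWeight hi lo ξ ≤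
      (σ (ξ - η) + σ η + σ ξ) * (powWeight h₁ l₁ (ξ - η) * powWeight h₂ l₂ η)) :
    ∃ C : ℝ, 0 ≤ C ∧ ∀ ρ ν : ℝ, 0 ≤ ρ → 0 ≤ ν → ν ≤ 1 → ∀ u v : TD n,
      gevreyNorm ρ ν h₁ l₁ u < ⊤ → gevreyNorm ρ ν h₂ l₂ v < ⊤ →
      ProdOK u v (fhat u) (fhat v) ∧ gevreyNorm ρ ν hi lo (mul u v) ≤
        ENNReal.ofReal C * gevreyNorm ρ ν h₁ l₁ u * gevreyNorm ρ ν h₂ l₂ v := by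
  set c : ℝ := (2 * Real.pi) ^ (-(n : ℝ) / 2) with hc
  have hcpos : 0 < c := by positivity
  refine ⟨c * (3 * (eLpNorm σ 2 volume).toReal), by positivity, ?_⟩
  intro ρ ν hρ hν hν1 u v hu hv
  have hu1 := hasFourier_fhat_of_lt_top hu
  have hv1 := hasFourier_fhat_of_lt_top hv
  -- Strictly measurable representatives are needed because `g₁ (ξ - η) * g₂ η` must be jointly
  -- measurable for the integrals in both variables.
  obtain ⟨g₁, hg₁m, hg₁⟩ := hu1.1.aestronglyMeasurable
  obtain ⟨g₂, hg₂m, hg₂⟩ := hv1.1.aestronglyMeasurable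
  have hu2 := hu1.congr hg₁
  have hv2 := hv1.congr hg₂
  have m1 := hg₁m.measurable
  have m2 := hg₂m.measurable
  have mW := Complex.measurable_ofReal.comp (measurable_weight (n := n) ρ ν hi lo)
  have mW1 := Complex.measurable_ofReal.comp (measurable_weight (n := n) ρ ν h₁ l₁)
  have mW2 := Complex.measurable_ofReal.comp (measurable_weight (n := n) ρ ν h₂ l₂)
  let F : Sp n → ℝ≥0∞ := fun ξ => ‖(weight ρ ν h₁ l₁ ξ : ℂ) * g₁ ξ‖ₑ
  let G : Sp n → ℝ≥0∞ := fun ξ => ‖(weight ρ ν h₂ l₂ ξ : ℂ) * g₂ ξ‖ₑ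
  have mF : Measurable F := (mW1.mul m1).enorm
  have mG : Measurable G := (mW2.mul m2).enorm
  let s : Sp n → ℝ≥0∞ := fun ξ => ‖σ ξ‖ₑ
  have ms : Measurable s := hσm.enorm
  have hmain := lintegral_kernel_sq_le ms mF mG
  have hF2 : ∫⁻ x, F x ^ 2 = gevreyNorm ρ ν h₁ l₁ u ^ 2 := by
    rw [hu2.gevreyNorm_eq, eLpNorm_two_sq]
  have hG2 : ∫⁻ x, G x ^ 2 = gevreyNorm ρ ν h₂ l₂ v ^ 2 := by
    rw [hv2.gevreyNorm_eq, eLpNorm_two_sq]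
  have hs2 : ∫⁻ x, s x ^ 2 = ENNReal.ofReal (eLpNorm σ 2 volume).toReal ^ 2 := by
    rw [ENNReal.ofReal_toReal hσ.2.ne]
    have : eLpNorm σ 2 volume = eLpNorm (fun x => (σ x : ℂ)) 2 volume :=
      eLpNorm_congr_norm_ae (Eventually.of_forall fun x => by simp)
    rw [this, eLpNorm_two_sq]
    refine lintegral_congr fun x => ?_
    simp only [s, ← ofReal_norm, Complex.norm_real]
  rw [hF2, hG2, hs2] at hmain
  have hpt (ξ : Sp n) (hξ : ξ ≠ 0) : ‖(weight ρ ν hi lo ξ : ℂ)‖ₑ *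
      (∫⁻ η, ‖g₁ (ξ - η) * g₂ η‖ₑ) ≤ ∫⁻ η, (s (ξ - η) + s η + s ξ) * (F (ξ - η) * G η) := by
    rw [← lintegral_const_mul _ (by fun_prop)]
    refine lintegral_mono_ae ?_
    filter_upwards [ae_ne_zero hn,
      (quasiMeasurePreserving_sub_left volume ξ).ae (ae_ne_zero hn)] with η h1 h2
    have hk := hK ξ η hξ h1 h2
    have he := weight_exp_submul hρ hν hν1 ξ η
    have key : weight ρ ν hi lo ξ ≤ (σ (ξ - η) + σ η + σ ξ) *
        (weight ρ ν h₁ l₁ (ξ - η) * weight ρ ν h₂ l₂ η) := by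
      rw [weight_eq, weight_eq, weight_eq]
      refine (mul_le_mul he hk (powWeight_nonneg _ _ _) (by positivity)).trans (le_of_eq ?_)
      ring
    simp only [s, F, G]
    simp only [← ofReal_norm]
    rw [← ENNReal.ofReal_add (norm_nonneg _) (norm_nonneg _), ← ENNReal.ofReal_add (by positivity)
      (norm_nonneg _), ← ENNReal.ofReal_mul (norm_nonneg _), ← ENNReal.ofReal_mul (norm_nonneg _),
      ← ENNReal.ofReal_mul (by positivity)]
    refine ENNReal.ofReal_le_ofReal ?_
    simp only [norm_mul, Complex.norm_real, Real.norm_of_nonneg (hσ0 _),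
      Real.norm_of_nonneg (weight_nonneg _ _ _ _ _)]
    calc _ ≤ ((σ (ξ - η) + σ η + σ ξ) * (weight ρ ν h₁ l₁ (ξ - η) * weight ρ ν h₂ l₂ η)) *
          (‖g₁ (ξ - η)‖ * ‖g₂ η‖) := by gcongr
      _ = _ := by ring
  have hfin : ∫⁻ ξ, (∫⁻ η, (s (ξ - η) + s η + s ξ) * (F (ξ - η) * G η)) ^ 2 < ⊤ := by
    refine hmain.trans_lt ?_
    have a1 := ENNReal.pow_lt_top (n := 2) hu
    have a2 := ENNReal.pow_lt_top (n := 2) hv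
    have a3 := ENNReal.pow_lt_top (n := 2) (ENNReal.ofReal_lt_top (r := (eLpNorm σ 2 volume).toReal))
    exact ENNReal.mul_lt_top (ENNReal.mul_lt_top (ENNReal.mul_lt_top (by norm_num) a3) a1) a2
  -- Finiteness of the integral of the square forces the inner integral to be finite for almost
  -- every `ξ`; dividing by the positive weight at `ξ` gives absolute convergence.
  have hint : ∀ᵐ ξ : Sp n, Integrable (fun η : Sp n => g₁ (ξ - η) * g₂ η) := by
    filter_upwards [ae_ne_zero hn, ae_lt_top (by fun_prop) hfin.ne] with ξ hξ hlt
    refine ⟨(Measurable.aestronglyMeasurable (by fun_prop)), ?_⟩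
    rw [hasFiniteIntegral_iff_enorm]
    have h1 := hpt ξ hξ
    have hw : ‖(weight ρ ν hi lo ξ : ℂ)‖ₑ ≠ 0 := by
      simpa using (weight_pos ρ ν hi lo hξ).ne'
    have h2 : ∫⁻ η, (s (ξ - η) + s η + s ξ) * (F (ξ - η) * G η) < ⊤ := by
      by_contra h
      rw [not_lt_top_iff.1 h] at hlt
      simp at hlt
    exact ENNReal.lt_top_of_mul_ne_top_right (h1.trans_lt h2).ne hw
  have hcm : AEStronglyMeasurable (convF g₁ g₂) := by
    refine AEStronglyMeasurable.const_mul ?_ _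
    have : StronglyMeasurable (Function.uncurry fun ξ η : Sp n => g₁ (ξ - η) * g₂ η) :=
      Measurable.stronglyMeasurable (by fun_prop)
    exact this.integral_prod_right.aestronglyMeasurable
  have hnorm : eLpNorm (fun ξ => (weight ρ ν hi lo ξ : ℂ) * convF g₁ g₂ ξ) 2 volume ≤
      ENNReal.ofReal (c * (3 * (eLpNorm σ 2 volume).toReal)) * gevreyNorm ρ ν h₁ l₁ u *
        gevreyNorm ρ ν h₂ l₂ v := by
    rw [← ENNReal.pow_le_pow_left_iff (n := 2) two_ne_zero, eLpNorm_two_sq]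
    calc ∫⁻ ξ, ‖(weight ρ ν hi lo ξ : ℂ) * convF g₁ g₂ ξ‖ₑ ^ 2
        ≤ ∫⁻ ξ, ENNReal.ofReal c ^ 2 *
            (∫⁻ η, (s (ξ - η) + s η + s ξ) * (F (ξ - η) * G η)) ^ 2 := by
          refine lintegral_mono_ae ?_
          filter_upwards [ae_ne_zero hn] with ξ hξ
          rw [← mul_pow]
          gcongr
          rw [convF, ← hc, enorm_mul, enorm_mul]
          have h1 : ‖(c : ℂ)‖ₑ = ENNReal.ofReal c := by
            rw [← ofReal_norm, Complex.norm_real, Real.norm_of_nonneg hcpos.le]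
          rw [h1, mul_left_comm]
          gcongr
          refine le_trans ?_ (hpt ξ hξ)
          gcongr
          exact enorm_integral_le_lintegral_enorm _
      _ = ENNReal.ofReal c ^ 2 *
            ∫⁻ ξ, (∫⁻ η, (s (ξ - η) + s η + s ξ) * (F (ξ - η) * G η)) ^ 2 := by
          rw [lintegral_const_mul _ (by fun_prop)]
      _ ≤ _ := (mul_le_mul_right hmain _).trans (le_of_eq ?_)
    rw [ENNReal.ofReal_mul hcpos.le, ENNReal.ofReal_mul (by norm_num)]
    have : ENNReal.ofReal 3 = 3 := by norm_num
    rw [this]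
    ring
  obtain ⟨w, hw⟩ := exists_hasFourier_of_weight hn hρ hlo hcm (hnorm.trans_lt
    (ENNReal.mul_lt_top (ENNReal.mul_lt_top ENNReal.ofReal_lt_top hu) hv))
  have hmul : mul u v = w := mul_eq_of_hasFourier hu2 hv2 hint hw
  have e := ae_eq_convolution_integrand hg₁.symm hg₂.symm
  have e2 : convF g₁ g₂ = convF (fhat u) (fhat v) := by
    ext ξ
    rw [convF, convF, integral_congr_ae (e ξ)]
  refine ⟨⟨hu1, hv1, ?_, ?_⟩, ?_⟩
  · filter_upwards [hint] with ξ hξ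
    exact hξ.congr (e ξ)
  · rw [hmul, ← e2]
    exact hw
  · rw [hmul, hw.gevreyNorm_eq]
    exact hnorm

/-! ### Bounded linear and bilinear operators between the weighted spaces -/

/-- `D` is a contraction from the space with exponents `(h, l)` to that with `(h', l')`,
uniformly in `ρ` and `ν`. -/
structure BddLin {n : ℕ} (D : TD n → TD n) (h l h' l' : ℝ) : Prop where
  bound : ∀ ρ ν : ℝ, 0 ≤ ρ → ∀ u, gevreyNorm ρ ν h l u < ⊤ →
    gevreyNorm ρ ν h' l' (D u) ≤ gevreyNorm ρ ν h l u
  sub : ∀ ρ ν : ℝ, 0 ≤ ρ → ∀ u v, gevreyNorm ρ ν h l u < ⊤ → gevreyNorm ρ ν h l v < ⊤ →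
    D (u - v) = D u - D v

/-- `T` is bilinear and bounded from the spaces with exponents `(h₁, l₁)`, `(h₂, l₂)` to that with
`(h, l)`, with constant `C` uniformly in `ρ` and `ν`. -/
structure BddBilin {n : ℕ} (T : TD n → TD n → TD n) (h₁ l₁ h₂ l₂ h l C : ℝ) : Prop where
  nonneg : 0 ≤ C
  bound : ∀ ρ ν : ℝ, 0 ≤ ρ → 0 ≤ ν → ν ≤ 1 → ∀ u v, gevreyNorm ρ ν h₁ l₁ u < ⊤ →
    gevreyNorm ρ ν h₂ l₂ v < ⊤ → gevreyNorm ρ ν h l (T u v) ≤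
      ENNReal.ofReal C * gevreyNorm ρ ν h₁ l₁ u * gevreyNorm ρ ν h₂ l₂ v
  sub_left : ∀ ρ ν : ℝ, 0 ≤ ρ → 0 ≤ ν → ν ≤ 1 → ∀ u u' v, gevreyNorm ρ ν h₁ l₁ u < ⊤ →
    gevreyNorm ρ ν h₁ l₁ u' < ⊤ → gevreyNorm ρ ν h₂ l₂ v < ⊤ → T (u - u') v = T u v - T u' v
  sub_right : ∀ ρ ν : ℝ, 0 ≤ ρ → 0 ≤ ν → ν ≤ 1 → ∀ u v v', gevreyNorm ρ ν h₁ l₁ u < ⊤ →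
    gevreyNorm ρ ν h₂ l₂ v < ⊤ → gevreyNorm ρ ν h₂ l₂ v' < ⊤ → T u (v - v') = T u v - T u v'

theorem BddLin.lt_top {n : ℕ} {D : TD n → TD n} {h l h' l' : ℝ} (hD : BddLin D h l h' l')
    {ρ ν : ℝ} (hρ : 0 ≤ ρ) {u : TD n} (hu : gevreyNorm ρ ν h l u < ⊤) :
    gevreyNorm ρ ν h' l' (D u) < ⊤ :=
  (hD.bound ρ ν hρ u hu).trans_lt hu

theorem BddLin.comp {n : ℕ} {D D' : TD n → TD n} {h l h' l' h'' l'' : ℝ}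
    (hD' : BddLin D' h' l' h'' l'') (hD : BddLin D h l h' l') :
    BddLin (fun u => D' (D u)) h l h'' l'' where
  bound ρ ν hρ u hu := (hD'.bound ρ ν hρ _ (hD.lt_top hρ hu)).trans (hD.bound ρ ν hρ u hu)
  sub ρ ν hρ u v hu hv := by
    rw [hD.sub ρ ν hρ u v hu hv, hD'.sub ρ ν hρ _ _ (hD.lt_top hρ hu) (hD.lt_top hρ hv)]

theorem BddLin.id {n : ℕ} (h l : ℝ) : BddLin (fun u : TD n => u) h l h l where
  bound _ _ _ _ _ := le_rfl
  sub _ _ _ _ _ _ _ := rfl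

theorem BddBilin.comp {n : ℕ} {T : TD n → TD n → TD n} {D₁ D₂ : TD n → TD n}
    {h₁ l₁ h₂ l₂ h₁' l₁' h₂' l₂' h l C : ℝ} (hT : BddBilin T h₁' l₁' h₂' l₂' h l C)
    (hD₁ : BddLin D₁ h₁ l₁ h₁' l₁') (hD₂ : BddLin D₂ h₂ l₂ h₂' l₂') :
    BddBilin (fun u v => T (D₁ u) (D₂ v)) h₁ l₁ h₂ l₂ h l C where
  nonneg := hT.nonneg
  bound ρ ν hρ hν hν1 u v hu hv := by
    refine (hT.bound ρ ν hρ hν hν1 _ _ (hD₁.lt_top hρ hu) (hD₂.lt_top hρ hv)).trans ?_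
    gcongr
    · exact hD₁.bound ρ ν hρ u hu
    · exact hD₂.bound ρ ν hρ v hv
  sub_left ρ ν hρ hν hν1 u u' v hu hu' hv := by
    rw [hD₁.sub ρ ν hρ u u' hu hu', hT.sub_left ρ ν hρ hν hν1 _ _ _ (hD₁.lt_top hρ hu)
      (hD₁.lt_top hρ hu') (hD₂.lt_top hρ hv)]
  sub_right ρ ν hρ hν hν1 u v v' hu hv hv' := by
    rw [hD₂.sub ρ ν hρ v v' hv hv', hT.sub_right ρ ν hρ hν hν1 _ _ _ (hD₁.lt_top hρ hu)
      (hD₂.lt_top hρ hv) (hD₂.lt_top hρ hv')]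

theorem BddBilin.lt_top {n : ℕ} {T : TD n → TD n → TD n} {h₁ l₁ h₂ l₂ h l C : ℝ}
    (hT : BddBilin T h₁ l₁ h₂ l₂ h l C) {ρ ν : ℝ} (hρ : 0 ≤ ρ) (hν : 0 ≤ ν) (hν1 : ν ≤ 1)
    {u v : TD n} (hu : gevreyNorm ρ ν h₁ l₁ u < ⊤) (hv : gevreyNorm ρ ν h₂ l₂ v < ⊤) :
    gevreyNorm ρ ν h l (T u v) < ⊤ :=
  (hT.bound ρ ν hρ hν hν1 u v hu hv).trans_lt
    (ENNReal.mul_lt_top (ENNReal.mul_lt_top ENNReal.ofReal_lt_top hu) hv)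

theorem BddLin.comp_bilin {n : ℕ} {T : TD n → TD n → TD n} {D : TD n → TD n}
    {h₁ l₁ h₂ l₂ h l h' l' C : ℝ} (hD : BddLin D h l h' l')
    (hT : BddBilin T h₁ l₁ h₂ l₂ h l C) :
    BddBilin (fun u v => D (T u v)) h₁ l₁ h₂ l₂ h' l' C where
  nonneg := hT.nonneg
  bound ρ ν hρ hν hν1 u v hu hv :=
    (hD.bound ρ ν hρ _ (hT.lt_top hρ hν hν1 hu hv)).trans (hT.bound ρ ν hρ hν hν1 u v hu hv)
  sub_left ρ ν hρ hν hν1 u u' v hu hu' hv := by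
    rw [hT.sub_left ρ ν hρ hν hν1 u u' v hu hu' hv,
      hD.sub ρ ν hρ _ _ (hT.lt_top hρ hν hν1 hu hv) (hT.lt_top hρ hν hν1 hu' hv)]
  sub_right ρ ν hρ hν hν1 u v v' hu hv hv' := by
    rw [hT.sub_right ρ ν hρ hν hν1 u v v' hu hv hv',
      hD.sub ρ ν hρ _ _ (hT.lt_top hρ hν hν1 hu hv) (hT.lt_top hρ hν hν1 hu hv')]

theorem BddBilin.add {n : ℕ} {S T : TD n → TD n → TD n} {h₁ l₁ h₂ l₂ h l C C' : ℝ}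
    (hS : BddBilin S h₁ l₁ h₂ l₂ h l C) (hT : BddBilin T h₁ l₁ h₂ l₂ h l C') :
    BddBilin (fun u v => S u v + T u v) h₁ l₁ h₂ l₂ h l (C + C') where
  nonneg := add_nonneg hS.nonneg hT.nonneg
  bound ρ ν hρ hν hν1 u v hu hv := by
    refine (gevreyNorm_add_le _ _ _ _ _ _).trans ?_
    rw [ENNReal.ofReal_add hS.nonneg hT.nonneg, add_mul, add_mul]
    exact add_le_add (hS.bound ρ ν hρ hν hν1 u v hu hv) (hT.bound ρ ν hρ hν hν1 u v hu hv)
  sub_left ρ ν hρ hν hν1 u u' v hu hu' hv := by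
    rw [hT.sub_left ρ ν hρ hν hν1 u u' v hu hu' hv, hS.sub_left ρ ν hρ hν hν1 u u' v hu hu' hv]
    abel
  sub_right ρ ν hρ hν hν1 u v v' hu hv hv' := by
    rw [hT.sub_right ρ ν hρ hν hν1 u v v' hu hv hv', hS.sub_right ρ ν hρ hν hν1 u v v' hu hv hv']
    abel

theorem BddBilin.smul {n : ℕ} {T : TD n → TD n → TD n} {h₁ l₁ h₂ l₂ h l C : ℝ}
    (hT : BddBilin T h₁ l₁ h₂ l₂ h l C) (c : ℂ) :
    BddBilin (fun u v => c • T u v) h₁ l₁ h₂ l₂ h l (‖c‖ * C) where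
  nonneg := mul_nonneg (norm_nonneg _) hT.nonneg
  bound ρ ν hρ hν hν1 u v hu hv := by
    refine (gevreyNorm_smul_le _ _ _ _ _ _).trans ?_
    rw [ENNReal.ofReal_mul (norm_nonneg _), mul_assoc, mul_assoc, ofReal_norm, ← mul_assoc _ _
      (gevreyNorm ρ ν h₂ l₂ v)]
    gcongr
    exact hT.bound ρ ν hρ hν hν1 u v hu hv
  sub_left ρ ν hρ hν hν1 u u' v hu hu' hv := by
    rw [hT.sub_left ρ ν hρ hν hν1 u u' v hu hu' hv, smul_sub]
  sub_right ρ ν hρ hν hν1 u v v' hu hv hv' := by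
    rw [hT.sub_right ρ ν hρ hν hν1 u v v' hu hv hv', smul_sub]

theorem BddBilin.sum {n : ℕ} {ι : Type*} (s : Finset ι) {T : ι → TD n → TD n → TD n}
    {h₁ l₁ h₂ l₂ h l C : ℝ} (hT : ∀ i, BddBilin (T i) h₁ l₁ h₂ l₂ h l C) :
    BddBilin (fun u v => ∑ i ∈ s, T i u v) h₁ l₁ h₂ l₂ h l (s.card * C) := by
  classical
  induction s using Finset.induction_on with
  | empty =>
    refine ⟨by simp, fun ρ ν _ _ _ u v _ _ => ?_, by simp, by simp⟩
    simp [gevreyNorm_zero]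
  | insert a s ha ih =>
    simp_rw [Finset.sum_insert ha, Finset.card_insert_of_notMem ha]
    convert (hT a).add ih using 1
    push_cast
    ring

/-! ### The linear operators -/

/-- The exponential factor is common to both sides, so only the power weights have to be compared.
-/
theorem gevreyNorm_le_of_ae {n : ℕ} {u v : TD n} {g g' : Sp n → ℂ} (hu : HasFourier u g)
    (hv : HasFourier v g') {ρ ν h l h' l' : ℝ}
    (hle : ∀ᵐ ξ, powWeight h' l' ξ * ‖g' ξ‖ ≤ powWeight h l ξ * ‖g ξ‖) :
    gevreyNorm ρ ν h' l' v ≤ gevreyNorm ρ ν h l u := by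
  rw [hu.gevreyNorm_eq, hv.gevreyNorm_eq]
  refine eLpNorm_mono_ae ?_
  filter_upwards [hle] with ξ hξ
  rw [norm_mul, norm_mul, Complex.norm_real, Complex.norm_real,
    Real.norm_of_nonneg (weight_nonneg _ _ _ _ _), Real.norm_of_nonneg (weight_nonneg _ _ _ _ _),
    weight_eq, weight_eq, mul_assoc, mul_assoc]
  gcongr

theorem powWeight_sub_mul {n : ℕ} (h l s : ℝ) {ξ : Sp n} (hξ : ξ ≠ 0) :
    powWeight (h - s) (l - s) ξ * ‖ξ‖ ^ s = powWeight h l ξ := by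
  rw [← powWeight_same, ← powWeight_add _ _ _ _ hξ]
  simp

theorem bddLin_pd {n : ℕ} (hn : 0 < n) (i : Fin n) (h l : ℝ) :
    BddLin (pd i) h l (h - 1) (l - 1) where
  bound ρ ν _ u hu := by
    have hf := hasFourier_fhat_of_lt_top hu
    refine gevreyNorm_le_of_ae hf (hf.pd i) ?_
    filter_upwards [ae_ne_zero hn] with ξ hξ
    rw [← powWeight_sub_mul h l 1 hξ, Real.rpow_one, norm_mul, norm_mul, Complex.norm_I, one_mul,
      Complex.norm_real, mul_assoc]
    have := powWeight_nonneg (h - 1) (l - 1) ξ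
    gcongr
    exact PiLp.norm_apply_le ξ i
  sub ρ ν _ u v _ _ := by
    ext θ
    simp [pd]

theorem bddLin_laplacian {n : ℕ} (hn : 0 < n) (h l : ℝ) :
    BddLin (fun u : TD n => Δ u) h l (h - 2) (l - 2) where
  bound ρ ν _ u hu := by
    have hf := hasFourier_fhat_of_lt_top hu
    refine gevreyNorm_le_of_ae hf hf.laplacian ?_
    filter_upwards [ae_ne_zero hn] with ξ hξ
    rw [← powWeight_sub_mul h l 2 hξ, Real.rpow_two, norm_mul, norm_neg,
      Complex.norm_real, mul_assoc, Real.norm_of_nonneg (by positivity)]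
  sub ρ ν _ u v _ _ := by
    ext θ
    simp

theorem conjD_sub {n : ℕ} (u v : TD n) : conjD (u - v) = conjD u - conjD v := by
  ext θ
  change (starRingEnd ℂ) (u (conjS θ) - v (conjS θ)) = _
  rw [map_sub]
  rfl

theorem powWeight_neg_arg {n : ℕ} (h l : ℝ) (ξ : Sp n) : powWeight h l (-ξ) = powWeight h l ξ := by
  simp [powWeight]

theorem bddLin_conjD {n : ℕ} (h l : ℝ) : BddLin (conjD : TD n → TD n) h l h l where
  bound ρ ν _ u hu := by
    have hf := hasFourier_fhat_of_lt_top hu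
    rw [hf.gevreyNorm_eq, hf.conjD.gevreyNorm_eq]
    have h1 := eLpNorm_comp_measurePreserving (p := 2)
      (g := fun ξ => (weight ρ ν h l ξ : ℂ) * fhat u ξ)
      (aestronglyMeasurable_weight_mul hf.1.aestronglyMeasurable)
      (Measure.measurePreserving_neg (volume : Measure (Sp n)))
    rw [← h1]
    refine le_of_eq (eLpNorm_congr_norm_ae (Eventually.of_forall fun ξ => ?_))
    simp [weight_eq, powWeight_neg_arg]
  sub ρ ν _ u v _ _ := conjD_sub u v

theorem bddLin_reD {n : ℕ} (h l : ℝ) : BddLin (reD : TD n → TD n) h l h l where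
  bound ρ ν hρ u hu := by
    refine (gevreyNorm_smul_le _ _ _ _ _ _).trans ?_
    have h1 := (gevreyNorm_add_le ρ ν h l u (conjD u)).trans
      (add_le_add le_rfl ((bddLin_conjD h l).bound ρ ν hρ u hu))
    refine (mul_le_mul_right h1 _).trans (le_of_eq ?_)
    rw [← two_mul, ← mul_assoc]
    have : ‖(1 / 2 : ℂ)‖ₑ * 2 = 1 := by
      rw [← ofReal_norm]
      norm_num
      rw [ENNReal.ofReal_div_of_pos (by norm_num)]
      norm_num
      exact ENNReal.inv_mul_cancel (by norm_num) (by norm_num)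
    rw [this, one_mul]
  sub ρ ν _ u v _ _ := by
    rw [reD, reD, reD, conjD_sub]
    refine Eq.trans ?_ (smul_sub (1 / 2 : ℂ) (u + conjD u) (v + conjD v))
    congr 1
    abel

/-- The condition on `l - s` keeps the multiplied function the transform of a tempered distribution,
so that `ofFourier` does not fall back to its default. -/
theorem hasFourier_absNabla {n : ℕ} (hn : 0 < n) {ρ ν h l s : ℝ} (hρ : 0 ≤ ρ)
    (hs : l - s < (n : ℝ) / 2) {u : TD n} (hu : gevreyNorm ρ ν h l u < ⊤) :
    HasFourier (absNabla s u) (fun ξ => ((‖ξ‖ ^ s : ℝ) : ℂ) * fhat u ξ) := by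
  have hf := hasFourier_fhat_of_lt_top hu
  have hm : AEStronglyMeasurable (fun ξ : Sp n => ((‖ξ‖ ^ s : ℝ) : ℂ) * fhat u ξ) :=
    (Measurable.aestronglyMeasurable (by fun_prop)).mul hf.1.aestronglyMeasurable
  obtain ⟨w, hw⟩ := exists_hasFourier_of_weight (ρ := ρ) (ν := ν) (hi := h - s) hn hρ hs hm (by
    refine lt_of_le_of_lt ?_ hu
    rw [hf.gevreyNorm_eq]
    refine eLpNorm_mono_ae ?_
    filter_upwards [ae_ne_zero hn] with ξ hξ
    rw [norm_mul, norm_mul, norm_mul, Complex.norm_real, Complex.norm_real, Complex.norm_real,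
      Real.norm_of_nonneg (weight_nonneg _ _ _ _ _), Real.norm_of_nonneg (weight_nonneg _ _ _ _ _),
      weight_eq, weight_eq, ← powWeight_sub_mul h l s hξ, Real.norm_of_nonneg (by positivity)]
    apply le_of_eq
    ring)
  rw [absNabla, hw.ofFourier_eq]
  exact hw

theorem bddLin_absNabla {n : ℕ} (hn : 0 < n) {h l s : ℝ} (hs : l - s < (n : ℝ) / 2) :
    BddLin (absNabla s : TD n → TD n) h l (h - s) (l - s) where
  bound ρ ν hρ u hu := by
    refine gevreyNorm_le_of_ae (hasFourier_fhat_of_lt_top hu) (hasFourier_absNabla hn hρ hs hu) ?_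
    filter_upwards [ae_ne_zero hn] with ξ hξ
    rw [← powWeight_sub_mul h l s hξ, norm_mul, Complex.norm_real, mul_assoc,
      Real.norm_of_nonneg (by positivity)]
  sub ρ ν hρ u v hu hv := by
    have h1 := hasFourier_absNabla hn hρ hs hu
    have h2 := hasFourier_absNabla hn hρ hs hv
    have h3 := (hasFourier_fhat_of_lt_top hu).sub (hasFourier_fhat_of_lt_top hv)
    have h4 := hasFourier_absNabla hn hρ hs ((gevreyNorm_sub_le ρ ν h l u v).trans_lt
      (ENNReal.add_lt_top.2 ⟨hu, hv⟩))
    refine h4.unique ((h1.sub h2).congr ?_)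
    filter_upwards [h3.fhat_ae_eq] with ξ hξ
    rw [hξ]
    ring

/-! ### Pointwise bounds on the weights -/

/-- Radial profile of the weight `powWeight`. -/
def pw (h l r : ℝ) : ℝ := if 1 < r then r ^ h else r ^ l

theorem powWeight_eq_pw {n : ℕ} (h l : ℝ) (ξ : Sp n) : powWeight h l ξ = pw h l ‖ξ‖ := rfl

theorem pw_pos (h l : ℝ) {r : ℝ} (hr : 0 < r) : 0 < pw h l r := by
  unfold pw
  split_ifs <;> positivity

theorem pw_add (h l h' l' : ℝ) {r : ℝ} (hr : 0 < r) :
    pw (h + h') (l + l') r = pw h l r * pw h' l' r := by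
  unfold pw
  split_ifs <;> rw [Real.rpow_add hr]

theorem pw_le_of_le_two_mul {h l z x : ℝ} (hh : 0 ≤ h) (hl : 0 ≤ l) (hz : 0 < z) (hx : 0 < x)
    (hzx : z ≤ 2 * x) : pw h l z ≤ 2 ^ (h + l) * pw h l x := by
  have h2h : (1 : ℝ) ≤ 2 ^ h := Real.one_le_rpow (by norm_num) hh
  have h2l : (1 : ℝ) ≤ 2 ^ l := Real.one_le_rpow (by norm_num) hl
  rw [Real.rpow_add (by norm_num)]
  unfold pw
  split_ifs with h1 h2 h2
  · calc z ^ h ≤ (2 * x) ^ h := by gcongr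
      _ = 2 ^ h * 1 * x ^ h := by rw [Real.mul_rpow (by norm_num) hx.le, mul_one]
      _ ≤ _ := by gcongr
  · push Not at h2
    have a : z ^ h ≤ 2 ^ h := by
      gcongr
      linarith
    have b : 1 ≤ 2 ^ l * x ^ l := by
      rw [← Real.mul_rpow (by norm_num) hx.le]
      exact Real.one_le_rpow (by linarith) hl
    calc z ^ h ≤ 2 ^ h * 1 := by rw [mul_one]; exact a
      _ ≤ 2 ^ h * (2 ^ l * x ^ l) := by gcongr
      _ = _ := by ring
  · have a : z ^ l ≤ 1 := Real.rpow_le_one hz.le (not_lt.1 h1) hl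
    have b : 1 ≤ x ^ h := Real.one_le_rpow h2.le hh
    calc z ^ l ≤ 1 * 1 * 1 := by simpa using a
      _ ≤ _ := by gcongr
  · calc z ^ l ≤ (2 * x) ^ l := by gcongr
      _ = 1 * 2 ^ l * x ^ l := by rw [Real.mul_rpow (by norm_num) hx.le, one_mul]
      _ ≤ _ := by gcongr

/-- On one side of the unit sphere, monotonicity of powers in the base and in the exponent suffices;
if `y ≤ 1 < x`, the value 1 separates the two profiles. -/
theorem pw_le_of_le {e f s a x y : ℝ} (hy : 0 < y) (hyx : y ≤ x) (he : e ≤ 0) (hes : e ≤ s)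
    (ha : a ≤ 0) (haf : a ≤ f) : pw e f x ≤ pw s a y := by
  unfold pw
  split_ifs with h1 h2 h2
  · exact (Real.rpow_le_rpow_of_nonpos hy hyx he).trans
      (Real.rpow_le_rpow_of_exponent_le h2.le hes)
  · exact (Real.rpow_le_one_of_one_le_of_nonpos h1.le he).trans
      (Real.one_le_rpow_of_pos_of_le_one_of_nonpos hy (not_lt.1 h2) ha)
  · exact absurd (h2.trans_le hyx) h1
  · push Not at h1 h2
    rcases le_total 0 f with hf | hf
    · exact (Real.rpow_le_one (hy.le.trans hyx) h1 hf).trans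
        (Real.one_le_rpow_of_pos_of_le_one_of_nonpos hy h2 ha)
    · exact (Real.rpow_le_rpow_of_nonpos hy hyx hf).trans
        (Real.rpow_le_rpow_of_exponent_ge hy h2 haf)

/-- As `z ≤ 2x`, the output weight can be moved to the larger input frequency `x`. The regularity of
the first factor left over there is then spent at the smaller frequency `y`, where it combines with
the second weight into the kernel with exponents `-s` and `-a`. For `s > n/2 > a` that kernel is
square integrable. -/
theorem pw_le_mul_of_le {h l h₁ l₁ h₂ l₂ s a z x y : ℝ} (hh : 0 ≤ h) (hl : 0 ≤ l) (hz : 0 < z)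
    (hy : 0 < y) (hyx : y ≤ x) (hzxy : z ≤ x + y) (hh₁ : h ≤ h₁) (hs : s ≤ h₁ + h₂ - h)
    (hl₂ : l₂ ≤ a) (hl₁₂ : l₁ + l₂ - l ≤ a) :
    pw h l z ≤ 2 ^ (h + l) * pw (-s) (-a) y * (pw h₁ l₁ x * pw h₂ l₂ y) := by
  have hx : 0 < x := hy.trans_le hyx
  have h1 := pw_le_of_le_two_mul hh hl hz hx (by linarith)
  have h2 : pw (h - h₁) (l - l₁) x ≤ pw (-s + h₂) (-a + l₂) y :=
    pw_le_of_le hy hyx (by linarith) (by linarith) (by linarith) (by linarith)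
  have h3 : pw h l x = pw (h - h₁) (l - l₁) x * pw h₁ l₁ x := by
    rw [← pw_add _ _ _ _ hx]
    simp
  rw [pw_add _ _ _ _ hy] at h2
  have p1 := pw_pos h₁ l₁ hx
  calc pw h l z ≤ 2 ^ (h + l) * pw h l x := h1
    _ = 2 ^ (h + l) * (pw (h - h₁) (l - l₁) x * pw h₁ l₁ x) := by rw [h3]
    _ ≤ 2 ^ (h + l) * ((pw (-s) (-a) y * pw h₂ l₂ y) * pw h₁ l₁ x) := by gcongr
    _ = _ := by ring

theorem norm_le_sub_add {n : ℕ} (ξ η : Sp n) : ‖ξ‖ ≤ ‖ξ - η‖ + ‖η‖ := by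
  simpa using norm_add_le (ξ - η) η

/-- The smaller of the two input frequencies carries the kernel. The summand in `ξ` only completes
the form required by `exists_mul_bound`. -/
theorem powWeight_kernel {n : ℕ} {h l h₁ l₁ h₂ l₂ s a : ℝ} (hh : 0 ≤ h) (hl : 0 ≤ l)
    (hh₁ : h ≤ h₁) (hh₂ : h ≤ h₂) (hs : s ≤ h₁ + h₂ - h) (hl₁ : l₁ ≤ a) (hl₂ : l₂ ≤ a)
    (hl₁₂ : l₁ + l₂ - l ≤ a) {ξ η : Sp n} (hξ : ξ ≠ 0) (hη : η ≠ 0) (hξη : ξ - η ≠ 0) :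
    powWeight h l ξ ≤ (2 ^ (h + l) * powWeight (-s) (-a) (ξ - η) +
      2 ^ (h + l) * powWeight (-s) (-a) η + 2 ^ (h + l) * powWeight (-s) (-a) ξ) *
      (powWeight h₁ l₁ (ξ - η) * powWeight h₂ l₂ η) := by
  simp only [powWeight_eq_pw]
  have hz := norm_pos_iff.2 hξ
  have hy := norm_pos_iff.2 hη
  have hx := norm_pos_iff.2 hξη
  have hzxy := norm_le_sub_add ξ η
  set x := ‖ξ - η‖
  set y := ‖η‖
  set z := ‖ξ‖
  have p1 := pw_pos (-s) (-a) hx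
  have p2 := pw_pos (-s) (-a) hy
  have p3 := pw_pos (-s) (-a) hz
  have p4 := pw_pos h₁ l₁ hx
  have p5 := pw_pos h₂ l₂ hy
  have p6 : (0 : ℝ) < 2 ^ (h + l) := by positivity
  rcases le_total y x with hyx | hyx
  · refine (pw_le_mul_of_le hh hl hz hy hyx hzxy hh₁ hs hl₂ hl₁₂).trans ?_
    gcongr
    have := mul_pos p6 p1
    have := mul_pos p6 p3
    linarith
  · refine (pw_le_mul_of_le (s := s) (h₂ := h₁) (l₁ := l₂) hh hl hz hx hyx (by linarith) hh₂
      (by linarith) hl₁ (by linarith)).trans ?_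
    rw [mul_comm (pw h₂ l₂ y)]
    gcongr
    have := mul_pos p6 p2
    have := mul_pos p6 p3
    linarith

/-- The product in the weighted spaces. -/
theorem exists_bddBilin_mul {n : ℕ} (hn : 0 < n) {h l h₁ l₁ h₂ l₂ a : ℝ}
    (ha : a < (n : ℝ) / 2) (hlo : l < (n : ℝ) / 2) (hh : 0 ≤ h) (hl : 0 ≤ l)
    (hh₁ : h ≤ h₁) (hh₂ : h ≤ h₂) (hs : (n : ℝ) / 2 < h₁ + h₂ - h) (hl₁ : l₁ ≤ a) (hl₂ : l₂ ≤ a)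
    (hl₁₂ : l₁ + l₂ - l ≤ a) : ∃ C, BddBilin (mul : TD n → TD n → TD n) h₁ l₁ h₂ l₂ h l C := by
  obtain ⟨C, hC, hb⟩ := exists_mul_bound (n := n) hn hlo
    (σ := fun ξ => 2 ^ (h + l) * powWeight (-(h₁ + h₂ - h)) (-a) ξ)
    ((measurable_powWeight _ _).const_mul _)
    (fun ξ => mul_nonneg (by positivity) (powWeight_nonneg _ _ _))
    ((memLp_powWeight hn (by linarith) (by linarith)).const_mul _)
    (fun ξ η hξ hη hξη => powWeight_kernel hh hl hh₁ hh₂ le_rfl hl₁ hl₂ hl₁₂ hξ hη hξη)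
  exact ⟨C, hC, fun ρ ν hρ hν hν1 u v hu hv => (hb ρ ν hρ hν hν1 u v hu hv).2,
    fun ρ ν hρ hν hν1 u u' v hu hu' hv => (hb ρ ν hρ hν hν1 u v hu hv).1.sub_left
      (hb ρ ν hρ hν hν1 u' v hu' hv).1,
    fun ρ ν hρ hν hν1 u v v' hu hv hv' => (hb ρ ν hρ hν hν1 u v hu hv).1.sub_right
      (hb ρ ν hρ hν hν1 u v' hu hv').1⟩

/-- The product in spaces without low frequency singularity, with values in a space with an
arbitrary low frequency exponent `l` such that `|ξ|^l` is locally square integrable. -/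
theorem exists_bddBilin_mul_low {n : ℕ} (hn : 0 < n) {h l h₁ h₂ : ℝ}
    (hl : -((n : ℝ) / 2) < l) (hlo : l < (n : ℝ) / 2) (hh : 0 ≤ h)
    (hh₁ : h ≤ h₁) (hh₂ : h ≤ h₂) (hs : (n : ℝ) / 2 < h₁ + h₂ - h) :
    ∃ C, BddBilin (mul : TD n → TD n → TD n) h₁ 0 h₂ 0 h l C := by
  have hn2 : (0 : ℝ) < (n : ℝ) / 2 := by positivity
  have ha : max 0 (-l) < (n : ℝ) / 2 := max_lt hn2 (by linarith)
  have ha0 : 0 ≤ max 0 (-l) := le_max_left _ _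
  have hker : ∀ ξ η : Sp n, ξ ≠ 0 → η ≠ 0 → ξ - η ≠ 0 → powWeight h l ξ ≤
      (2 ^ (h + 0) * powWeight (-(h₁ + h₂ - h)) (-(max 0 (-l))) (ξ - η) +
        2 ^ (h + 0) * powWeight (-(h₁ + h₂ - h)) (-(max 0 (-l))) η +
        2 ^ (h + 0) * powWeight (-(h₁ + h₂ - h)) (-(max 0 (-l))) ξ) *
      (powWeight h₁ 0 (ξ - η) * powWeight h₂ 0 η) := by
    intro ξ η hξ hη hξη
    by_cases h1 : 1 < ‖ξ‖
    · have := powWeight_kernel (s := h₁ + h₂ - h) hh le_rfl hh₁ hh₂ le_rfl ha0 ha0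
        (by simp) hξ hη hξη
      refine le_trans (le_of_eq ?_) this
      simp [powWeight, h1]
    -- For low output frequency both input weights are at least 1, so the singular factor `|ξ|^l`
    -- must come from the kernel at `ξ`. It is locally square integrable because `l > -n/2`.
    · have hz := norm_pos_iff.2 hξ
      have q1 : 1 ≤ powWeight h₁ 0 (ξ - η) := by
        unfold powWeight
        split_ifs with h2
        · exact Real.one_le_rpow h2.le (hh.trans hh₁)
        · simp
      have q2 : 1 ≤ powWeight h₂ 0 η := by
        unfold powWeight
        split_ifs with h2
        · exact Real.one_le_rpow h2.le (hh.trans hh₂)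
        · simp
      have q3 : powWeight h l ξ ≤ powWeight (-(h₁ + h₂ - h)) (-(max 0 (-l))) ξ := by
        simp only [powWeight, h1, if_false]
        refine Real.rpow_le_rpow_of_exponent_ge hz (not_lt.1 h1) ?_
        linarith [le_max_right 0 (-l)]
      have q4 : (1 : ℝ) ≤ 2 ^ (h + 0) := Real.one_le_rpow (by norm_num) (by linarith)
      have q5 := powWeight_nonneg (-(h₁ + h₂ - h)) (-(max 0 (-l))) ξ
      have q6 := powWeight_nonneg (-(h₁ + h₂ - h)) (-(max 0 (-l))) η
      have q7 := powWeight_nonneg (-(h₁ + h₂ - h)) (-(max 0 (-l))) (ξ - η)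
      calc powWeight h l ξ ≤ (0 + 0 + 1 * powWeight (-(h₁ + h₂ - h)) (-(max 0 (-l))) ξ) * (1 * 1) := by
            simpa using q3
        _ ≤ _ := by
            gcongr <;> positivity
  obtain ⟨C, hC, hb⟩ := exists_mul_bound (n := n) (hi := h) (lo := l) (h₁ := h₁) (l₁ := 0)
    (h₂ := h₂) (l₂ := 0) hn hlo
    (σ := fun ξ => 2 ^ (h + 0) * powWeight (-(h₁ + h₂ - h)) (-(max 0 (-l))) ξ)
    ((measurable_powWeight _ _).const_mul _)
    (fun ξ => mul_nonneg (by positivity) (powWeight_nonneg _ _ _))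
    ((memLp_powWeight hn (by linarith) (by linarith)).const_mul _) hker
  exact ⟨C, hC, fun ρ ν hρ hν hν1 u v hu hv => (hb ρ ν hρ hν hν1 u v hu hv).2,
    fun ρ ν hρ hν hν1 u u' v hu hu' hv => (hb ρ ν hρ hν hν1 u v hu hv).1.sub_left
      (hb ρ ν hρ hν hν1 u' v hu' hv).1,
    fun ρ ν hρ hν hν1 u v v' hu hv hv' => (hb ρ ν hρ hν hν1 u v hu hv).1.sub_right
      (hb ρ ν hρ hν hν1 u v' hu hv').1⟩

/-! ### The nonlinear terms -/

/-- The operator `(φ, w) ↦ (2∇φ·∇ + (Δφ)) w` in the scale of spaces. -/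
theorem exists_bddBilin_transport {n : ℕ} (hn : 0 < n) {llow ℓ k K : ℝ} (hll : 0 ≤ llow)
    (hll2 : llow < (n : ℝ) / 2) (hK : 0 ≤ K) (hKℓ : K ≤ ℓ) (hKk : K ≤ k - 1)
    (hs : (n : ℝ) / 2 < ℓ + k - K) :
    ∃ C, BddBilin (transport : TD n → TD n → TD n) (ℓ + 2) llow k 0 K 0 C := by
  have hn2 : (0 : ℝ) < (n : ℝ) / 2 := by positivity
  -- The two gradients leave exponents `ℓ + 1` and `k - 1`, and the Laplacian term leaves `ℓ` and
  -- `k`; both have total `ℓ + k`, so the same excess over `K` is available.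
  obtain ⟨C₁, h₁⟩ := exists_bddBilin_mul (n := n) (h := K) (l := 0) (h₁ := ℓ + 2 - 1)
    (l₁ := llow - 1) (h₂ := k - 1) (l₂ := 0 - 1) hn hll2 hn2 hK le_rfl (by linarith) hKk
    (by linarith) (by linarith) (by linarith) (by linarith)
  obtain ⟨C₂, h₂⟩ := exists_bddBilin_mul (n := n) (h := K) (l := 0) (h₁ := ℓ + 2 - 2)
    (l₁ := llow - 2) (h₂ := k) (l₂ := 0) hn hll2 hn2 hK le_rfl (by linarith) (by linarith)
    (by linarith) (by linarith) (by linarith) (by linarith)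
  have h₃ := BddBilin.sum Finset.univ fun i : Fin n =>
    h₁.comp (bddLin_pd hn i (ℓ + 2) llow) (bddLin_pd hn i k 0)
  exact ⟨_, (h₃.smul 2).add (h₂.comp (bddLin_laplacian hn (ℓ + 2) llow) (BddLin.id k 0))⟩

/-- Each gradient costs one derivative at high frequency, hence the loss of one. At low frequency it
lowers the exponent, which leaves room in the product estimate. -/
theorem exists_bddBilin_gradDot {n : ℕ} (hn : 0 < n) {llow ℓ₁ ℓ₂ L : ℝ} (hll : 0 ≤ llow)
    (hll2 : llow < (n : ℝ) / 2) (hL : 0 ≤ L + 2) (h₁ : L + 1 ≤ ℓ₁) (h₂ : L + 1 ≤ ℓ₂)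
    (hs : (n : ℝ) / 2 < ℓ₁ + ℓ₂ - L) :
    ∃ C, BddBilin (gradDot : TD n → TD n → TD n) (ℓ₁ + 2) llow (ℓ₂ + 2) llow (L + 2) llow C := by
  obtain ⟨C₁, hC⟩ := exists_bddBilin_mul (n := n) (h := L + 2) (l := llow) (h₁ := ℓ₁ + 2 - 1)
    (l₁ := llow - 1) (h₂ := ℓ₂ + 2 - 1) (l₂ := llow - 1) hn hll2 hll2 hL hll (by linarith)
    (by linarith) (by linarith) (by linarith) (by linarith) (by linarith)
  exact ⟨_, BddBilin.sum Finset.univ fun i : Fin n =>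
    hC.comp (bddLin_pd hn i (ℓ₁ + 2) llow) (bddLin_pd hn i (ℓ₂ + 2) llow)⟩

/-- The product is placed in the space with low exponent `llow + μ - n`, which `|∇|^(μ-n)` turns
into `llow`. That exponent may be negative, but it exceeds `-n/2` precisely because `llow > n/2 -
μ`. -/
theorem exists_bddBilin_g0 {n : ℕ} (hn : 0 < n) {llow μ κ k₁ k₂ K : ℝ} (hμn : μ ≤ n)
    (hll2 : llow < (n : ℝ) / 2) (hll3 : (n : ℝ) / 2 - μ < llow)
    (hK : 0 ≤ K) (h₁ : K ≤ k₁) (h₂ : K ≤ k₂) (hs : (n : ℝ) / 2 < k₁ + k₂ - K) :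
    ∃ C, BddBilin (g0 κ μ : TD n → TD n → TD n) k₁ 0 k₂ 0 (K - (μ - n)) llow C := by
  obtain ⟨C, hC⟩ := exists_bddBilin_mul_low (n := n) (h := K) (l := llow + (μ - n)) hn
    (by linarith) (by linarith) hK h₁ h₂ hs
  have h3 := hC.comp (BddLin.id k₁ 0) (bddLin_conjD k₂ 0)
  have h4 : BddLin (absNabla (μ - n) : TD n → TD n) K (llow + (μ - n)) (K - (μ - n)) llow := by
    have := bddLin_absNabla (n := n) (h := K) (l := llow + (μ - n)) (s := μ - n) hn (by linarith)
    simpa using this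
  exact ⟨_, (((bddLin_reD _ _).comp h4).comp_bilin h3).smul κ⟩

/-! ### Estimating functions of time -/

/-- `∫_t^∞ s⁻¹ f(s) ds`. -/
def tailInt (f : ℝ → ℝ) (t : ℝ) : ℝ := ∫ s in Ioi t, s⁻¹ * f s

/-- Admissible densities: continuous, nonnegative and integrable against `s⁻¹` at infinity. -/
structure IsDensity (f : ℝ → ℝ) : Prop where
  cont : Continuous f
  nonneg : ∀ t, 0 ≤ f t
  int : IntegrableOn (fun s => s⁻¹ * f s) (Ioi 1)

theorem IsDensity.intervalIntegrable_inv {f : ℝ → ℝ} (hf : IsDensity f) {a b : ℝ} (ha : 0 < a)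
    (hb : 0 < b) : IntervalIntegrable (fun s => s⁻¹ * f s) volume a b := by
  refine ContinuousOn.intervalIntegrable (ContinuousOn.mul ?_ hf.cont.continuousOn)
  refine continuousOn_inv₀.mono fun x hx => ?_
  have := (mem_uIcc.1 hx)
  rcases this with h | h
  · exact (ha.trans_le h.1).ne'
  · exact (hb.trans_le h.1).ne'

theorem IsDensity.integrableOn_tail {f : ℝ → ℝ} (hf : IsDensity f) {t : ℝ} (ht : 0 < t) :
    IntegrableOn (fun s => s⁻¹ * f s) (Ioi t) := by
  rcases le_total t 1 with h | h
  · rw [← Ioc_union_Ioi_eq_Ioi h]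
    exact ((intervalIntegrable_iff_integrableOn_Ioc_of_le h).1
      (hf.intervalIntegrable_inv ht one_pos)).union hf.int
  · exact hf.int.mono_set (Ioi_subset_Ioi h)

theorem IsDensity.hasDerivAt_tailInt {f : ℝ → ℝ} (hf : IsDensity f) {t : ℝ} (ht : 0 < t) :
    HasDerivAt (tailInt f) (-(t⁻¹ * f t)) t := by
  have ht2 : 0 < t / 2 := by positivity
  have e : tailInt f =ᶠ[𝓝 t] fun x => tailInt f (t / 2) - ∫ s in (t / 2)..x, s⁻¹ * f s := by
    filter_upwards [Ioi_mem_nhds (show t / 2 < t by linarith)] with x hx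
    have hx' : t / 2 < x := hx
    rw [intervalIntegral.integral_of_le hx'.le, tailInt, tailInt, ← Ioc_union_Ioi_eq_Ioi hx'.le,
      setIntegral_union (Ioc_disjoint_Ioi le_rfl) measurableSet_Ioi
        ((intervalIntegrable_iff_integrableOn_Ioc_of_le hx'.le).1
        (hf.intervalIntegrable_inv ht2 (ht2.trans hx'))) (hf.integrableOn_tail (ht2.trans hx'))]
    ring
  have hc : ContinuousAt (fun s => s⁻¹ * f s) t :=
    (continuousAt_inv₀ ht.ne').mul hf.cont.continuousAt
  have hm : StronglyMeasurableAtFilter (fun s => s⁻¹ * f s) (𝓝 t) volume :=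
    ⟨univ, univ_mem, (measurable_inv.mul hf.cont.measurable).aestronglyMeasurable⟩
  have := (intervalIntegral.integral_hasDerivAt_right
    (hf.intervalIntegrable_inv ht2 ht) hm hc).const_sub (tailInt f (t / 2))
  exact this.congr_of_eventuallyEq e

theorem IsDensity.hasDerivAt_integral {f : ℝ → ℝ} (hf : IsDensity f) (t : ℝ) :
    HasDerivAt (fun x => ∫ s in (1 : ℝ)..x, f s) (f t) t :=
  intervalIntegral.integral_hasDerivAt_right (hf.cont.intervalIntegrable _ _)
    hf.cont.stronglyMeasurable.stronglyMeasurableAtFilter hf.cont.continuousAt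

theorem IsDensity.tailInt_nonneg {f : ℝ → ℝ} (hf : IsDensity f) {t : ℝ} (ht : 1 ≤ t) :
    0 ≤ tailInt f t := by
  refine setIntegral_nonneg measurableSet_Ioi fun s hs => ?_
  have : 0 < s := by have : t < s := hs; linarith
  exact mul_nonneg (by positivity) (hf.nonneg s)

theorem IsDensity.integrableOn_max {f : ℝ → ℝ} (hf : IsDensity f) (t : ℝ) :
    IntegrableOn (fun s => (max t s)⁻¹ * f s) (Ioi 1) := by
  refine Integrable.mono' hf.int ?_ ?_
  · exact ((by fun_prop : Measurable fun s : ℝ => (max t s)⁻¹).mul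
      hf.cont.measurable).aestronglyMeasurable
  · refine (ae_restrict_iff' measurableSet_Ioi).2 (Eventually.of_forall fun s hs => ?_)
    have hs1 : (1 : ℝ) < s := hs
    have h1 : s ≤ max t s := le_max_right _ _
    rw [norm_mul, Real.norm_of_nonneg (hf.nonneg s), Real.norm_of_nonneg (by positivity)]
    have := hf.nonneg s
    gcongr

theorem IsDensity.integral_max {f : ℝ → ℝ} (hf : IsDensity f) {t : ℝ} (ht : 1 ≤ t) :
    ∫ s in Ioi 1, (max t s)⁻¹ * f s = t⁻¹ * (∫ s in (1 : ℝ)..t, f s) + tailInt f t := by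
  have hi := hf.integrableOn_max t
  rw [← Ioc_union_Ioi_eq_Ioi ht] at hi ⊢
  rw [setIntegral_union (Ioc_disjoint_Ioi le_rfl) measurableSet_Ioi hi.left_of_union
    hi.right_of_union, intervalIntegral.integral_of_le ht, ← integral_const_mul, tailInt]
  congr 1
  · refine setIntegral_congr_fun measurableSet_Ioc fun s hs => ?_
    simp only [max_eq_left hs.2]
  · refine setIntegral_congr_fun measurableSet_Ioi fun s hs => ?_
    simp only [max_eq_right (le_of_lt (mem_Ioi.1 hs))]

theorem IsDensity.tendsto_integral_max {f : ℝ → ℝ} (hf : IsDensity f) :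
    Tendsto (fun t => ∫ s in Ioi 1, (max t s)⁻¹ * f s) atTop (𝓝 0) := by
  have h := tendsto_integral_filter_of_dominated_convergence
    (μ := volume.restrict (Ioi (1 : ℝ))) (l := atTop) (F := fun t s => (max t s)⁻¹ * f s)
    (f := fun _ => (0 : ℝ)) (fun s => s⁻¹ * f s)
    (Eventually.of_forall fun t => (hf.integrableOn_max t).aestronglyMeasurable)
    (Eventually.of_forall fun t => ?_) hf.int ?_
  · simpa using h
  · refine (ae_restrict_iff' measurableSet_Ioi).2 (Eventually.of_forall fun s hs => ?_)
    have hs1 : (1 : ℝ) < s := hs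
    have h1 : s ≤ max t s := le_max_right _ _
    rw [norm_mul, Real.norm_of_nonneg (hf.nonneg s), Real.norm_of_nonneg (by positivity)]
    have := hf.nonneg s
    gcongr
  · refine Eventually.of_forall fun s => ?_
    have h1 : Tendsto (fun t : ℝ => max t s) atTop atTop :=
      tendsto_atTop_mono (fun t => le_max_left t s) tendsto_id
    simpa using (tendsto_inv_atTop_zero.comp h1).mul_const (f s)

theorem le_of_hasDerivAt_le {F G F' G' : ℝ → ℝ} (hF : ∀ t, 1 ≤ t → HasDerivAt F (F' t) t)
    (hG : ∀ t, 1 ≤ t → HasDerivAt G (G' t) t) (h' : ∀ t, 1 ≤ t → F' t ≤ G' t) {s t : ℝ}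
    (hs : 1 ≤ s) (hst : s ≤ t) : F t - F s ≤ G t - G s := by
  have hm : MonotoneOn (fun x => G x - F x) (Ici 1) := by
    refine monotoneOn_of_deriv_nonneg (convex_Ici 1) ?_ ?_ ?_
    · exact fun x hx => ((hG x hx).sub (hF x hx)).continuousAt.continuousWithinAt
    · intro x hx
      rw [interior_Ici] at hx
      exact ((hG x (le_of_lt hx)).sub (hF x (le_of_lt hx))).differentiableAt.differentiableWithinAt
    · intro x hx
      rw [interior_Ici] at hx
      have e : deriv (fun x => G x - F x) x = G' x - F' x :=
        ((hG x (le_of_lt hx)).sub (hF x (le_of_lt hx))).deriv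
      rw [e]
      linarith [h' x (le_of_lt hx)]
  have := hm hs (hs.trans hst) hst
  simp only at this
  linarith

/-! ### Inequalities between the functions h, N_m, Q_m and the tails R_m. -/

section

variable {d : ℝ → ℝ}

theorem hFun_eq (hd : IsDensity d) {t : ℝ} (ht : 1 ≤ t) :
    hFun d t = t⁻¹ * (∫ s in (1 : ℝ)..t, d s) + tailInt d t :=
  hd.integral_max ht

/-- As `h` is constant to the left of 1, formulas valid on `[1, ∞)` give its continuity on the whole
line. -/
theorem hFun_max (d : ℝ → ℝ) (t : ℝ) : hFun d t = hFun d (max t 1) := by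
  refine setIntegral_congr_fun measurableSet_Ioi fun s hs => ?_
  have : (1 : ℝ) ≤ s := le_of_lt hs
  simp only [max_assoc, max_eq_right this]

theorem continuous_hFun (hd : IsDensity d) : Continuous (hFun d) := by
  have h1 : ContinuousOn (fun t => t⁻¹ * (∫ s in (1 : ℝ)..t, d s) + tailInt d t) (Ici 1) := by
    intro t ht
    have ht' : 0 < t := one_pos.trans_le ht
    exact (((continuousAt_inv₀ ht'.ne').mul (hd.hasDerivAt_integral t).continuousAt).add
      (hd.hasDerivAt_tailInt ht').continuousAt).continuousWithinAt
  have h2 : Continuous fun t => (fun t => t⁻¹ * (∫ s in (1 : ℝ)..t, d s) + tailInt d t) (max t 1) :=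
    h1.comp_continuous (by fun_prop) fun t => le_max_right t 1
  convert h2 using 2 with t
  rw [hFun_max, hFun_eq hd (le_max_right t 1)]

theorem hFun_nonneg (hd : IsDensity d) (t : ℝ) : 0 ≤ hFun d t := by
  refine setIntegral_nonneg measurableSet_Ioi fun s hs => mul_nonneg ?_ (hd.nonneg s)
  have : (1 : ℝ) < s := hs
  have : 0 < max t s := lt_max_of_lt_right (by linarith)
  positivity

theorem hFun_antitone (hd : IsDensity d) : Antitone (hFun d) := by
  intro a b hab
  refine setIntegral_mono_on (hd.integrableOn_max b) (hd.integrableOn_max a) measurableSet_Ioi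
    fun s hs => ?_
  have : (1 : ℝ) < s := hs
  have h0 : 0 < max a s := lt_max_of_lt_right (by linarith)
  have := hd.nonneg s
  gcongr

theorem isDensity_mul_pow (hd : IsDensity d) (m : ℕ) : IsDensity fun s => d s * hFun d s ^ m where
  cont := hd.cont.mul ((continuous_hFun hd).pow m)
  nonneg t := mul_nonneg (hd.nonneg t) (pow_nonneg (hFun_nonneg hd t) m)
  int := by
    refine Integrable.mono' (hd.int.mul_const (hFun d 1 ^ m)) ?_ ?_
    · exact (measurable_inv.mul (hd.cont.mul ((continuous_hFun hd).pow m)).measurable).aestronglyMeasurable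
    · refine (ae_restrict_iff' measurableSet_Ioi).2 (Eventually.of_forall fun s hs => ?_)
      have hs1 : (1 : ℝ) < s := hs
      have h1 := hFun_antitone hd hs1.le
      have h2 := hFun_nonneg hd s
      have h3 := hd.nonneg s
      rw [Real.norm_of_nonneg (by positivity), ← mul_assoc]
      gcongr

/-- `R_m(t) = ∫_t^∞ s⁻¹ h₀'(s) h(s)^m ds`. -/
def RFun (d : ℝ → ℝ) (m : ℕ) (t : ℝ) : ℝ := tailInt (fun s => d s * hFun d s ^ m) t

theorem hasDerivAt_NFun (hd : IsDensity d) (m : ℕ) (t : ℝ) :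
    HasDerivAt (NFun d m) (d t * hFun d t ^ m) t :=
  (isDensity_mul_pow hd m).hasDerivAt_integral t

theorem hasDerivAt_RFun (hd : IsDensity d) (m : ℕ) {t : ℝ} (ht : 1 ≤ t) :
    HasDerivAt (RFun d m) (-(t⁻¹ * (d t * hFun d t ^ m))) t :=
  (isDensity_mul_pow hd m).hasDerivAt_tailInt (by linarith)

theorem QFun_eq_add (hd : IsDensity d) (m : ℕ) {t : ℝ} (ht : 1 ≤ t) :
    QFun d m t = t⁻¹ * NFun d m t + RFun d m t := by
  have := (isDensity_mul_pow hd m).integral_max ht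
  simp only [QFun, mul_assoc]
  exact this

theorem QFun_zero (d : ℝ → ℝ) (t : ℝ) : QFun d 0 t = hFun d t := by
  simp [QFun, hFun]

theorem NFun_one (d : ℝ → ℝ) (m : ℕ) : NFun d m 1 = 0 := by
  simp [NFun]

theorem NFun_monotone (hd : IsDensity d) (m : ℕ) {s t : ℝ} (hs : 1 ≤ s) (hst : s ≤ t) :
    NFun d m s ≤ NFun d m t := by
  have := le_of_hasDerivAt_le (F := fun _ => 0) (F' := fun _ => 0) (fun t _ => hasDerivAt_const t 0)
    (fun t _ => hasDerivAt_NFun hd m t) (fun t _ => (isDensity_mul_pow hd m).nonneg t) hs hst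
  linarith

theorem NFun_nonneg (hd : IsDensity d) (m : ℕ) {t : ℝ} (ht : 1 ≤ t) : 0 ≤ NFun d m t := by
  rw [← NFun_one d m]
  exact NFun_monotone hd m le_rfl ht

theorem RFun_nonneg (hd : IsDensity d) (m : ℕ) {t : ℝ} (ht : 1 ≤ t) : 0 ≤ RFun d m t :=
  (isDensity_mul_pow hd m).tailInt_nonneg ht

theorem QFun_nonneg (hd : IsDensity d) (m : ℕ) {t : ℝ} (ht : 1 ≤ t) : 0 ≤ QFun d m t := by
  rw [QFun_eq_add hd m ht]
  have := NFun_nonneg hd m ht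
  have := RFun_nonneg hd m ht
  positivity

theorem tendsto_QFun (hd : IsDensity d) (m : ℕ) : Tendsto (QFun d m) atTop (𝓝 0) := by
  have := (isDensity_mul_pow hd m).tendsto_integral_max
  simp only [← mul_assoc] at this
  exact this

/-- In `Q_m = t⁻¹ N_m + R_m` the terms containing the density cancel. Since `Q_m` tends to 0, it is
the integral of `s⁻² N_m(s)` from `t` to infinity, the natural size of `w_{m+1}`. The derivative is
taken within `[1, ∞)`, where the formula for `Q_m` holds. -/
theorem hasDerivWithinAt_QFun (hd : IsDensity d) (m : ℕ) {t : ℝ} (ht : 1 ≤ t) :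
    HasDerivWithinAt (QFun d m) (-((t ^ 2)⁻¹ * NFun d m t)) (Ici 1) t := by
  have ht0 : t ≠ 0 := by positivity
  have h := (((hasDerivAt_inv ht0).mul (hasDerivAt_NFun hd m t)).add
    (hasDerivAt_RFun hd m ht)).hasDerivWithinAt (s := Ici 1)
  have h2 : HasDerivWithinAt (QFun d m) _ (Ici 1) t :=
    h.congr (fun x hx => QFun_eq_add hd m hx) (QFun_eq_add hd m ht)
  convert h2 using 1
  ring

theorem NFun_zero_le (hd : IsDensity d) {t : ℝ} (ht : 1 ≤ t) :
    t⁻¹ * NFun d 0 t ≤ hFun d t := by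
  rw [← QFun_zero, QFun_eq_add hd 0 ht]
  linarith [RFun_nonneg hd 0 ht]

theorem RFun_zero_le (hd : IsDensity d) {t : ℝ} (ht : 1 ≤ t) : RFun d 0 t ≤ hFun d t := by
  rw [← QFun_zero, QFun_eq_add hd 0 ht]
  have := NFun_nonneg hd 0 ht
  have : 0 ≤ t⁻¹ * NFun d 0 t := by positivity
  linarith

/-- In the tail `h(s) ≤ h(t)`, so m factors come out and the remaining `R_0` is part of `h`. -/
theorem RFun_le (hd : IsDensity d) (m : ℕ) {t : ℝ} (ht : 1 ≤ t) :
    RFun d m t ≤ hFun d t ^ (m + 1) := by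
  have h1 : RFun d m t ≤ hFun d t ^ m * RFun d 0 t := by
    rw [RFun, RFun, tailInt, tailInt, ← integral_const_mul]
    refine setIntegral_mono_on ((isDensity_mul_pow hd m).integrableOn_tail (by linarith))
      (((isDensity_mul_pow hd 0).integrableOn_tail (by linarith)).const_mul _) measurableSet_Ioi
      fun s hs => ?_
    have hs' : t < s := hs
    have h2 := hFun_antitone hd hs'.le
    have h3 := hFun_nonneg hd s
    have h4 := hd.nonneg s
    rw [pow_zero, mul_one, mul_comm (hFun d t ^ m), mul_assoc]
    have : 0 < s := by linarith
    gcongr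
  refine h1.trans ?_
  rw [pow_succ]
  have := pow_nonneg (hFun_nonneg hd t) m
  exact mul_le_mul_of_nonneg_left (RFun_zero_le hd ht) this

theorem NFun_mul_pow_le (hd : IsDensity d) (i j : ℕ) {t : ℝ} (ht : 1 ≤ t) :
    NFun d i t * hFun d t ^ j ≤ NFun d (i + j) t := by
  rw [NFun, NFun, ← intervalIntegral.integral_mul_const]
  refine intervalIntegral.integral_mono_on ht
    (((isDensity_mul_pow hd i).cont.mul continuous_const).intervalIntegrable _ _)
    ((isDensity_mul_pow hd (i + j)).cont.intervalIntegrable _ _) fun s hs => ?_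
  have h2 := hFun_antitone hd hs.2
  have h3 := hFun_nonneg hd t
  have h4 := hd.nonneg s
  have h5 := hFun_nonneg hd s
  rw [pow_add, ← mul_assoc]
  gcongr

theorem hasDerivAt_cross (hd : IsDensity d) (i j : ℕ) {t : ℝ} (ht : 1 ≤ t) :
    HasDerivAt (fun t => t⁻¹ * (NFun d i t * NFun d j t) + NFun d i t * RFun d j t +
      NFun d j t * RFun d i t) (-((t ^ 2)⁻¹ * (NFun d i t * NFun d j t)) +
      d t * hFun d t ^ i * RFun d j t + d t * hFun d t ^ j * RFun d i t) t := by
  have ht0 : t ≠ 0 := by positivity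
  have hi := hasDerivAt_NFun hd i t
  have hj := hasDerivAt_NFun hd j t
  have h := (((hasDerivAt_inv ht0).mul (hi.mul hj)).add (hi.mul (hasDerivAt_RFun hd j ht))).add
    (hj.mul (hasDerivAt_RFun hd i ht))
  refine HasDerivAt.congr_deriv (f := fun t => t⁻¹ * (NFun d i t * NFun d j t) +
    NFun d i t * RFun d j t + NFun d j t * RFun d i t) h ?_
  change -(t ^ 2)⁻¹ * (NFun d i t * NFun d j t) + t⁻¹ * (d t * hFun d t ^ i * NFun d j t +
    NFun d i t * (d t * hFun d t ^ j)) + _ + _ = _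
  ring

/-- Both sides vanish at 1. On differentiation the terms in `t⁻¹` cancel and the one in `t⁻²` is
negative; what survives is at most `2 h₀' h^(i+j+1)` by `RFun_le`. -/
theorem cross_le (hd : IsDensity d) (i j : ℕ) {t : ℝ} (ht : 1 ≤ t) :
    t⁻¹ * (NFun d i t * NFun d j t) + NFun d i t * RFun d j t + NFun d j t * RFun d i t ≤
      2 * NFun d (i + j + 1) t := by
  have := le_of_hasDerivAt_le (fun t ht => hasDerivAt_cross hd i j ht)
    (fun t _ => (hasDerivAt_NFun hd (i + j + 1) t).const_mul 2) (fun t ht => ?_) le_rfl ht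
  · simpa [NFun_one] using this
  · have h1 := NFun_nonneg hd i ht
    have h2 := NFun_nonneg hd j ht
    have h3 : 0 ≤ (t ^ 2)⁻¹ * (NFun d i t * NFun d j t) := by positivity
    have h4 := hd.nonneg t
    have h5 := hFun_nonneg hd t
    have h6 : d t * hFun d t ^ i * RFun d j t ≤ d t * hFun d t ^ (i + j + 1) := by
      rw [add_assoc, pow_add, ← mul_assoc]
      gcongr
      exact RFun_le hd j ht
    have h7 : d t * hFun d t ^ j * RFun d i t ≤ d t * hFun d t ^ (i + j + 1) := by
      rw [add_comm i j, add_assoc, pow_add, ← mul_assoc]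
      gcongr
      exact RFun_le hd i ht
    linarith

theorem QFun_mul_NFun_le (hd : IsDensity d) (i j : ℕ) {t : ℝ} (ht : 1 ≤ t) :
    NFun d j t * QFun d i t ≤ 2 * NFun d (j + i + 1) t := by
  have h := cross_le hd j i ht
  have h1 := mul_nonneg (NFun_nonneg hd i ht) (RFun_nonneg hd j ht)
  rw [QFun_eq_add hd i ht]
  calc _ = t⁻¹ * (NFun d j t * NFun d i t) + NFun d j t * RFun d i t := by ring
    _ ≤ _ := by linarith

/-- Compare derivatives: by `NFun_mul_pow_le`, each term `h₀' h^i N_j` is at most `h₀' N_{i+j}`. All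
products of total index m thus reduce to the single product `N_0 N_m`. -/
theorem NFun_mul_NFun_le (hd : IsDensity d) (i j : ℕ) {t : ℝ} (ht : 1 ≤ t) :
    NFun d i t * NFun d j t ≤ 2 * (NFun d 0 t * NFun d (i + j) t) := by
  have := le_of_hasDerivAt_le
    (fun t _ => (hasDerivAt_NFun hd i t).mul (hasDerivAt_NFun hd j t))
    (fun t _ => ((hasDerivAt_NFun hd 0 t).mul (hasDerivAt_NFun hd (i + j) t)).const_mul 2)
    (fun t ht => ?_) le_rfl ht
  · simpa [NFun_one] using this
  · have h4 := hd.nonneg t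
    have h5 := hFun_nonneg hd t
    have h1 := mul_le_mul_of_nonneg_left (NFun_mul_pow_le hd i j ht) h4
    have h2 := mul_le_mul_of_nonneg_left (NFun_mul_pow_le hd j i ht) h4
    have h3 := NFun_nonneg hd 0 ht
    have h6 : 0 ≤ NFun d 0 t * (d t * hFun d t ^ (i + j)) := by positivity
    rw [add_comm j i] at h2
    rw [pow_zero, mul_one]
    linarith

/-- Split each factor into `t⁻¹ N` and `R`. Every product containing an `N` is covered by
`QFun_mul_NFun_le`; only `R_i R_j` remains, and it gives the pure power of `h`. -/
theorem QFun_mul_QFun_le (hd : IsDensity d) (i j : ℕ) {t : ℝ} (ht : 1 ≤ t) :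
    QFun d i t * QFun d j t ≤ 4 * QFun d (i + j + 1) t + hFun d t ^ (i + j + 2) := by
  have hti : 0 < t⁻¹ := by positivity
  have h1 := mul_le_mul_of_nonneg_left (QFun_mul_NFun_le hd j i ht) hti.le
  have h2 := mul_le_mul_of_nonneg_left (QFun_mul_NFun_le hd i j ht) hti.le
  have h3 : RFun d i t * RFun d j t ≤ hFun d t ^ (i + j + 2) := by
    have e : i + j + 2 = (i + 1) + (j + 1) := by ring
    rw [e, pow_add]
    have := hFun_nonneg hd t
    exact mul_le_mul (RFun_le hd i ht) (RFun_le hd j ht) (RFun_nonneg hd j ht) (by positivity)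
  have h4 : t⁻¹ * NFun d (i + j + 1) t ≤ QFun d (i + j + 1) t := by
    rw [QFun_eq_add hd _ ht]
    linarith [RFun_nonneg hd (i + j + 1) ht]
  have h5 : 0 ≤ t⁻¹ * (NFun d j t * (t⁻¹ * NFun d i t)) := by
    have := NFun_nonneg hd i ht
    have := NFun_nonneg hd j ht
    positivity
  rw [add_comm j i] at h2
  rw [QFun_eq_add hd i ht] at h2 ⊢
  rw [QFun_eq_add hd j ht] at h1 ⊢
  nlinarith

/-- Antiderivative bounding the time derivative of the phase corrections. -/
def phaseBound (d : ℝ → ℝ) (m : ℕ) (t : ℝ) : ℝ :=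
  5 * NFun d (m + 1) t - (t⁻¹ * (NFun d 0 t * NFun d m t) + NFun d 0 t * RFun d m t +
    NFun d m t * RFun d 0 t + NFun d m t * RFun d 0 t)

/-- The time derivative of `phaseBound`. -/
def phaseRate (d : ℝ → ℝ) (m : ℕ) (t : ℝ) : ℝ :=
  5 * (d t * hFun d t ^ (m + 1)) - (-((t ^ 2)⁻¹ * (NFun d 0 t * NFun d m t)) +
      d t * hFun d t ^ 0 * RFun d m t + d t * hFun d t ^ m * RFun d 0 t +
      (d t * hFun d t ^ m * RFun d 0 t + NFun d m t * -(t⁻¹ * (d t * hFun d t ^ 0))))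

theorem hasDerivAt_phaseBound (hd : IsDensity d) (m : ℕ) {t : ℝ} (ht : 1 ≤ t) :
    HasDerivAt (phaseBound d m) (phaseRate d m t) t :=
  ((hasDerivAt_NFun hd (m + 1) t).const_mul 5).sub ((hasDerivAt_cross hd 0 m ht).add
    ((hasDerivAt_NFun hd m t).mul (hasDerivAt_RFun hd 0 ht)))

/-- Subtracting the cross terms in `phaseBound` produces `t⁻² N_0 N_m`, and the second copy of `N_m
R_0` produces the part `t⁻¹ h₀' N_m` of `h₀' Q_m`. The price is `2 h₀' R_m + 2 h₀' h^m R_0`, at most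
`4 h₀' h^(m+1)`; together with the wanted `h₀' h^(m+1)` this explains the coefficient 5. -/
theorem le_phaseRate (hd : IsDensity d) (m : ℕ) {t : ℝ} (ht : 1 ≤ t) :
    (t ^ 2)⁻¹ * (NFun d 0 t * NFun d m t) + d t * QFun d m t + d t * hFun d t ^ (m + 1) ≤
      phaseRate d m t := by
  have h4 := hd.nonneg t
  have h5 := hFun_nonneg hd t
  have h1 := mul_le_mul_of_nonneg_left (RFun_le hd m ht) h4
  have h2 := mul_le_mul_of_nonneg_left (RFun_zero_le hd ht)
    (mul_nonneg h4 (pow_nonneg h5 m))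
  rw [QFun_eq_add hd m ht, phaseRate, pow_zero, mul_one]
  rw [pow_succ (hFun d t) m] at h1 ⊢
  linarith

theorem phaseRate_nonneg (hd : IsDensity d) (m : ℕ) {t : ℝ} (ht : 1 ≤ t) :
    0 ≤ phaseRate d m t := by
  refine le_trans ?_ (le_phaseRate hd m ht)
  have := hd.nonneg t
  have := hFun_nonneg hd t
  have := NFun_nonneg hd 0 ht
  have := NFun_nonneg hd m ht
  have := QFun_nonneg hd m ht
  positivity

theorem phaseBound_one (d : ℝ → ℝ) (m : ℕ) : phaseBound d m 1 = 0 := by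
  simp [phaseBound, NFun_one]

theorem phaseBound_le (hd : IsDensity d) (m : ℕ) {t : ℝ} (ht : 1 ≤ t) :
    phaseBound d m t ≤ 5 * NFun d (m + 1) t := by
  have := NFun_nonneg hd 0 ht
  have := NFun_nonneg hd m ht
  have := RFun_nonneg hd 0 ht
  have := RFun_nonneg hd m ht
  have : 0 ≤ t⁻¹ * (NFun d 0 t * NFun d m t) + NFun d 0 t * RFun d m t +
    NFun d m t * RFun d 0 t + NFun d m t * RFun d 0 t := by positivity
  unfold phaseBound
  linarith

theorem phaseBound_monotone (hd : IsDensity d) (m : ℕ) {s t : ℝ} (hs : 1 ≤ s) (hst : s ≤ t) :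
    phaseBound d m s ≤ phaseBound d m t := by
  have := le_of_hasDerivAt_le (F := fun _ => 0) (F' := fun _ => 0) (fun t _ => hasDerivAt_const t 0)
    (fun t ht => hasDerivAt_phaseBound hd m ht) (fun t ht => phaseRate_nonneg hd m ht) hs hst
  linarith

/-! ### The functions P_m, and positivity of h and N_m. -/

theorem integrableOn_PFun (hd : IsDensity d) (m : ℕ) (hP : PFinite d m) (t : ℝ) :
    IntegrableOn (fun s => hFun d (max t s) * d s * hFun d s ^ m) (Ioi 1) := by
  refine Integrable.mono' hP ?_ ?_
  · refine Continuous.aestronglyMeasurable ?_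
    have := continuous_hFun hd
    have := hd.cont
    fun_prop
  · refine Eventually.of_forall fun s => ?_
    have h1 := hFun_nonneg hd (max t s)
    have h2 := hFun_nonneg hd s
    have h3 := hd.nonneg s
    rw [Real.norm_of_nonneg (by positivity), pow_succ]
    have := mul_le_mul_of_nonneg_right (hFun_antitone hd (le_max_right t s))
      (mul_nonneg h3 (pow_nonneg h2 m))
    linarith

theorem PFun_eq (hd : IsDensity d) (m : ℕ) (hP : PFinite d m) {t : ℝ} (ht : 1 ≤ t) :
    PFun d m t = hFun d t * NFun d m t + ∫ s in Ioi t, d s * hFun d s ^ (m + 1) := by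
  have hi := integrableOn_PFun hd m hP t
  rw [PFun]
  rw [← Ioc_union_Ioi_eq_Ioi ht] at hi ⊢
  rw [setIntegral_union (Ioc_disjoint_Ioi le_rfl) measurableSet_Ioi hi.left_of_union
    hi.right_of_union, NFun, intervalIntegral.integral_of_le ht, ← integral_const_mul]
  congr 1
  · refine setIntegral_congr_fun measurableSet_Ioc fun s hs => ?_
    simp only [max_eq_left hs.2, mul_assoc]
  · refine setIntegral_congr_fun measurableSet_Ioi fun s hs => ?_
    simp only [max_eq_right (le_of_lt (mem_Ioi.1 hs))]
    ring

/-- The increment of `5 N_{m+1}` is at most five times the tail integral in `PFun_eq`. The four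
cross terms at `s` are each at most `h(s) N_m(s)`, and those at `t` have a favourable sign. -/
theorem phaseBound_sub_le (hd : IsDensity d) (m : ℕ) (hP : PFinite d m) {s t : ℝ} (hs : 1 ≤ s)
    (hst : s ≤ t) : phaseBound d m t - phaseBound d m s ≤ 5 * PFun d m s := by
  have ht := hs.trans hst
  have h1 : NFun d (m + 1) t - NFun d (m + 1) s ≤ ∫ x in Ioi s, d x * hFun d x ^ (m + 1) := by
    have hc := (isDensity_mul_pow hd (m + 1)).cont
    rw [NFun, NFun, intervalIntegral.integral_interval_sub_left (hc.intervalIntegrable _ _)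
      (hc.intervalIntegrable _ _), intervalIntegral.integral_of_le hst]
    refine setIntegral_mono_set (hP.mono_set (Ioi_subset_Ioi hs))
      (Eventually.of_forall fun x => (isDensity_mul_pow hd (m + 1)).nonneg x)
      (Eventually.of_forall fun x hx => hx.1)
  have a1 := NFun_nonneg hd 0 hs
  have a2 := NFun_nonneg hd m hs
  have b0 := hFun_nonneg hd s
  have c1 : s⁻¹ * (NFun d 0 s * NFun d m s) ≤ hFun d s * NFun d m s := by
    rw [← mul_assoc]
    exact mul_le_mul_of_nonneg_right (NFun_zero_le hd hs) a2
  have c2 : NFun d 0 s * RFun d m s ≤ hFun d s * NFun d m s := by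
    have e1 := mul_le_mul_of_nonneg_left (RFun_le hd m hs) a1
    have e2 := mul_le_mul_of_nonneg_left (NFun_mul_pow_le hd 0 m hs) b0
    rw [zero_add] at e2
    rw [pow_succ] at e1
    linarith
  have c3 : NFun d m s * RFun d 0 s ≤ hFun d s * NFun d m s := by
    rw [mul_comm]
    exact mul_le_mul_of_nonneg_right (RFun_zero_le hd hs) a2
  have c4 := phaseBound_le hd m ht
  have c5 : 0 ≤ hFun d s * NFun d m s := mul_nonneg b0 a2
  rw [PFun_eq hd m hP hs]
  have c6 : phaseBound d m s = 5 * NFun d (m + 1) s - (s⁻¹ * (NFun d 0 s * NFun d m s) +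
    NFun d 0 s * RFun d m s + NFun d m s * RFun d 0 s + NFun d m s * RFun d 0 s) := rfl
  linarith

theorem PFun_nonneg (hd : IsDensity d) (m : ℕ) (t : ℝ) : 0 ≤ PFun d m t :=
  integral_nonneg fun s => mul_nonneg (mul_nonneg (hFun_nonneg hd _) (hd.nonneg s))
    (pow_nonneg (hFun_nonneg hd s) m)

theorem tendsto_PFun (hd : IsDensity d) (m : ℕ) (hP : PFinite d m) :
    Tendsto (PFun d m) atTop (𝓝 0) := by
  have h := tendsto_integral_filter_of_dominated_convergence
    (μ := volume.restrict (Ioi (1 : ℝ))) (l := atTop)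
    (F := fun t s => hFun d (max t s) * d s * hFun d s ^ m)
    (f := fun _ => (0 : ℝ)) (fun s => d s * hFun d s ^ (m + 1))
    (Eventually.of_forall fun t => (integrableOn_PFun hd m hP t).aestronglyMeasurable)
    (Eventually.of_forall fun t => Eventually.of_forall fun s => ?_) hP ?_
  · rw [integral_zero] at h
    exact h
  · have h1 := hFun_nonneg hd (max t s)
    have h2 := hFun_nonneg hd s
    have h3 := hd.nonneg s
    rw [Real.norm_of_nonneg (by positivity), pow_succ]
    have := mul_le_mul_of_nonneg_right (hFun_antitone hd (le_max_right t s))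
      (mul_nonneg h3 (pow_nonneg h2 m))
    linarith
  · refine Eventually.of_forall fun s => ?_
    have h1 : Tendsto (fun t : ℝ => max t s) atTop atTop :=
      tendsto_atTop_mono (fun t => le_max_left t s) tendsto_id
    have h2 : Tendsto (hFun d) atTop (𝓝 0) := by
      have := tendsto_QFun hd 0
      rwa [funext (QFun_zero d)] at this
    have := ((h2.comp h1).mul_const (d s)).mul_const (hFun d s ^ m)
    simpa using this

theorem hFun_pos (hd : IsDensity d) (hpos : ∀ t, 0 < d t) (t : ℝ) : 0 < hFun d t := by
  have h2 : 1 ≤ max t 2 := by linarith [le_max_right t 2]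
  have h2' : (1 : ℝ) < max t 2 := by linarith [le_max_right t 2]
  refine lt_of_lt_of_le ?_ (hFun_antitone hd (le_max_left t 2))
  rw [hFun_eq hd h2]
  have h3 : 0 < ∫ s in (1 : ℝ)..(max t 2), d s :=
    intervalIntegral.intervalIntegral_pos_of_pos (hd.cont.intervalIntegrable _ _) hpos h2'
  have h4 := hd.tailInt_nonneg h2
  positivity

theorem NFun_pos (hd : IsDensity d) (hpos : ∀ t, 0 < d t) (m : ℕ) {t : ℝ} (ht : 1 < t) :
    0 < NFun d m t :=
  intervalIntegral.intervalIntegral_pos_of_pos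
    ((isDensity_mul_pow hd m).cont.intervalIntegrable _ _)
    (fun s => mul_pos (hpos s) (pow_pos (hFun_pos hd hpos s) m)) ht

end

/-! ### Monotonicity and interpolation of the norms -/

theorem gevreyNorm_mono_low {n : ℕ} (hn : 0 < n) (ρ ν hi : ℝ) {lo lo' : ℝ} (h : lo' ≤ lo)
    (u : TD n) : gevreyNorm ρ ν hi lo u ≤ gevreyNorm ρ ν hi lo' u := by
  by_cases hu : gevreyNorm ρ ν hi lo' u < ⊤
  · have hf := hasFourier_fhat_of_lt_top hu
    refine gevreyNorm_le_of_ae hf hf ?_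
    filter_upwards [ae_ne_zero hn] with ξ hξ
    gcongr
    unfold powWeight
    split_ifs with h1
    · exact le_rfl
    · exact Real.rpow_le_rpow_of_exponent_ge (norm_pos_iff.2 hξ) (not_lt.1 h1) h
  · rw [not_lt_top_iff.1 hu]
    exact le_top

/-- Beyond a radius `r₁` the factor `|ξ|^(k'-k)` is below `ε`. Between 1 and `r₁` the ratio of the
powers `k'` and `k₁` is bounded, and inside the unit ball all three weights agree, where `M ≥ 1` is
enough. -/
theorem exists_powWeight_interpolation {k' k : ℝ} (hk : k' < k) (k₁ : ℝ) {ε : ℝ} (hε : 0 < ε) :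
    ∃ M : ℝ, 0 ≤ M ∧ ∀ (n : ℕ) (ξ : Sp n),
      powWeight k' 0 ξ ≤ ε * powWeight k 0 ξ + M * powWeight k₁ 0 ξ := by
  have h1 : Tendsto (fun r : ℝ => r ^ (-(k - k'))) atTop (𝓝 0) :=
    tendsto_rpow_neg_atTop (by linarith)
  obtain ⟨r₀, hr₀⟩ := eventually_atTop.1 (h1.eventually (gt_mem_nhds hε))
  set r₁ := max r₀ 1 with hr₁
  have hr11 : 1 ≤ r₁ := le_max_right _ _
  have hM1 : 1 ≤ r₁ ^ |k' - k₁| := Real.one_le_rpow hr11 (abs_nonneg _)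
  refine ⟨r₁ ^ |k' - k₁|, by linarith, fun n ξ => ?_⟩
  unfold powWeight
  split_ifs with hξ
  · have h0 : 0 < ‖ξ‖ := by linarith
    rcases le_total r₁ ‖ξ‖ with hr | hr
    · have h2 := (hr₀ ‖ξ‖ ((le_max_left _ _).trans hr)).le
      have h3 : ‖ξ‖ ^ k' = ‖ξ‖ ^ (-(k - k')) * ‖ξ‖ ^ k := by
        rw [← Real.rpow_add h0]
        congr 1
        ring
      have h4 : 0 ≤ r₁ ^ |k' - k₁| * ‖ξ‖ ^ k₁ := by positivity
      rw [h3]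
      have : ‖ξ‖ ^ (-(k - k')) * ‖ξ‖ ^ k ≤ ε * ‖ξ‖ ^ k := by gcongr
      linarith
    · have h3 : ‖ξ‖ ^ k' = ‖ξ‖ ^ (k' - k₁) * ‖ξ‖ ^ k₁ := by
        rw [← Real.rpow_add h0]
        congr 1
        ring
      have h4 : ‖ξ‖ ^ (k' - k₁) ≤ r₁ ^ |k' - k₁| :=
        (Real.rpow_le_rpow_of_exponent_le hξ.le (le_abs_self _)).trans
          (Real.rpow_le_rpow h0.le hr (abs_nonneg _))
      have h5 : 0 ≤ ε * ‖ξ‖ ^ k := by positivity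
      rw [h3]
      have : ‖ξ‖ ^ (k' - k₁) * ‖ξ‖ ^ k₁ ≤ r₁ ^ |k' - k₁| * ‖ξ‖ ^ k₁ := by gcongr
      linarith
  · simp only [Real.rpow_zero, mul_one]
    linarith

theorem exists_gevreyNorm_interpolation {k' k : ℝ} (hk : k' < k) (k₁ : ℝ) {ε : ℝ} (hε : 0 < ε) :
    ∃ M : ℝ, 0 ≤ M ∧ ∀ (n : ℕ) (ρ ν : ℝ) (u : TD n), gevreyNorm ρ ν k' 0 u ≤
      ENNReal.ofReal ε * gevreyNorm ρ ν k 0 u + ENNReal.ofReal M * gevreyNorm ρ ν k₁ 0 u := by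
  obtain ⟨M, hM, h⟩ := exists_powWeight_interpolation hk k₁ hε
  refine ⟨M, hM, fun n ρ ν u => ?_⟩
  by_cases hf : ∃ g, HasFourier u g
  swap
  · have e : gevreyNorm ρ ν k 0 u = ⊤ := by rw [gevreyNorm, if_neg hf]
    rw [e, ENNReal.mul_top (by simpa using hε)]
    simp
  obtain ⟨g, hg⟩ := hf
  have hm := hg.1.aestronglyMeasurable
  have e (c : ℝ) (hc : 0 ≤ c) (q : ℝ) : ENNReal.ofReal c * gevreyNorm ρ ν q 0 u =
      eLpNorm (fun ξ => (c : ℂ) * ((weight ρ ν q 0 ξ : ℂ) * g ξ)) 2 volume := by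
    have := eLpNorm_const_smul (c : ℂ) (fun ξ => (weight ρ ν q 0 ξ : ℂ) * g ξ) 2 volume
    rw [← ofReal_norm, Complex.norm_real, Real.norm_of_nonneg hc, ← hg.gevreyNorm_eq] at this
    rw [← this]
    rfl
  rw [e ε hε.le, e M hM, hg.gevreyNorm_eq,
    ← eLpNorm_norm (fun ξ => (ε : ℂ) * ((weight ρ ν k 0 ξ : ℂ) * g ξ)),
    ← eLpNorm_norm (fun ξ => (M : ℂ) * ((weight ρ ν k₁ 0 ξ : ℂ) * g ξ))]
  refine le_trans ?_ (eLpNorm_add_le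
    ((aestronglyMeasurable_weight_mul hm).const_mul _).norm
    ((aestronglyMeasurable_weight_mul hm).const_mul _).norm (by norm_num))
  refine eLpNorm_mono_real fun ξ => ?_
  simp only [Pi.add_apply, norm_mul, Complex.norm_real,
    Real.norm_of_nonneg (weight_nonneg _ _ _ _ _), Real.norm_of_nonneg hM,
    Real.norm_of_nonneg hε.le]
  rw [weight_eq, weight_eq, weight_eq]
  have h1 := h n ξ
  calc Real.exp (ρ * max (‖ξ‖ ^ ν) 1) * powWeight k' 0 ξ * ‖g ξ‖
      ≤ Real.exp (ρ * max (‖ξ‖ ^ ν) 1) * (ε * powWeight k 0 ξ + M * powWeight k₁ 0 ξ) * ‖g ξ‖ := by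
        gcongr
    _ = _ := by ring

theorem BddBilin.mono {n : ℕ} {T : TD n → TD n → TD n} {h₁ l₁ h₂ l₂ h l C C' : ℝ}
    (hT : BddBilin T h₁ l₁ h₂ l₂ h l C) (hC : C ≤ C') : BddBilin T h₁ l₁ h₂ l₂ h l C' where
  nonneg := hT.nonneg.trans hC
  bound ρ ν hρ hν hν1 u v hu hv := by
    refine (hT.bound ρ ν hρ hν hν1 u v hu hv).trans ?_
    gcongr
  sub_left := hT.sub_left
  sub_right := hT.sub_right

theorem BddBilin.bound_ofReal {n : ℕ} {T : TD n → TD n → TD n} {h₁ l₁ h₂ l₂ h l C : ℝ}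
    (hT : BddBilin T h₁ l₁ h₂ l₂ h l C) {ρ ν : ℝ} (hρ : 0 ≤ ρ) (hν : 0 ≤ ν) (hν1 : ν ≤ 1)
    {u v : TD n} {a b : ℝ} (ha : 0 ≤ a) (hu : gevreyNorm ρ ν h₁ l₁ u ≤ ENNReal.ofReal a)
    (hv : gevreyNorm ρ ν h₂ l₂ v ≤ ENNReal.ofReal b) :
    gevreyNorm ρ ν h l (T u v) ≤ ENNReal.ofReal (C * (a * b)) := by
  refine (hT.bound ρ ν hρ hν hν1 u v (hu.trans_lt ENNReal.ofReal_lt_top)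
    (hv.trans_lt ENNReal.ofReal_lt_top)).trans ?_
  rw [ENNReal.ofReal_mul hT.nonneg, ENNReal.ofReal_mul ha, mul_assoc]
  gcongr

theorem gevreyNorm_smul_le_ofReal {n : ℕ} {ρ ν hi lo r a : ℝ} {c : ℂ} (hc : ‖c‖ ≤ r) {u : TD n}
    (hu : gevreyNorm ρ ν hi lo u ≤ ENNReal.ofReal a) :
    gevreyNorm ρ ν hi lo (c • u) ≤ ENNReal.ofReal (r * a) := by
  refine (gevreyNorm_smul_le _ _ _ _ _ _).trans ?_
  rw [ENNReal.ofReal_mul ((norm_nonneg c).trans hc), ← ofReal_norm]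
  gcongr

theorem gevreyNorm_add_le_ofReal {n : ℕ} {ρ ν hi lo a b : ℝ} (ha : 0 ≤ a) (hb : 0 ≤ b) {u v : TD n}
    (hu : gevreyNorm ρ ν hi lo u ≤ ENNReal.ofReal a)
    (hv : gevreyNorm ρ ν hi lo v ≤ ENNReal.ofReal b) :
    gevreyNorm ρ ν hi lo (u + v) ≤ ENNReal.ofReal (a + b) := by
  rw [ENNReal.ofReal_add ha hb]
  exact (gevreyNorm_add_le _ _ _ _ _ _).trans (add_le_add hu hv)

theorem gevreyNorm_sum_le_ofReal {n : ℕ} {ρ ν hi lo a : ℝ} (m : ℕ) {u : ℕ → TD n}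
    (hu : ∀ j < m, gevreyNorm ρ ν hi lo (u j) ≤ ENNReal.ofReal a) :
    gevreyNorm ρ ν hi lo (∑ j ∈ Finset.range m, u j) ≤ ENNReal.ofReal (m * a) := by
  refine (gevreyNorm_sum_le _ _ _ _ _ _).trans ?_
  refine (Finset.sum_le_sum fun j hj => hu j (Finset.mem_range.1 hj)).trans ?_
  rw [Finset.sum_const, Finset.card_range, nsmul_eq_mul, ENNReal.ofReal_mul (by positivity),
    ENNReal.ofReal_natCast]

/-! ### Distribution valued functions of time -/

theorem HasTimeDeriv.mono {n : ℕ} {I J : Set ℝ} {u R : ℝ → TD n} (h : HasTimeDeriv I u R)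
    (hJ : J ⊆ I) : HasTimeDeriv J u R :=
  fun t ht θ => (h t (hJ ht) θ).mono hJ

theorem HasTimeDeriv.sub {n : ℕ} {I : Set ℝ} {u v R S : ℝ → TD n} (h : HasTimeDeriv I u R)
    (h' : HasTimeDeriv I v S) : HasTimeDeriv I (fun t => u t - v t) (fun t => R t - S t) :=
  fun t ht θ => (h t ht θ).sub (h' t ht θ)

theorem HasTimeDeriv.sum {n : ℕ} {I : Set ℝ} (s : Finset ℕ) {u R : ℕ → ℝ → TD n}
    (h : ∀ j ∈ s, HasTimeDeriv I (u j) (R j)) :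
    HasTimeDeriv I (fun t => ∑ j ∈ s, u j t) (fun t => ∑ j ∈ s, R j t) := by
  intro t ht θ
  have := HasDerivWithinAt.fun_sum fun j hj => h j hj t ht θ
  simpa using this

theorem HasTimeDeriv.congr_deriv {n : ℕ} {I : Set ℝ} {u R S : ℝ → TD n} (h : HasTimeDeriv I u R)
    (h' : ∀ t ∈ I, R t = S t) : HasTimeDeriv I u S :=
  fun t ht θ => by rw [← h' t ht]; exact h t ht θ

/-- Limits of functions with the Cauchy property in norm. -/
theorem exists_limit_of_gevreyNorm {n : ℕ} (hn : 0 < n) {ρ ν hi lo : ℝ} (hρ : 0 ≤ ρ)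
    (hlo : lo < (n : ℝ) / 2) {t₀ : ℝ} {u : ℝ → TD n} {b : ℝ → ℝ} (hb0 : ∀ s, t₀ ≤ s → 0 ≤ b s)
    (hb : Tendsto b atTop (𝓝 0)) (hu : ∀ s t, t₀ ≤ s → s ≤ t →
      gevreyNorm ρ ν hi lo (u t - u s) ≤ ENNReal.ofReal (b s)) :
    ∃ v : TD n, (∀ θ, Tendsto (fun t => u t θ) atTop (𝓝 (v θ))) ∧
      ∀ s, t₀ ≤ s → gevreyNorm ρ ν hi lo (u s - v) ≤ ENNReal.ofReal (b s) := by
  have hcauchy (θ : 𝓢(Sp n, ℂ)) : ∃ z, Tendsto (fun t => (u t - u t₀) (𝓕 θ)) atTop (𝓝 z) := by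
    refine cauchy_map_iff_exists_tendsto.1 ?_
    rw [Metric.cauchy_iff]
    refine ⟨inferInstance, fun ε hε => ?_⟩
    have h1 : Tendsto (fun t => b t * (testNorm ρ ν hi lo θ).toReal) atTop (𝓝 0) := by
      simpa using hb.mul_const (testNorm ρ ν hi lo θ).toReal
    obtain ⟨s, hs, hst⟩ := ((h1.eventually (gt_mem_nhds (half_pos hε))).and
      (eventually_ge_atTop t₀)).exists
    have hd (t) (ht : s ≤ t) : dist ((u t - u t₀) (𝓕 θ)) ((u s - u t₀) (𝓕 θ)) < ε / 2 := by
      refine lt_of_le_of_lt ?_ hs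
      have := norm_fourier_le hn hρ hlo (hb0 s hst) (hu s t hst ht) θ
      have e : (u t - u t₀) (𝓕 θ) - (u s - u t₀) (𝓕 θ) = 𝓕 (u t - u s) θ := by
        change (u t (𝓕 θ) - u t₀ (𝓕 θ)) - (u s (𝓕 θ) - u t₀ (𝓕 θ)) = u t (𝓕 θ) - u s (𝓕 θ)
        ring
      rw [dist_eq_norm, e]
      exact this
    refine ⟨(fun t => (u t - u t₀) (𝓕 θ)) '' Ici s, image_mem_map (Ici_mem_atTop s), ?_⟩
    rintro _ ⟨x, hx, rfl⟩ _ ⟨y, hy, rfl⟩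
    have := dist_triangle_right ((u x - u t₀) (𝓕 θ)) ((u y - u t₀) (𝓕 θ)) ((u s - u t₀) (𝓕 θ))
    linarith [hd x hx, hd y hy]
  choose z hz using hcauchy
  let L : 𝓢(Sp n, ℂ) →ₗ[ℂ] ℂ :=
    { toFun := z
      map_add' := fun θ θ' => by
        refine tendsto_nhds_unique (hz (θ + θ')) (((hz θ).add (hz θ')).congr fun t => ?_)
        rw [FourierTransform.fourier_add, map_add]
      map_smul' := fun c θ => by
        refine tendsto_nhds_unique (hz (c • θ)) (((hz θ).const_mul c).congr fun t => ?_)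
        rw [FourierTransform.fourier_smul, map_smul]
        rfl }
  -- Only the differences are controlled, as `u t₀` need not have finite norm. The limit of `u t - u
  -- t₀` is represented first, and `u t₀` is added back afterwards.
  obtain ⟨v', hv', -⟩ := exists_gevreyNorm_le_of_functional hn (ν := ν) (hi := hi) hρ hlo
    (hb0 t₀ le_rfl) L (fun θ => by
      refine le_of_tendsto (hz θ).norm ?_
      filter_upwards [eventually_ge_atTop t₀] with t ht
      exact norm_fourier_le hn hρ hlo (hb0 t₀ le_rfl) (hu t₀ t le_rfl ht) θ)
  have hlim (θ) : Tendsto (fun t => u t θ) atTop (𝓝 ((v' + u t₀) θ)) := by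
    have h1 := hz (𝓕⁻ θ)
    have h2 := hv' (𝓕⁻ θ)
    rw [TemperedDistribution.fourier_apply, FourierTransform.fourier_fourierInv_eq] at h2
    rw [FourierTransform.fourier_fourierInv_eq] at h1
    have h3 := h1.add_const (u t₀ θ)
    have e : z (𝓕⁻ θ) + u t₀ θ = (v' + u t₀) θ := by
      change _ = v' θ + u t₀ θ
      rw [h2]
      rfl
    rw [e] at h3
    refine h3.congr fun t => ?_
    change u t θ - u t₀ θ + u t₀ θ = _
    ring
  refine ⟨v' + u t₀, hlim, fun s hs => ?_⟩
  rw [← gevreyNorm_neg, neg_sub]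
  refine gevreyNorm_le_of_tendsto (F := atTop) (u := fun t => u t - u s) (v := v' + u t₀ - u s)
    (C := fun _ => b s) hn hρ hlo (fun θ => (hlim θ).sub_const (u s θ)) tendsto_const_nhds (fun _ => hb0 s hs) ?_
  filter_upwards [eventually_ge_atTop s] with t ht
  exact hu s t hs ht

/-- Integration in time of a distribution valued function from `1`. -/
theorem exists_hasTimeDeriv {n : ℕ} (hn : 0 < n) {ρ ν hi lo : ℝ} (hρ : 0 ≤ ρ)
    (hlo : lo < (n : ℝ) / 2) {R : ℝ → TD n} {B' : ℝ → ℝ} (hB' : ContinuousOn B' (Ici 1))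
    (hB0 : ∀ t, 1 ≤ t → 0 ≤ B' t)
    (hR : ∀ t, 1 ≤ t → gevreyNorm ρ ν hi lo (R t) ≤ ENNReal.ofReal (B' t))
    (hc : ∀ θ, ContinuousOn (fun t => R t θ) (Ici 1)) :
    ∃ u : ℝ → TD n, u 1 = 0 ∧ HasTimeDeriv (Ici 1) u R := by
  have hc' (θ) : Continuous fun t => R (max t 1) θ :=
    (hc θ).comp_continuous (by fun_prop) fun t => le_max_right t 1
  have hBc : Continuous fun t => B' (max t 1) :=
    hB'.comp_continuous (by fun_prop) fun t => le_max_right t 1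
  have hex (t : ℝ) : ∃ v : TD n, ∀ θ, v θ = ∫ s in (1 : ℝ)..(max t 1), R (max s 1) θ := by
    let L : 𝓢(Sp n, ℂ) →ₗ[ℂ] ℂ :=
      { toFun := fun θ => ∫ s in (1 : ℝ)..(max t 1), R (max s 1) (𝓕 θ)
        map_add' := fun θ θ' => by
          rw [← intervalIntegral.integral_add ((hc' _).intervalIntegrable _ _)
            ((hc' _).intervalIntegrable _ _)]
          simp only [FourierTransform.fourier_add, map_add]
        map_smul' := fun c θ => by
          rw [RingHom.id_apply, ← intervalIntegral.integral_smul]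
          simp only [FourierTransform.fourier_smul, map_smul] }
    obtain ⟨v, hv, -⟩ := exists_gevreyNorm_le_of_functional hn (ν := ν) (hi := hi) hρ hlo
      (C := ∫ s in (1 : ℝ)..(max t 1), B' (max s 1))
      (intervalIntegral.integral_nonneg (le_max_right t 1) fun s _ => hB0 _ (le_max_right s 1)) L
      (fun θ => by
        rw [← intervalIntegral.integral_mul_const]
        refine intervalIntegral.norm_integral_le_of_norm_le (le_max_right t 1)
          (Eventually.of_forall fun s _ => ?_) ((hBc.mul continuous_const).intervalIntegrable _ _)
        exact norm_fourier_le hn hρ hlo (hB0 _ (le_max_right s 1)) (hR _ (le_max_right s 1)) θ)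
    refine ⟨v, fun θ => ?_⟩
    have := hv (𝓕⁻ θ)
    rw [TemperedDistribution.fourier_apply, FourierTransform.fourier_fourierInv_eq] at this
    rw [this]
    change ∫ s in (1 : ℝ)..(max t 1), R (max s 1) (𝓕 (𝓕⁻ θ)) = _
    rw [FourierTransform.fourier_fourierInv_eq]
  choose u hu using hex
  refine ⟨u, by ext θ; simp [hu], fun t ht θ => ?_⟩
  have ht1 : (1 : ℝ) ≤ t := ht
  have h1 := (intervalIntegral.integral_hasDerivAt_right (a := 1) (b := t)
    ((hc' θ).intervalIntegrable _ _) (hc' θ).stronglyMeasurable.stronglyMeasurableAtFilter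
    (hc' θ).continuousAt).hasDerivWithinAt (s := Ici 1)
  rw [max_eq_left ht1] at h1
  refine h1.congr (fun x hx => ?_) ?_
  · rw [hu, max_eq_left (show (1 : ℝ) ≤ x from hx)]
  · rw [hu, max_eq_left ht1]

/-- Norm continuity on `[1, ∞)`. -/
structure NormCont {n : ℕ} (ρ ν hi lo : ℝ) (u : ℝ → TD n) : Prop where
  lt_top : ∀ t, 1 ≤ t → gevreyNorm ρ ν hi lo (u t) < ⊤
  tendsto : ∀ t, 1 ≤ t → Tendsto (fun s => gevreyNorm ρ ν hi lo (u s - u t)) (𝓝[Ici 1] t) (𝓝 0)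

theorem normCont_const {n : ℕ} {ρ ν hi lo : ℝ} {u : ℝ → TD n} {v : TD n}
    (hu : ∀ t, 1 ≤ t → u t = v) (hv : gevreyNorm ρ ν hi lo v < ⊤) : NormCont ρ ν hi lo u where
  lt_top t ht := by rwa [hu t ht]
  tendsto t ht := by
    refine tendsto_const_nhds.congr' ?_
    filter_upwards [self_mem_nhdsWithin] with s hs
    rw [hu t ht, hu s hs, sub_self, gevreyNorm_zero]

theorem normCont_of_le {n : ℕ} {ρ ν hi lo : ℝ} {u : ℝ → TD n} {B : ℝ → ℝ}
    (hB : ContinuousOn B (Ici 1)) (hlt : ∀ t, 1 ≤ t → gevreyNorm ρ ν hi lo (u t) < ⊤)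
    (hu : ∀ s t, 1 ≤ s → s ≤ t → gevreyNorm ρ ν hi lo (u t - u s) ≤ ENNReal.ofReal (B t - B s)) :
    NormCont ρ ν hi lo u where
  lt_top := hlt
  tendsto t ht := by
    have h1 : Tendsto (fun s => ENNReal.ofReal |B s - B t|) (𝓝[Ici 1] t) (𝓝 0) := by
      have h2 : Tendsto (fun s => |B s - B t|) (𝓝[Ici 1] t) (𝓝 0) := by
        have := ((hB t ht).sub_const (B t)).abs
        simpa using this
      have := ENNReal.tendsto_ofReal h2
      rwa [ENNReal.ofReal_zero] at this
    refine tendsto_of_tendsto_of_tendsto_of_le_of_le' tendsto_const_nhds h1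
      (Eventually.of_forall fun _ => zero_le) ?_
    filter_upwards [self_mem_nhdsWithin] with s hs
    rcases le_total s t with h | h
    · rw [← gevreyNorm_neg, neg_sub, abs_sub_comm]
      exact (hu s t hs h).trans (ENNReal.ofReal_le_ofReal (le_abs_self _))
    · exact (hu t s ht h).trans (ENNReal.ofReal_le_ofReal (le_abs_self _))

/-- The increment of a bilinear expression splits into three products, each containing a small norm.
Continuity of the sources against test functions is what `exists_hasTimeDeriv` needs to
differentiate its integral. -/
theorem BddBilin.continuousOn_apply {n : ℕ} (hn : 0 < n) {T : TD n → TD n → TD n}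
    {h₁ l₁ h₂ l₂ h l C : ℝ} (hT : BddBilin T h₁ l₁ h₂ l₂ h l C) (hl : l < (n : ℝ) / 2) {ρ ν : ℝ}
    (hρ : 0 ≤ ρ) (hν : 0 ≤ ν) (hν1 : ν ≤ 1) {u v : ℝ → TD n} (hu : NormCont ρ ν h₁ l₁ u)
    (hv : NormCont ρ ν h₂ l₂ v) (θ : 𝓢(Sp n, ℂ)) :
    ContinuousOn (fun t => T (u t) (v t) θ) (Ici 1) := by
  intro t ht
  refine tendsto_apply_of_gevreyNorm (hi := h) (lo := l) hn hρ (ν := ν) hl ?_ θ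
  have hsub (a b : ℝ) (ha : 1 ≤ a) (hb : 1 ≤ b) : gevreyNorm ρ ν h₂ l₂ (v a - v b) < ⊤ :=
    (gevreyNorm_sub_le _ _ _ _ _ _).trans_lt (ENNReal.add_lt_top.2 ⟨hv.lt_top a ha, hv.lt_top b hb⟩)
  have hsub' (a b : ℝ) (ha : 1 ≤ a) (hb : 1 ≤ b) : gevreyNorm ρ ν h₁ l₁ (u a - u b) < ⊤ :=
    (gevreyNorm_sub_le _ _ _ _ _ _).trans_lt (ENNReal.add_lt_top.2 ⟨hu.lt_top a ha, hu.lt_top b hb⟩)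
  have hbd : ∀ s ∈ Ici (1 : ℝ), gevreyNorm ρ ν h l (T (u s) (v s) - T (u t) (v t)) ≤
      ENNReal.ofReal C * gevreyNorm ρ ν h₁ l₁ (u s - u t) * gevreyNorm ρ ν h₂ l₂ (v s - v t) +
      (ENNReal.ofReal C * gevreyNorm ρ ν h₁ l₁ (u s - u t) * gevreyNorm ρ ν h₂ l₂ (v t) +
      ENNReal.ofReal C * gevreyNorm ρ ν h₁ l₁ (u t) * gevreyNorm ρ ν h₂ l₂ (v s - v t)) := by
    intro s hs
    have e : T (u s) (v s) - T (u t) (v t) =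
        T (u s - u t) (v s - v t) + (T (u s - u t) (v t) + T (u t) (v s - v t)) := by
      rw [hT.sub_left ρ ν hρ hν hν1 _ _ _ (hu.lt_top s hs) (hu.lt_top t ht) (hsub s t hs ht),
        hT.sub_left ρ ν hρ hν hν1 _ _ _ (hu.lt_top s hs) (hu.lt_top t ht) (hv.lt_top t ht),
        hT.sub_right ρ ν hρ hν hν1 _ _ _ (hu.lt_top s hs) (hv.lt_top s hs) (hv.lt_top t ht),
        hT.sub_right ρ ν hρ hν hν1 _ _ _ (hu.lt_top t ht) (hv.lt_top s hs) (hv.lt_top t ht)]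
      abel
    rw [e]
    refine (gevreyNorm_add_le _ _ _ _ _ _).trans (add_le_add
      (hT.bound ρ ν hρ hν hν1 _ _ (hsub' s t hs ht) (hsub s t hs ht)) ?_)
    exact (gevreyNorm_add_le _ _ _ _ _ _).trans (add_le_add
      (hT.bound ρ ν hρ hν hν1 _ _ (hsub' s t hs ht) (hv.lt_top t ht))
      (hT.bound ρ ν hρ hν hν1 _ _ (hu.lt_top t ht) (hsub s t hs ht)))
  have hU := ENNReal.Tendsto.const_mul (a := ENNReal.ofReal C) (hu.tendsto t ht)
    (Or.inr ENNReal.ofReal_ne_top)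
  rw [mul_zero] at hU
  have h1 := ENNReal.Tendsto.mul hU (Or.inr ENNReal.zero_ne_top) (hv.tendsto t ht)
    (Or.inr ENNReal.zero_ne_top)
  have h2 := ENNReal.Tendsto.mul_const (b := gevreyNorm ρ ν h₂ l₂ (v t)) hU
    (Or.inr (hv.lt_top t ht).ne)
  have h3 := ENNReal.Tendsto.const_mul (a := ENNReal.ofReal C * gevreyNorm ρ ν h₁ l₁ (u t))
    (hv.tendsto t ht)
    (Or.inr (ENNReal.mul_lt_top ENNReal.ofReal_lt_top (hu.lt_top t ht)).ne)
  have h4 := h1.add (h2.add h3)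
  simp only [mul_zero, zero_mul, add_zero] at h4
  refine tendsto_of_tendsto_of_tendsto_of_le_of_le' tendsto_const_nhds h4
    (Eventually.of_forall fun _ => zero_le) ?_
  filter_upwards [self_mem_nhdsWithin] with s hs
  exact hbd s hs

/-! ### Rates -/

/-- `1, Q_0, Q_1, …`: decay of the amplitudes. -/
def ampl (d : ℝ → ℝ) : ℕ → ℝ → ℝ
  | 0, _ => 1
  | m + 1, t => QFun d m t

/-- Growth rate of the phases. -/
def rate (d : ℝ → ℝ) : ℕ → ℝ → ℝ
  | 0, t => d t
  | m + 1, t => phaseRate d m t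

/-- Antiderivative of `rate`. -/
def prim (d : ℝ → ℝ) : ℕ → ℝ → ℝ
  | 0, t => NFun d 0 t
  | m + 1, t => phaseBound d m t

section

variable {d : ℝ → ℝ}

theorem ampl_nonneg (hd : IsDensity d) (m : ℕ) {t : ℝ} (ht : 1 ≤ t) : 0 ≤ ampl d m t := by
  cases m with
  | zero => exact zero_le_one
  | succ m => exact QFun_nonneg hd m ht

theorem rate_nonneg (hd : IsDensity d) (m : ℕ) {t : ℝ} (ht : 1 ≤ t) : 0 ≤ rate d m t := by
  cases m with
  | zero => exact hd.nonneg t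
  | succ m => exact phaseRate_nonneg hd m ht

theorem hasDerivAt_prim (hd : IsDensity d) (m : ℕ) {t : ℝ} (ht : 1 ≤ t) :
    HasDerivAt (prim d m) (rate d m t) t := by
  cases m with
  | zero =>
    have := hasDerivAt_NFun hd 0 t
    rw [pow_zero, mul_one] at this
    exact this
  | succ m => exact hasDerivAt_phaseBound hd m ht

theorem prim_one (d : ℝ → ℝ) (m : ℕ) : prim d m 1 = 0 := by
  cases m with
  | zero => exact NFun_one d 0
  | succ m => exact phaseBound_one d m

theorem prim_le (hd : IsDensity d) (m : ℕ) {t : ℝ} (ht : 1 ≤ t) : prim d m t ≤ 5 * NFun d m t := by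
  cases m with
  | zero =>
    have := NFun_nonneg hd 0 ht
    simp only [prim]
    linarith
  | succ m => exact phaseBound_le hd m ht

theorem continuousOn_rate (hd : IsDensity d) (m : ℕ) : ContinuousOn (rate d m) (Ici 1) := by
  cases m with
  | zero => exact hd.cont.continuousOn
  | succ m =>
    have hN (j : ℕ) : ContinuousOn (NFun d j) (Ici 1) := fun t _ =>
      (hasDerivAt_NFun hd j t).continuousAt.continuousWithinAt
    have hR (j : ℕ) : ContinuousOn (RFun d j) (Ici 1) := fun t ht =>
      (hasDerivAt_RFun hd j ht).continuousAt.continuousWithinAt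
    have hh := (continuous_hFun hd).continuousOn (s := Ici 1)
    have hdc := hd.cont.continuousOn (s := Ici 1)
    have hi : ContinuousOn (fun t : ℝ => t⁻¹) (Ici 1) :=
      continuousOn_inv₀.mono fun t ht => (one_pos.trans_le (show (1 : ℝ) ≤ t from ht)).ne'
    have hi2 : ContinuousOn (fun t : ℝ => (t ^ 2)⁻¹) (Ici 1) :=
      (hi.pow 2).congr fun t _ => (inv_pow t 2).symm
    have h0 := hN 0
    have h1 := hN m
    have h2 := hR 0
    have h3 := hR m
    change ContinuousOn (fun t => phaseRate d m t) (Ici 1)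
    unfold phaseRate
    fun_prop

theorem NFun_mul_ampl_le (hd : IsDensity d) {i j m : ℕ} (h : j + i = m) {t : ℝ} (ht : 1 ≤ t) :
    NFun d j t * ampl d i t ≤ 2 * NFun d m t := by
  subst h
  cases i with
  | zero =>
    have := NFun_nonneg hd j ht
    simp only [ampl, add_zero]
    linarith
  | succ i => exact QFun_mul_NFun_le hd i j ht

theorem ampl_mul_ampl_le (hd : IsDensity d) {i j m : ℕ} (h : i + j = m + 1) {t : ℝ} (ht : 1 ≤ t) :
    ampl d i t * ampl d j t ≤ 4 * QFun d m t + hFun d t ^ (m + 1) := by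
  have hQ := QFun_nonneg hd m ht
  have hh := pow_nonneg (hFun_nonneg hd t) (m + 1)
  cases i with
  | zero =>
    obtain rfl : j = m + 1 := by omega
    simp only [ampl]
    linarith
  | succ i =>
    cases j with
    | zero =>
      obtain rfl : i = m := by omega
      simp only [ampl]
      linarith
    | succ j =>
      obtain rfl : m = i + j + 1 := by omega
      exact QFun_mul_QFun_le hd i j ht

end

/-! ### The scale of spaces -/

/-- Mapping properties of the nonlinear terms in a scale of spaces `K m`, `Y m`. -/
structure Scheme (n p : ℕ) (K Y : ℕ → ℝ) (llow κ μ C : ℝ) : Prop where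
  dim_pos : 0 < n
  low_lt : llow < (n : ℝ) / 2
  nonneg : 0 ≤ C
  tr : ∀ i j, i + j ≤ p →
    BddBilin (transport : TD n → TD n → TD n) (Y j) llow (K i) 0 (K (i + j + 1)) 0 C
  gr : ∀ i j, i + j ≤ p →
    BddBilin (gradDot : TD n → TD n → TD n) (Y i) llow (Y j) llow (Y (i + j + 1)) llow C
  gz : ∀ i j, i + j ≤ p + 1 →
    BddBilin (g0 κ μ : TD n → TD n → TD n) (K i) 0 (K j) 0 (Y (i + j)) llow C

section

variable {n p : ℕ} {K Y : ℕ → ℝ} {llow κ μ C : ℝ} {d : ℝ → ℝ}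

theorem norm_inv_two_sq {t : ℝ} : ‖((2 * t ^ 2 : ℂ))⁻¹‖ = (2 * t ^ 2)⁻¹ := by
  rw [norm_inv, norm_mul, norm_pow, Complex.norm_real, Real.norm_eq_abs, sq_abs]
  norm_num

/-- The sequences are arbitrary, so the estimate serves both for the corrections and for sums mixing
corrections with remainders. In each summand the indices add up to m and so do the rates, by
`NFun_mul_ampl_le`. -/
theorem Scheme.transport_le (S : Scheme n p K Y llow κ μ C) (hd : IsDensity d) {ρ ν A : ℝ}
    (hρ : 0 ≤ ρ) (hν : 0 ≤ ν) (hν1 : ν ≤ 1) (hA : 0 ≤ A) {m : ℕ} (hm : m ≤ p) {t : ℝ} (ht : 1 ≤ t)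
    {x y : ℕ → TD n}
    (hx : ∀ j ≤ m, gevreyNorm ρ ν (Y j) llow (x j) ≤ ENNReal.ofReal (A * NFun d j t))
    (hy : ∀ j ≤ m, gevreyNorm ρ ν (K j) 0 (y j) ≤ ENNReal.ofReal (A * ampl d j t)) :
    gevreyNorm ρ ν (K (m + 1)) 0
      ((2 * t ^ 2 : ℂ)⁻¹ • ∑ j ∈ Finset.range (m + 1), transport (x j) (y (m - j))) ≤
      ENNReal.ofReal (C * A ^ 2 * (m + 1) * ((t ^ 2)⁻¹ * NFun d m t)) := by
  have h1 : gevreyNorm ρ ν (K (m + 1)) 0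
      (∑ j ∈ Finset.range (m + 1), transport (x j) (y (m - j))) ≤
      ENNReal.ofReal ((m + 1 : ℕ) * (C * A ^ 2 * (2 * NFun d m t))) := by
    refine gevreyNorm_sum_le_ofReal _ fun j hj => ?_
    have hjm : m - j + j = m := by omega
    have hb := (S.tr (m - j) j (by omega)).bound_ofReal hρ hν hν1
      (mul_nonneg hA (NFun_nonneg hd j ht)) (hx j (by omega)) (hy (m - j) (by omega))
    rw [hjm] at hb
    refine hb.trans (ENNReal.ofReal_le_ofReal ?_)
    have h2 := NFun_mul_ampl_le hd (show j + (m - j) = m by omega) ht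
    calc C * (A * NFun d j t * (A * ampl d (m - j) t))
        = C * A ^ 2 * (NFun d j t * ampl d (m - j) t) := by ring
      _ ≤ _ := mul_le_mul_of_nonneg_left h2 (mul_nonneg S.nonneg (by positivity))
  refine (gevreyNorm_smul_le_ofReal norm_inv_two_sq.le h1).trans (le_of_eq ?_)
  congr 1
  push_cast
  rw [mul_inv]
  ring

/-- At order 0 there is no gradient term and `t^(-γ) ≤ c h₀'` alone gives the rate. At order M+1 the
gradient terms reduce to `N_0 N_M` and the `g0` terms to `4 Q_M + h^(M+1)`, the three quantities in
`le_phaseRate`. Each bilinear form has two separate input sequences for later use with remainders.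
-/
theorem Scheme.phase_le (S : Scheme n p K Y llow κ μ C) (hd : IsDensity d) {γ c : ℝ} (hc : 0 ≤ c)
    {ρ ν A : ℝ} (hρ : 0 ≤ ρ) (hν : 0 ≤ ν) (hν1 : ν ≤ 1) (hA : 0 ≤ A) {m : ℕ} (hm : m ≤ p + 1)
    {t : ℝ} (ht : 1 ≤ t) (hγ : t ^ (-γ) ≤ c * d t) {x y x' y' : ℕ → TD n}
    (hx : ∀ j < m, gevreyNorm ρ ν (Y j) llow (x j) ≤ ENNReal.ofReal (A * NFun d j t))
    (hy : ∀ j < m, gevreyNorm ρ ν (Y j) llow (y j) ≤ ENNReal.ofReal (A * NFun d j t))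
    (hx' : ∀ j ≤ m, gevreyNorm ρ ν (K j) 0 (x' j) ≤ ENNReal.ofReal (A * ampl d j t))
    (hy' : ∀ j ≤ m, gevreyNorm ρ ν (K j) 0 (y' j) ≤ ENNReal.ofReal (A * ampl d j t)) :
    gevreyNorm ρ ν (Y m) llow
      ((2 * t ^ 2 : ℂ)⁻¹ • ∑ j ∈ Finset.range m, gradDot (x j) (y (m - 1 - j)) +
        ((t ^ (-γ) : ℝ) : ℂ) • ∑ j ∈ Finset.range (m + 1), g0 κ μ (x' j) (y' (m - j))) ≤
      ENNReal.ofReal (C * A ^ 2 * (m + 1) * (1 + 4 * c) * rate d m t) := by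
  have hCA : 0 ≤ C * A ^ 2 := mul_nonneg S.nonneg (by positivity)
  have hcd : ‖((t ^ (-γ) : ℝ) : ℂ)‖ ≤ c * d t := by
    rw [Complex.norm_real, Real.norm_of_nonneg (by positivity)]
    exact hγ
  cases m with
  | zero =>
    simp only [Finset.range_zero, Finset.sum_empty, zero_add, Finset.range_one,
      Finset.sum_singleton, Nat.sub_zero]
    have e : (2 * t ^ 2 : ℂ)⁻¹ • (0 : TD n) = 0 := by
      ext θ
      simp
    rw [e, zero_add]
    have h1 := (S.gz 0 0 (by omega)).bound_ofReal hρ hν hν1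
      (mul_nonneg hA (ampl_nonneg hd 0 ht)) (hx' 0 le_rfl) (hy' 0 le_rfl)
    refine (gevreyNorm_smul_le_ofReal hcd h1).trans (ENNReal.ofReal_le_ofReal ?_)
    have hdn := hd.nonneg t
    simp only [ampl, rate, Nat.cast_zero]
    have : 0 ≤ C * A ^ 2 * d t := mul_nonneg hCA hdn
    nlinarith [mul_nonneg this hc]
  | succ M =>
    have hN0 := NFun_nonneg hd 0 ht
    have hNM := NFun_nonneg hd M ht
    have hQ := QFun_nonneg hd M ht
    have hh := pow_nonneg (hFun_nonneg hd t) (M + 1)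
    have hdn := hd.nonneg t
    have h1 : gevreyNorm ρ ν (Y (M + 1)) llow
        (∑ j ∈ Finset.range (M + 1), gradDot (x j) (y (M + 1 - 1 - j))) ≤
        ENNReal.ofReal ((M + 1 : ℕ) * (C * A ^ 2 * (2 * (NFun d 0 t * NFun d M t)))) := by
      refine gevreyNorm_sum_le_ofReal _ fun j hj => ?_
      have hjm : j + (M + 1 - 1 - j) = M := by omega
      have hb := (S.gr j (M + 1 - 1 - j) (by omega)).bound_ofReal hρ hν hν1
        (mul_nonneg hA (NFun_nonneg hd j ht)) (hx j hj) (hy (M + 1 - 1 - j) (by omega))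
      rw [hjm] at hb
      refine hb.trans (ENNReal.ofReal_le_ofReal ?_)
      have h2 := NFun_mul_NFun_le hd j (M + 1 - 1 - j) ht
      rw [hjm] at h2
      calc C * (A * NFun d j t * (A * NFun d (M + 1 - 1 - j) t))
          = C * A ^ 2 * (NFun d j t * NFun d (M + 1 - 1 - j) t) := by ring
        _ ≤ _ := mul_le_mul_of_nonneg_left h2 hCA
    have h2 : gevreyNorm ρ ν (Y (M + 1)) llow
        (∑ j ∈ Finset.range (M + 1 + 1), g0 κ μ (x' j) (y' (M + 1 - j))) ≤
        ENNReal.ofReal ((M + 1 + 1 : ℕ) * (C * A ^ 2 * (4 * QFun d M t + hFun d t ^ (M + 1)))) := by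
      refine gevreyNorm_sum_le_ofReal _ fun j hj => ?_
      have hjm : j + (M + 1 - j) = M + 1 := by omega
      have hb := (S.gz j (M + 1 - j) (by omega)).bound_ofReal hρ hν hν1
        (mul_nonneg hA (ampl_nonneg hd j ht)) (hx' j (by omega)) (hy' (M + 1 - j) (by omega))
      rw [hjm] at hb
      refine hb.trans (ENNReal.ofReal_le_ofReal ?_)
      have h2 := ampl_mul_ampl_le hd hjm ht
      calc C * (A * ampl d j t * (A * ampl d (M + 1 - j) t))
          = C * A ^ 2 * (ampl d j t * ampl d (M + 1 - j) t) := by ring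
        _ ≤ _ := mul_le_mul_of_nonneg_left h2 hCA
    refine (gevreyNorm_add_le_ofReal ?_ ?_ (gevreyNorm_smul_le_ofReal norm_inv_two_sq.le h1)
      (gevreyNorm_smul_le_ofReal hcd h2)).trans (ENNReal.ofReal_le_ofReal ?_)
    · have := mul_nonneg hCA (mul_nonneg zero_le_two (mul_nonneg hN0 hNM))
      positivity
    · exact mul_nonneg (mul_nonneg hc hdn) (mul_nonneg (by positivity)
        (mul_nonneg hCA (by positivity)))
    · have h3 := le_phaseRate hd M ht
      have ht2 : (0 : ℝ) < (t ^ 2)⁻¹ := by positivity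
      simp only [rate]
      push_cast
      have hX : 0 ≤ (t ^ 2)⁻¹ * (NFun d 0 t * NFun d M t) := by positivity
      have hYY : 0 ≤ d t * QFun d M t := by positivity
      have hZ : 0 ≤ d t * hFun d t ^ (M + 1) := by positivity
      have hM0 : (0 : ℝ) ≤ M := Nat.cast_nonneg M
      set X := (t ^ 2)⁻¹ * (NFun d 0 t * NFun d M t)
      set YY := d t * QFun d M t
      set Z := d t * hFun d t ^ (M + 1)
      have h4 : (1 + 4 * c) * (X + YY + Z) ≤ (1 + 4 * c) * phaseRate d M t :=
        mul_le_mul_of_nonneg_left h3 (by linarith)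
      have h5 : ((M : ℝ) + 1) * X + c * ((M : ℝ) + 1 + 1) * (4 * YY + Z) ≤
          ((M : ℝ) + 1 + 1) * ((1 + 4 * c) * (X + YY + Z)) := by
        have a1 := mul_nonneg hc hX
        have a2 := mul_nonneg hc hYY
        have a3 := mul_nonneg hc hZ
        have b1 := mul_nonneg hM0 a1
        have b2 := mul_nonneg hM0 a3
        have b3 := mul_nonneg hM0 hYY
        have b4 := mul_nonneg hM0 hZ
        nlinarith
      calc (2 * t ^ 2)⁻¹ * (((M : ℝ) + 1) * (C * A ^ 2 * (2 * (NFun d 0 t * NFun d M t)))) +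
          c * d t * (((M : ℝ) + 1 + 1) * (C * A ^ 2 * (4 * QFun d M t + hFun d t ^ (M + 1))))
          = C * A ^ 2 * (((M : ℝ) + 1) * X + c * ((M : ℝ) + 1 + 1) * (4 * YY + Z)) := by
            simp only [X, YY, Z]
            rw [mul_inv]
            ring
        _ ≤ C * A ^ 2 * (((M : ℝ) + 1 + 1) * ((1 + 4 * c) * phaseRate d M t)) := by
            refine mul_le_mul_of_nonneg_left (h5.trans ?_) hCA
            exact mul_le_mul_of_nonneg_left h4 (by positivity)
        _ = _ := by ring

/-- Bounds for a phase with controlled time derivative. -/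
theorem Scheme.phase_sub_le (S : Scheme n p K Y llow κ μ C) (hd : IsDensity d) {ρ ν A t₀ h : ℝ}
    (hρ : 0 ≤ ρ) (hA : 0 ≤ A) (m : ℕ) (ht₀ : 1 ≤ t₀) {u R : ℝ → TD n}
    (hu : HasTimeDeriv (Ici t₀) u R)
    (hR : ∀ t, t₀ ≤ t → gevreyNorm ρ ν h llow (R t) ≤ ENNReal.ofReal (A * rate d m t))
    {s t : ℝ} (hs : t₀ ≤ s) (hst : s ≤ t) :
    gevreyNorm ρ ν h llow (u t - u s) ≤ ENNReal.ofReal (A * prim d m t - A * prim d m s) := by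
  have h1 (τ : ℝ) (hτ : τ ∈ Icc s t) : 1 ≤ τ := ht₀.trans (hs.trans hτ.1)
  exact gevreyNorm_sub_le_of_hasTimeDeriv S.dim_pos hρ S.low_lt hs hst hu
    (B := fun τ => A * prim d m τ) (B' := fun τ => A * rate d m τ)
    (fun τ hτ => ((hasDerivAt_prim hd m (h1 τ hτ)).const_mul A).hasDerivWithinAt)
    (fun τ hτ =>
      ((hasDerivAt_prim hd m (h1 τ hτ)).const_mul A).continuousAt.continuousWithinAt)
    (fun τ hτ => mul_nonneg hA (rate_nonneg hd m (h1 τ hτ)))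
    (fun τ hτ => hR τ (hs.trans hτ.1))

/-- Bounds for an amplitude with controlled time derivative. -/
theorem Scheme.ampl_sub_le (S : Scheme n p K Y llow κ μ C) (hd : IsDensity d) {ρ ν A t₀ h : ℝ}
    (hρ : 0 ≤ ρ) (hA : 0 ≤ A) (m : ℕ) (ht₀ : 1 ≤ t₀) {u R : ℝ → TD n}
    (hu : HasTimeDeriv (Ici t₀) u R)
    (hR : ∀ t, t₀ ≤ t →
      gevreyNorm ρ ν h 0 (R t) ≤ ENNReal.ofReal (A * ((t ^ 2)⁻¹ * NFun d m t)))
    {s t : ℝ} (hs : t₀ ≤ s) (hst : s ≤ t) :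
    gevreyNorm ρ ν h 0 (u t - u s) ≤ ENNReal.ofReal (-(A * QFun d m t) - -(A * QFun d m s)) := by
  have hn := S.dim_pos
  have h1 (τ : ℝ) (hτ : τ ∈ Icc s t) : 1 ≤ τ := ht₀.trans (hs.trans hτ.1)
  have h2 (τ : ℝ) (hτ : τ ∈ Icc s t) : HasDerivWithinAt (fun τ => -(A * QFun d m τ))
      (A * ((τ ^ 2)⁻¹ * NFun d m τ)) (Ici 1) τ := by
    have := ((hasDerivWithinAt_QFun hd m (h1 τ hτ)).const_mul A).neg
    exact this.congr_deriv (by ring)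
  exact gevreyNorm_sub_le_of_hasTimeDeriv hn hρ (by positivity) hs hst hu
    (B := fun τ => -(A * QFun d m τ)) (B' := fun τ => A * ((τ ^ 2)⁻¹ * NFun d m τ))
    (fun τ hτ => (h2 τ hτ).mono fun x hx => (h1 τ hτ).trans hx)
    (fun τ hτ => (h2 τ hτ).continuousWithinAt.mono fun x hx => h1 x hx)
    (fun τ hτ => mul_nonneg hA (mul_nonneg (by positivity) (NFun_nonneg hd m (h1 τ hτ))))
    (fun τ hτ => hR τ (hs.trans hτ.1))

theorem Scheme.phase_bound (S : Scheme n p K Y llow κ μ C) (hd : IsDensity d) {ρ ν A h : ℝ}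
    (hρ : 0 ≤ ρ) (hA : 0 ≤ A) (m : ℕ) {u R : ℝ → TD n}
    (hu : HasTimeDeriv (Ici 1) u R) (hu1 : u 1 = 0)
    (hR : ∀ t, 1 ≤ t → gevreyNorm ρ ν h llow (R t) ≤ ENNReal.ofReal (A * rate d m t)) :
    (∀ t, 1 ≤ t → gevreyNorm ρ ν h llow (u t) ≤ ENNReal.ofReal (5 * A * NFun d m t)) ∧
      NormCont ρ ν h llow u := by
  have key {s t : ℝ} (hs : 1 ≤ s) (hst : s ≤ t) :=
    S.phase_sub_le hd hρ hA m le_rfl hu hR hs hst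
  have h1 (t : ℝ) (ht : 1 ≤ t) :
      gevreyNorm ρ ν h llow (u t) ≤ ENNReal.ofReal (5 * A * NFun d m t) := by
    have := key le_rfl ht
    rw [hu1, sub_zero, prim_one, mul_zero, sub_zero] at this
    refine this.trans (ENNReal.ofReal_le_ofReal ?_)
    calc A * prim d m t ≤ A * (5 * NFun d m t) := mul_le_mul_of_nonneg_left (prim_le hd m ht) hA
      _ = _ := by ring
  refine ⟨h1, normCont_of_le (B := fun t => A * prim d m t) (fun t ht =>
    ((hasDerivAt_prim hd m ht).const_mul A).continuousAt.continuousWithinAt)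
    (fun t ht => (h1 t ht).trans_lt ENNReal.ofReal_lt_top) fun s t hs hst => key hs hst⟩

/-- Integration over `[s, t]` followed by `t → ∞`. Convergence to 0 against test functions is
enough, by lower semicontinuity of the norm. -/
theorem Scheme.ampl_bound_of_tendsto (S : Scheme n p K Y llow κ μ C) (hd : IsDensity d)
    {ρ ν A t₀ h : ℝ} (hρ : 0 ≤ ρ) (hA : 0 ≤ A) (m : ℕ) (ht₀ : 1 ≤ t₀) {u R : ℝ → TD n}
    (hu : HasTimeDeriv (Ici t₀) u R) (hu0 : ∀ θ, Tendsto (fun t => u t θ) atTop (𝓝 0))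
    (hR : ∀ t, t₀ ≤ t →
      gevreyNorm ρ ν h 0 (R t) ≤ ENNReal.ofReal (A * ((t ^ 2)⁻¹ * NFun d m t)))
    {s : ℝ} (hs : t₀ ≤ s) : gevreyNorm ρ ν h 0 (u s) ≤ ENNReal.ofReal (A * QFun d m s) := by
  have hn := S.dim_pos
  rw [← gevreyNorm_neg]
  refine gevreyNorm_le_of_tendsto (F := atTop) (u := fun t => u t - u s)
    (C := fun _ => A * QFun d m s) hn hρ (by positivity)
    (fun θ => by simpa using (hu0 θ).sub_const (u s θ)) tendsto_const_nhds
    (fun _ => mul_nonneg hA (QFun_nonneg hd m (ht₀.trans hs))) ?_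
  filter_upwards [eventually_ge_atTop s] with t ht
  refine (S.ampl_sub_le hd hρ hA m ht₀ hu hR hs ht).trans (ENNReal.ofReal_le_ofReal ?_)
  have := mul_nonneg hA (QFun_nonneg hd m (ht₀.trans (hs.trans ht)))
  linarith

theorem Scheme.ampl_bound (S : Scheme n p K Y llow κ μ C) (hd : IsDensity d) {ρ ν A h : ℝ}
    (hρ : 0 ≤ ρ) (hA : 0 ≤ A) (m : ℕ) {u R : ℝ → TD n}
    (hu : HasTimeDeriv (Ici 1) u R) (hu0 : ∀ θ, Tendsto (fun t => u t θ) atTop (𝓝 0))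
    (hR : ∀ t, 1 ≤ t →
      gevreyNorm ρ ν h 0 (R t) ≤ ENNReal.ofReal (A * ((t ^ 2)⁻¹ * NFun d m t))) :
    (∀ t, 1 ≤ t → gevreyNorm ρ ν h 0 (u t) ≤ ENNReal.ofReal (A * QFun d m t)) ∧
      NormCont ρ ν h 0 u := by
  have h1 (t : ℝ) (ht : 1 ≤ t) := S.ampl_bound_of_tendsto hd hρ hA m le_rfl hu hu0 hR ht
  refine ⟨h1, normCont_of_le (B := fun t => -(A * QFun d m t)) (fun t ht => ?_)
    (fun t ht => (h1 t ht).trans_lt ENNReal.ofReal_lt_top)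
    fun s t hs hst => S.ampl_sub_le hd hρ hA m le_rfl hu hR hs hst⟩
  exact ((hasDerivWithinAt_QFun hd m ht).const_mul A).neg.continuousWithinAt

end

/-! ### The asymptotic functions -/

/-- The time derivative of `w_{m+1}`. -/
def amplRHS {n : ℕ} (m : ℕ) (wm φm : ℕ → ℝ → TD n) (t : ℝ) : TD n :=
  (2 * t ^ 2 : ℂ)⁻¹ • ∑ j ∈ Finset.range (m + 1), transport (φm j t) (wm (m - j) t)

/-- The time derivative of `φ_m`. -/
def phaseRHS {n : ℕ} (κ μ γ : ℝ) (m : ℕ) (wm φm : ℕ → ℝ → TD n) (t : ℝ) : TD n :=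
  (2 * t ^ 2 : ℂ)⁻¹ • ∑ j ∈ Finset.range m, gradDot (φm j t) (φm (m - 1 - j) t) +
    ((t ^ (-γ) : ℝ) : ℂ) • ∑ j ∈ Finset.range (m + 1), g0 κ μ (wm j t) (wm (m - j) t)

theorem amplRHS_congr {n m : ℕ} {wm φm wm' φm' : ℕ → ℝ → TD n} (hw : ∀ j ≤ m, wm j = wm' j)
    (hφ : ∀ j ≤ m, φm j = φm' j) : amplRHS m wm φm = amplRHS m wm' φm' := by
  funext t
  unfold amplRHS
  congr 1
  refine Finset.sum_congr rfl fun j hj => ?_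
  have := Finset.mem_range.1 hj
  rw [hw (m - j) (by omega), hφ j (by omega)]

theorem phaseRHS_congr {n m : ℕ} {κ μ γ : ℝ} {wm φm wm' φm' : ℕ → ℝ → TD n}
    (hw : ∀ j ≤ m, wm j = wm' j) (hφ : ∀ j < m, φm j = φm' j) :
    phaseRHS κ μ γ m wm φm = phaseRHS κ μ γ m wm' φm' := by
  funext t
  unfold phaseRHS
  congr 2
  · refine Finset.sum_congr rfl fun j hj => ?_
    have := Finset.mem_range.1 hj
    rw [hφ (m - 1 - j) (by omega), hφ j (by omega)]
  · refine Finset.sum_congr rfl fun j hj => ?_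
    have := Finset.mem_range.1 hj
    rw [hw (m - j) (by omega), hw j (by omega)]

/-- The equations of the asymptotic system for `w_1, …, w_a` and `φ_0, …, φ_{b-1}`. -/
structure PartialFamily {n : ℕ} (κ μ γ : ℝ) (a b : ℕ) (wplus : TD n) (wm φm : ℕ → ℝ → TD n) :
    Prop where
  w_zero : ∀ t, 1 ≤ t → wm 0 t = wplus
  eq_w : ∀ m < a, HasTimeDeriv (Ici 1) (wm (m + 1)) (amplRHS m wm φm)
  w_infty : ∀ m < a, ∀ θ, Tendsto (fun t => wm (m + 1) t θ) atTop (𝓝 0)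
  eq_φ : ∀ m < b, HasTimeDeriv (Ici 1) (φm m) (phaseRHS κ μ γ m wm φm)
  φ_one : ∀ m < b, φm m 1 = 0

theorem tendsto_TD_iff {n : ℕ} {u : ℝ → TD n} {v : TD n} :
    Tendsto u atTop (𝓝 v) ↔ ∀ θ, Tendsto (fun t => u t θ) atTop (𝓝 (v θ)) :=
  PointwiseConvergenceCLM.tendsto_iff_forall_tendsto

theorem partialFamily_iff {n : ℕ} {κ μ γ : ℝ} {p : ℕ} {wplus : TD n} {wm φm : ℕ → ℝ → TD n} :
    PartialFamily κ μ γ (p + 1) (p + 1) wplus wm φm ↔ IsAsymptoticFamily κ μ γ p wplus wm φm := by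
  constructor
  · intro h
    exact ⟨h.w_zero, fun m hm => h.eq_w m (by omega),
      fun m hm => tendsto_TD_iff.2 (h.w_infty m (by omega)),
      fun m hm => h.eq_φ m (by omega), fun m hm => h.φ_one m (by omega)⟩
  · intro h
    exact ⟨h.w_zero, fun m hm => h.eq_w m (by omega),
      fun m hm => tendsto_TD_iff.1 (h.w_infty m (by omega)),
      fun m hm => h.eq_φ m (by omega), fun m hm => h.φ_one m (by omega)⟩

/-- Bounds on and norm continuity of `w_0, …, w_a` and `φ_0, …, φ_{b-1}`. -/
structure FamilyBound {n : ℕ} (d : ℝ → ℝ) (K Y : ℕ → ℝ) (llow ρ ν A : ℝ) (a b : ℕ)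
    (wm φm : ℕ → ℝ → TD n) : Prop where
  w : ∀ j ≤ a, ∀ t, 1 ≤ t → gevreyNorm ρ ν (K j) 0 (wm j t) ≤ ENNReal.ofReal (A * ampl d j t)
  φ : ∀ j < b, ∀ t, 1 ≤ t → gevreyNorm ρ ν (Y j) llow (φm j t) ≤ ENNReal.ofReal (A * NFun d j t)
  w_cont : ∀ j ≤ a, NormCont ρ ν (K j) 0 (wm j)
  φ_cont : ∀ j < b, NormCont ρ ν (Y j) llow (φm j)

section

variable {n p : ℕ} {K Y : ℕ → ℝ} {llow κ μ C : ℝ} {d : ℝ → ℝ} {γ c : ℝ} {ρ ν A : ℝ}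
  {wm φm : ℕ → ℝ → TD n} {m : ℕ}

theorem FamilyBound.phase_le (S : Scheme n p K Y llow κ μ C) (hd : IsDensity d) (hc : 0 ≤ c)
    (hγ : ∀ t, 1 ≤ t → t ^ (-γ) ≤ c * d t) (hρ : 0 ≤ ρ) (hν : 0 ≤ ν) (hν1 : ν ≤ 1) (hA : 0 ≤ A)
    (hm : m ≤ p + 1) (h : FamilyBound d K Y llow ρ ν A m m wm φm) {t : ℝ} (ht : 1 ≤ t) :
    gevreyNorm ρ ν (Y m) llow (phaseRHS κ μ γ m wm φm t) ≤
      ENNReal.ofReal (C * A ^ 2 * (m + 1) * (1 + 4 * c) * rate d m t) :=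
  S.phase_le (x := fun j => φm j t) (y := fun j => φm j t) (x' := fun j => wm j t)
    (y' := fun j => wm j t) hd hc hρ hν hν1 hA hm ht (hγ t ht)
    (fun j hj => h.φ j hj t ht) (fun j hj => h.φ j hj t ht)
    (fun j hj => h.w j hj t ht) (fun j hj => h.w j hj t ht)

theorem FamilyBound.ampl_le (S : Scheme n p K Y llow κ μ C) (hd : IsDensity d)
    (hρ : 0 ≤ ρ) (hν : 0 ≤ ν) (hν1 : ν ≤ 1) (hA : 0 ≤ A)
    (hm : m ≤ p) (h : FamilyBound d K Y llow ρ ν A m (m + 1) wm φm) {t : ℝ} (ht : 1 ≤ t) :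
    gevreyNorm ρ ν (K (m + 1)) 0 (amplRHS m wm φm t) ≤
      ENNReal.ofReal (C * A ^ 2 * (m + 1) * ((t ^ 2)⁻¹ * NFun d m t)) :=
  S.transport_le (x := fun j => φm j t) (y := fun j => wm j t) hd hρ hν hν1 hA hm ht
    (fun j hj => h.φ j (by omega) t ht) (fun j hj => h.w j hj t ht)

theorem FamilyBound.succ_phase (S : Scheme n p K Y llow κ μ C) (hd : IsDensity d) (hc : 0 ≤ c)
    (hγ : ∀ t, 1 ≤ t → t ^ (-γ) ≤ c * d t) (hρ : 0 ≤ ρ) (hν : 0 ≤ ν) (hν1 : ν ≤ 1) (hA : 0 ≤ A)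
    (hm : m ≤ p + 1) (h : FamilyBound d K Y llow ρ ν A m m wm φm)
    (hφ : HasTimeDeriv (Ici 1) (φm m) (phaseRHS κ μ γ m wm φm)) (hφ1 : φm m 1 = 0) :
    FamilyBound d K Y llow ρ ν (A + 5 * (C * A ^ 2 * (m + 1) * (1 + 4 * c))) m (m + 1) wm φm := by
  have hB : 0 ≤ C * A ^ 2 * (m + 1) * (1 + 4 * c) :=
    mul_nonneg (mul_nonneg (mul_nonneg S.nonneg (by positivity)) (by positivity)) (by positivity)
  obtain ⟨h1, h2⟩ := S.phase_bound hd hρ hB m hφ hφ1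
    fun t ht => h.phase_le S hd hc hγ hρ hν hν1 hA hm ht
  refine ⟨fun j hj t ht => (h.w j hj t ht).trans (ENNReal.ofReal_le_ofReal ?_),
    fun j hj t ht => ?_, h.w_cont, fun j hj => ?_⟩
  · exact mul_le_mul_of_nonneg_right (by linarith) (ampl_nonneg hd j ht)
  · rcases Nat.lt_succ_iff_lt_or_eq.1 hj with hj | rfl
    · exact (h.φ j hj t ht).trans (ENNReal.ofReal_le_ofReal
        (mul_le_mul_of_nonneg_right (by linarith) (NFun_nonneg hd j ht)))
    · exact (h1 t ht).trans (ENNReal.ofReal_le_ofReal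
        (mul_le_mul_of_nonneg_right (by linarith) (NFun_nonneg hd j ht)))
  · rcases Nat.lt_succ_iff_lt_or_eq.1 hj with hj | rfl
    · exact h.φ_cont j hj
    · exact h2

theorem FamilyBound.succ_ampl (S : Scheme n p K Y llow κ μ C) (hd : IsDensity d)
    (hρ : 0 ≤ ρ) (hν : 0 ≤ ν) (hν1 : ν ≤ 1) (hA : 0 ≤ A)
    (hm : m ≤ p) (h : FamilyBound d K Y llow ρ ν A m (m + 1) wm φm)
    (hw : HasTimeDeriv (Ici 1) (wm (m + 1)) (amplRHS m wm φm))
    (hw0 : ∀ θ, Tendsto (fun t => wm (m + 1) t θ) atTop (𝓝 0)) :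
    FamilyBound d K Y llow ρ ν (A + C * A ^ 2 * (m + 1)) (m + 1) (m + 1) wm φm := by
  have hB : 0 ≤ C * A ^ 2 * (m + 1) :=
    mul_nonneg (mul_nonneg S.nonneg (by positivity)) (by positivity)
  obtain ⟨h1, h2⟩ := S.ampl_bound hd hρ hB m hw hw0
    fun t ht => h.ampl_le S hd hρ hν hν1 hA hm ht
  refine ⟨fun j hj t ht => ?_,
    fun j hj t ht => (h.φ j hj t ht).trans (ENNReal.ofReal_le_ofReal ?_),
    fun j hj => ?_, h.φ_cont⟩
  · rcases Nat.le_succ_iff.1 hj with hj | rfl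
    · exact (h.w j hj t ht).trans (ENNReal.ofReal_le_ofReal
        (mul_le_mul_of_nonneg_right (by linarith) (ampl_nonneg hd j ht)))
    · exact (h1 t ht).trans (ENNReal.ofReal_le_ofReal
        (mul_le_mul_of_nonneg_right (by linarith) (QFun_nonneg hd m ht)))
  · exact mul_le_mul_of_nonneg_right (by linarith) (NFun_nonneg hd j ht)
  · rcases Nat.le_succ_iff.1 hj with hj | rfl
    · exact h.w_cont j hj
    · exact h2

theorem familyBound_zero {a : ℝ} {wplus : TD n} (hw : ∀ t, 1 ≤ t → wm 0 t = wplus)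
    (ha : gevreyNorm ρ ν (K 0) 0 wplus ≤ ENNReal.ofReal a) :
    FamilyBound d K Y llow ρ ν a 0 0 wm φm := by
  refine ⟨fun j hj t ht => ?_, fun j hj => absurd hj (by omega), fun j hj => ?_,
    fun j hj => absurd hj (by omega)⟩
  · obtain rfl : j = 0 := by omega
    rw [hw t ht, ampl, mul_one]
    exact ha
  · obtain rfl : j = 0 := by omega
    exact normCont_const hw (ha.trans_lt ENNReal.ofReal_lt_top)

/-- A priori bounds for the asymptotic functions. -/
theorem Scheme.exists_familyBound (S : Scheme n p K Y llow κ μ C) (hd : IsDensity d) (hc : 0 ≤ c)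
    (hγ : ∀ t, 1 ≤ t → t ^ (-γ) ≤ c * d t) {a : ℝ} (ha : 0 ≤ a) :
    ∀ m ≤ p + 1, ∃ A : ℝ, 0 ≤ A ∧ ∀ ρ ν : ℝ, 0 ≤ ρ → 0 ≤ ν → ν ≤ 1 →
      ∀ (wplus : TD n) (wm φm : ℕ → ℝ → TD n), gevreyNorm ρ ν (K 0) 0 wplus ≤ ENNReal.ofReal a →
      PartialFamily κ μ γ m m wplus wm φm → FamilyBound d K Y llow ρ ν A m m wm φm := by
  intro m
  induction m with
  | zero => exact fun _ => ⟨a, ha, fun ρ ν _ _ _ wplus wm φm h hF => familyBound_zero hF.w_zero h⟩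
  | succ m ih =>
    intro hm
    obtain ⟨A, hA, h⟩ := ih (by omega)
    obtain ⟨B, hB'⟩ : ∃ B, B = A + 5 * (C * A ^ 2 * (m + 1) * (1 + 4 * c)) := ⟨_, rfl⟩
    have hB : 0 ≤ B := by
      have := S.nonneg
      rw [hB']
      positivity
    refine ⟨B + C * B ^ 2 * (m + 1), ?_, fun ρ ν hρ hν hν1 wplus wm φm hw hF => ?_⟩
    · have := S.nonneg
      positivity
    · have h1 := h ρ ν hρ hν hν1 wplus wm φm hw ⟨hF.w_zero, fun j hj => hF.eq_w j (by omega),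
        fun j hj => hF.w_infty j (by omega), fun j hj => hF.eq_φ j (by omega),
        fun j hj => hF.φ_one j (by omega)⟩
      have h2 := h1.succ_phase S hd hc hγ hρ hν hν1 hA (by omega) (hF.eq_φ m (by omega))
        (hF.φ_one m (by omega))
      rw [← hB'] at h2
      exact h2.succ_ampl S hd hρ hν hν1 hB (by omega) (hF.eq_w m (by omega))
        (hF.w_infty m (by omega))

theorem smul_sum_apply {n : ℕ} (z : ℂ) (s : Finset ℕ) (u : ℕ → TD n) (θ : 𝓢(Sp n, ℂ)) :
    (z • ∑ j ∈ s, u j) θ = z * ∑ j ∈ s, u j θ := by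
  simp

theorem continuousOn_inv_two_sq : ContinuousOn (fun t : ℝ => (2 * t ^ 2 : ℂ)⁻¹) (Ici 1) := by
  refine ContinuousOn.inv₀ (by fun_prop) fun t ht => ?_
  have : (t : ℂ) ≠ 0 := by
    exact_mod_cast (one_pos.trans_le (show (1 : ℝ) ≤ t from ht)).ne'
  exact mul_ne_zero two_ne_zero (pow_ne_zero 2 this)

theorem FamilyBound.exists_phase (S : Scheme n p K Y llow κ μ C) (hd : IsDensity d) (hc : 0 ≤ c)
    (hγ : ∀ t, 1 ≤ t → t ^ (-γ) ≤ c * d t) (hρ : 0 ≤ ρ) (hν : 0 ≤ ν) (hν1 : ν ≤ 1) (hA : 0 ≤ A)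
    (hm : m ≤ p + 1) (h : FamilyBound d K Y llow ρ ν A m m wm φm) :
    ∃ u : ℝ → TD n, u 1 = 0 ∧ HasTimeDeriv (Ici 1) u (phaseRHS κ μ γ m wm φm) := by
  have hB : 0 ≤ C * A ^ 2 * (m + 1) * (1 + 4 * c) := by
    have := S.nonneg
    positivity
  have hn := S.dim_pos
  refine exists_hasTimeDeriv hn hρ S.low_lt
    (B' := fun t => C * A ^ 2 * (m + 1) * (1 + 4 * c) * rate d m t)
    (continuousOn_const.mul (continuousOn_rate hd m))
    (fun t ht => mul_nonneg hB (rate_nonneg hd m ht))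
    (fun t ht => h.phase_le S hd hc hγ hρ hν hν1 hA hm ht) fun θ => ?_
  have e (t : ℝ) : phaseRHS κ μ γ m wm φm t θ =
      (2 * t ^ 2 : ℂ)⁻¹ * ∑ j ∈ Finset.range m, gradDot (φm j t) (φm (m - 1 - j) t) θ +
      ((t ^ (-γ) : ℝ) : ℂ) * ∑ j ∈ Finset.range (m + 1), g0 κ μ (wm j t) (wm (m - j) t) θ := by
    rw [← smul_sum_apply, ← smul_sum_apply]
    rfl
  simp_rw [e]
  refine (continuousOn_inv_two_sq.mul (continuousOn_finsetSum _ fun j hj => ?_)).add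
    (ContinuousOn.mul ?_ (continuousOn_finsetSum _ fun j hj => ?_))
  · have := Finset.mem_range.1 hj
    exact (S.gr j (m - 1 - j) (by omega)).continuousOn_apply hn S.low_lt hρ hν hν1
      (h.φ_cont j this) (h.φ_cont _ (by omega)) θ
  · refine Complex.continuous_ofReal.comp_continuousOn ?_
    exact ContinuousOn.rpow_const continuousOn_id fun t ht =>
      Or.inl (one_pos.trans_le (show (1 : ℝ) ≤ t from ht)).ne'
  · have := Finset.mem_range.1 hj
    exact (S.gz j (m - j) (by omega)).continuousOn_apply hn S.low_lt hρ hν hν1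
      (h.w_cont j (by omega)) (h.w_cont _ (by omega)) θ

/-- Integrate from 1, then subtract the limit at infinity. That limit exists because the increments
after time `s` are bounded by a multiple of `Q_m(s)`, which tends to 0. -/
theorem FamilyBound.exists_ampl (S : Scheme n p K Y llow κ μ C) (hd : IsDensity d)
    (hρ : 0 ≤ ρ) (hν : 0 ≤ ν) (hν1 : ν ≤ 1) (hA : 0 ≤ A)
    (hm : m ≤ p) (h : FamilyBound d K Y llow ρ ν A m (m + 1) wm φm) :
    ∃ u : ℝ → TD n, HasTimeDeriv (Ici 1) u (amplRHS m wm φm) ∧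
      ∀ θ, Tendsto (fun t => u t θ) atTop (𝓝 0) := by
  have hB : 0 ≤ C * A ^ 2 * (m + 1) := by
    have := S.nonneg
    positivity
  have hn := S.dim_pos
  have h0 : (0 : ℝ) < (n : ℝ) / 2 := by positivity
  have hle {t : ℝ} (ht : 1 ≤ t) := h.ampl_le S hd hρ hν hν1 hA hm ht
  have e (t : ℝ) (θ) : amplRHS m wm φm t θ = (2 * t ^ 2 : ℂ)⁻¹ *
      ∑ j ∈ Finset.range (m + 1), transport (φm j t) (wm (m - j) t) θ := smul_sum_apply _ _ _ _
  obtain ⟨u, -, hu⟩ := exists_hasTimeDeriv hn hρ h0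
    (B' := fun t => C * A ^ 2 * (m + 1) * ((t ^ 2)⁻¹ * NFun d m t))
    (continuousOn_const.mul (ContinuousOn.mul
      (ContinuousOn.inv₀ (by fun_prop) fun t ht =>
        pow_ne_zero 2 (one_pos.trans_le (show (1 : ℝ) ≤ t from ht)).ne')
      fun t _ => (hasDerivAt_NFun hd m t).continuousAt.continuousWithinAt))
    (fun t ht => mul_nonneg hB (mul_nonneg (by positivity) (NFun_nonneg hd m ht)))
    (fun t ht => hle ht) fun θ => by
      simp_rw [e]
      refine continuousOn_inv_two_sq.mul (continuousOn_finsetSum _ fun j hj => ?_)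
      have := Finset.mem_range.1 hj
      exact (S.tr (m - j) j (by omega)).continuousOn_apply hn h0 hρ hν hν1
        (h.φ_cont j this) (h.w_cont _ (by omega)) θ
  obtain ⟨v, hv, -⟩ := exists_limit_of_gevreyNorm (ν := ν) (hi := K (m + 1)) hn hρ h0 (t₀ := 1)
    (u := u) (b := fun t => C * A ^ 2 * (m + 1) * QFun d m t)
    (fun s hs => mul_nonneg hB (QFun_nonneg hd m hs))
    (by simpa using (tendsto_QFun hd m).const_mul (C * A ^ 2 * (m + 1)))
    (fun s t hs hst => (S.ampl_sub_le hd hρ hB m le_rfl hu (fun t ht => hle ht) hs hst).trans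
      (ENNReal.ofReal_le_ofReal (by
        have := mul_nonneg hB (QFun_nonneg hd m (hs.trans hst))
        linarith)))
  refine ⟨fun t => u t - v, fun t ht θ => (hu t ht θ).sub_const (v θ), fun θ => ?_⟩
  have := (hv θ).sub_const (v θ)
  rwa [sub_self] at this

/-- The system is triangular: `φ_m` uses earlier phases and amplitudes up to m, and `w_{m+1}` uses
phases and amplitudes up to m. Overwriting the entries `φ_m` and then `w_{m+1}` therefore leaves all
earlier equations intact. -/
theorem Scheme.exists_family (S : Scheme n p K Y llow κ μ C) (hd : IsDensity d) (hc : 0 ≤ c)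
    (hγ : ∀ t, 1 ≤ t → t ^ (-γ) ≤ c * d t) (hρ : 0 ≤ ρ) (hν : 0 ≤ ν) (hν1 : ν ≤ 1)
    {a : ℝ} (ha : 0 ≤ a) {wplus : TD n} (hw : gevreyNorm ρ ν (K 0) 0 wplus ≤ ENNReal.ofReal a) :
    ∀ m ≤ p + 1, ∃ wm φm : ℕ → ℝ → TD n, PartialFamily κ μ γ m m wplus wm φm := by
  intro m
  induction m with
  | zero =>
    refine fun _ => ⟨fun _ _ => wplus, fun _ _ => 0, fun _ _ => rfl, ?_, ?_, ?_, ?_⟩ <;>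
      exact fun j hj => absurd hj (by omega)
  | succ m ih =>
    intro hm
    obtain ⟨wm, φm, hF⟩ := ih (by omega)
    obtain ⟨A, hA, hb⟩ := S.exists_familyBound hd hc hγ ha m (by omega)
    have h1 := hb ρ ν hρ hν hν1 wplus wm φm hw hF
    obtain ⟨u, hu1, hu⟩ := h1.exists_phase S hd hc hγ hρ hν hν1 hA (by omega)
    set φm' := Function.update φm m u with hφm'
    have eφ (j : ℕ) (hj : j < m) : φm j = φm' j := (Function.update_of_ne hj.ne _ _).symm
    have eu : φm' m = u := Function.update_self _ _ _
    have h2 : FamilyBound d K Y llow ρ ν A m m wm φm' :=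
      ⟨h1.w, fun j hj => eφ j hj ▸ h1.φ j hj, h1.w_cont, fun j hj => eφ j hj ▸ h1.φ_cont j hj⟩
    have hB : 0 ≤ A + 5 * (C * A ^ 2 * (m + 1) * (1 + 4 * c)) := by
      have := S.nonneg
      positivity
    have h3 := h2.succ_phase S hd hc hγ hρ hν hν1 hA (by omega)
      (by rw [eu, ← phaseRHS_congr (fun _ _ => rfl) eφ]; exact hu) (by rw [eu]; exact hu1)
    obtain ⟨z, hz, hz0⟩ := h3.exists_ampl S hd hρ hν hν1 hB (by omega)
    set wm' := Function.update wm (m + 1) z with hwm'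
    have ew (j : ℕ) (hj : j ≤ m) : wm j = wm' j :=
      (Function.update_of_ne (by omega) _ _).symm
    have ez : wm' (m + 1) = z := Function.update_self _ _ _
    refine ⟨wm', φm', fun t ht => by rw [← ew 0 (by omega)]; exact hF.w_zero t ht, fun j hj => ?_,
      fun j hj => ?_, fun j hj => ?_, fun j hj => ?_⟩
    · rcases Nat.lt_succ_iff_lt_or_eq.1 hj with hj | rfl
      · rw [← ew (j + 1) hj, ← amplRHS_congr (fun i hi => ew i (by omega))
          (fun i hi => eφ i (by omega))]
        exact hF.eq_w j hj
      · rw [ez, ← amplRHS_congr ew fun _ _ => rfl]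
        exact hz
    · rcases Nat.lt_succ_iff_lt_or_eq.1 hj with hj | rfl
      · rw [← ew (j + 1) hj]
        exact hF.w_infty j hj
      · rw [ez]
        exact hz0
    · rcases Nat.lt_succ_iff_lt_or_eq.1 hj with hj | rfl
      · rw [← eφ j hj, ← phaseRHS_congr (fun i hi => ew i (by omega))
          (fun i hi => eφ i (by omega))]
        exact hF.eq_φ j hj
      · rw [eu, ← phaseRHS_congr ew eφ]
        exact hu
    · rcases Nat.lt_succ_iff_lt_or_eq.1 hj with hj | rfl
      · rw [← eφ j hj]
        exact hF.φ_one j hj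
      · rw [eu]
        exact hu1

end

/-! ### Remainders -/

/-- Expansion of a bilinear expression in terms of two series and their remainders. -/
theorem bilin_remainder {n : ℕ} (B : TD n → TD n → TD n) {X W ψ v : ℕ → TD n}
    (hψ : ∀ j, ψ (j + 1) = ψ j - X j) (hv : ∀ j, v (j + 1) = v j - W j) (m : ℕ)
    (hl : ∀ j < m, B (ψ j - X j) (v 0) = B (ψ j) (v 0) - B (X j) (v 0))
    (hr : ∀ i j, j + i < m → B (X j) (v i - W i) = B (X j) (v i) - B (X j) (W i)) :
    B (ψ 0) (v 0) - ∑ i ∈ Finset.range m, ∑ j ∈ Finset.range (i + 1), B (X j) (W (i - j)) =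
      ∑ j ∈ Finset.range (m + 1), B (if j < m then X j else ψ m) (v (m - j)) := by
  -- Passing from m to m+1 splits `ψ m` into `X m` and `ψ (m+1)`, while the subtracted sum of order
  -- m turns each `v (m-j)` into `v (m+1-j)`.
  have key : B (ψ 0) (v 0) -
      ∑ i ∈ Finset.range m, ∑ j ∈ Finset.range (i + 1), B (X j) (W (i - j)) =
      ∑ j ∈ Finset.range m, B (X j) (v (m - j)) + B (ψ m) (v 0) := by
    induction m with
    | zero => simp
    | succ m ih =>
      have ih := ih (fun j hj => hl j (by omega)) (fun i j h => hr i j (by omega))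
      rw [Finset.sum_range_succ _ m, ← sub_sub, ih, hψ m, hl m (by omega)]
      have e : ∑ j ∈ Finset.range (m + 1), B (X j) (v (m + 1 - j)) =
          ∑ j ∈ Finset.range (m + 1), B (X j) (v (m - j)) -
            ∑ j ∈ Finset.range (m + 1), B (X j) (W (m - j)) := by
        rw [← Finset.sum_sub_distrib]
        refine Finset.sum_congr rfl fun j hj => ?_
        have hj' := Finset.mem_range.1 hj
        rw [show m + 1 - j = m - j + 1 by omega, hv, hr (m - j) j (by omega)]
      rw [e, Finset.sum_range_succ (fun j => B (X j) (v (m - j))), Nat.sub_self]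
      abel
  rw [key, Finset.sum_range_succ, if_neg (lt_irrefl m), Nat.sub_self]
  congr 1
  refine Finset.sum_congr rfl fun j hj => ?_
  rw [if_pos (Finset.mem_range.1 hj)]

/-- The remainder `u - ∑_{j < m} u_j`. -/
def rem {n : ℕ} (u : ℝ → TD n) (um : ℕ → ℝ → TD n) (m : ℕ) (t : ℝ) : TD n :=
  u t - ∑ j ∈ Finset.range m, um j t

theorem rem_zero {n : ℕ} (u : ℝ → TD n) (um : ℕ → ℝ → TD n) (t : ℝ) : rem u um 0 t = u t := by
  simp [rem]

theorem rem_succ {n : ℕ} (u : ℝ → TD n) (um : ℕ → ℝ → TD n) (m : ℕ) (t : ℝ) :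
    rem u um (m + 1) t = rem u um m t - um m t := by
  rw [rem, rem, Finset.sum_range_succ, sub_add_eq_sub_sub]

/-- A solution of the auxiliary system together with its asymptotic functions and their bounds. -/
structure SolutionData {n : ℕ} (d : ℝ → ℝ) (K Y : ℕ → ℝ) (llow κ μ γ T k a A ρ ν : ℝ) (p : ℕ)
    (wplus : TD n) (w φ : ℝ → TD n) (wm φm : ℕ → ℝ → TD n) : Prop where
  aux : IsAuxSolution κ μ γ (Ici T) w φ
  w_le : ∀ t, T ≤ t → gevreyNorm ρ ν k 0 (w t) ≤ ENNReal.ofReal a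
  w_lim : ∀ θ, Tendsto (fun t => w t θ) atTop (𝓝 (wplus θ))
  fam : PartialFamily κ μ γ (p + 1) (p + 1) wplus wm φm
  bd : FamilyBound d K Y llow ρ ν A (p + 1) (p + 1) wm φm

/-- Bounds on the remainders of order at most `a` for `w`, and at most `b` for `φ`. -/
structure RemBound {n : ℕ} (d : ℝ → ℝ) (K Y : ℕ → ℝ) (llow T ρ ν A : ℝ) (a b : ℕ)
    (w φ : ℝ → TD n) (wm φm : ℕ → ℝ → TD n) : Prop where
  w : ∀ j ≤ a, ∀ t, T ≤ t → gevreyNorm ρ ν (K j) 0 (rem w wm j t) ≤ ENNReal.ofReal (A * ampl d j t)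
  φ : ∀ j ≤ b, ∀ t, T ≤ t →
    gevreyNorm ρ ν (Y j) llow (rem φ φm j t) ≤ ENNReal.ofReal (A * NFun d j t)

section

variable {n p : ℕ} {K Y : ℕ → ℝ} {llow κ μ C : ℝ} {d : ℝ → ℝ} {γ c T k a A B ρ ν : ℝ}
  {wplus : TD n} {w φ : ℝ → TD n} {wm φm : ℕ → ℝ → TD n} {m : ℕ}

theorem RemBound.mono (hd : IsDensity d) (hT : 1 ≤ T) {a b : ℕ}
    (h : RemBound d K Y llow T ρ ν A a b w φ wm φm) (hAB : A ≤ B) :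
    RemBound d K Y llow T ρ ν B a b w φ wm φm :=
  ⟨fun j hj t ht => (h.w j hj t ht).trans (ENNReal.ofReal_le_ofReal
      (mul_le_mul_of_nonneg_right hAB (ampl_nonneg hd j (hT.trans ht)))),
    fun j hj t ht => (h.φ j hj t ht).trans (ENNReal.ofReal_le_ofReal
      (mul_le_mul_of_nonneg_right hAB (NFun_nonneg hd j (hT.trans ht))))⟩

theorem FamilyBound.mono (hd : IsDensity d) {a b : ℕ}
    (h : FamilyBound d K Y llow ρ ν A a b wm φm) (hAB : A ≤ B) :
    FamilyBound d K Y llow ρ ν B a b wm φm :=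
  ⟨fun j hj t ht => (h.w j hj t ht).trans (ENNReal.ofReal_le_ofReal
      (mul_le_mul_of_nonneg_right hAB (ampl_nonneg hd j ht))),
    fun j hj t ht => (h.φ j hj t ht).trans (ENNReal.ofReal_le_ofReal
      (mul_le_mul_of_nonneg_right hAB (NFun_nonneg hd j ht))), h.w_cont, h.φ_cont⟩

/-- The Laplacian costs two derivatives, whence `K (m + 1) ≤ k - 2`. Its contribution `a t⁻²` has no
growing factor, but `N_m(t) ≥ N_m(T) > 0` lets it be absorbed with constant `a / N_m(T)`. -/
theorem Scheme.aux_ampl_le (S : Scheme n p K Y llow κ μ C) (hd : IsDensity d)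
    (hpos : ∀ t, 0 < d t) (hT : 1 < T) (ha : 0 ≤ a)
    (hρ : 0 ≤ ρ) (hν : 0 ≤ ν) (hν1 : ν ≤ 1) (hA : 0 ≤ A) (hm : m ≤ p) (hK : K (m + 1) ≤ k - 2)
    {t : ℝ} (ht : T ≤ t) {u : TD n} {x y : ℕ → TD n}
    (hu : gevreyNorm ρ ν k 0 u ≤ ENNReal.ofReal a)
    (hx : ∀ j ≤ m, gevreyNorm ρ ν (Y j) llow (x j) ≤ ENNReal.ofReal (A * NFun d j t))
    (hy : ∀ j ≤ m, gevreyNorm ρ ν (K j) 0 (y j) ≤ ENNReal.ofReal (A * ampl d j t)) :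
    gevreyNorm ρ ν (K (m + 1)) 0 ((Complex.I * (2 * t ^ 2 : ℂ)⁻¹) • Δ u +
      (2 * t ^ 2 : ℂ)⁻¹ • ∑ j ∈ Finset.range (m + 1), transport (x j) (y (m - j))) ≤
      ENNReal.ofReal ((a / NFun d m T + C * A ^ 2 * (m + 1)) * ((t ^ 2)⁻¹ * NFun d m t)) := by
  have ht1 : 1 ≤ t := hT.le.trans ht
  have hNT := NFun_pos hd hpos m hT
  have hN := NFun_monotone hd m hT.le ht
  have hC := S.nonneg
  have h1 : gevreyNorm ρ ν (K (m + 1)) 0 (Δ u) ≤ ENNReal.ofReal a := by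
    refine (gevreyNorm_mono ρ ν 0 hK _).trans ((gevreyNorm_mono_low S.dim_pos ρ ν (k - 2)
      (show (0 : ℝ) - 2 ≤ 0 by norm_num) _).trans ?_)
    exact ((bddLin_laplacian S.dim_pos k 0).bound ρ ν hρ u (hu.trans_lt ENNReal.ofReal_lt_top)).trans hu
  have h2 := gevreyNorm_smul_le_ofReal (r := (2 * t ^ 2)⁻¹) (c := Complex.I * (2 * t ^ 2 : ℂ)⁻¹)
    (by rw [norm_mul, Complex.norm_I, one_mul, norm_inv_two_sq]) h1
  refine (gevreyNorm_add_le_ofReal (by positivity) ?_ h2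
    (S.transport_le hd hρ hν hν1 hA hm ht1 hx hy)).trans (ENNReal.ofReal_le_ofReal ?_)
  · have := NFun_nonneg hd m ht1
    positivity
  · rw [add_mul]
    refine add_le_add ?_ le_rfl
    have h3 : a ≤ a / NFun d m T * NFun d m t := by
      rw [div_mul_eq_mul_div, le_div_iff₀ hNT]
      gcongr
    have h4 : (2 * t ^ 2)⁻¹ ≤ (t ^ 2)⁻¹ := by
      have : 0 < t ^ 2 := by positivity
      exact inv_anti₀ this (by linarith)
    calc (2 * t ^ 2)⁻¹ * a ≤ (t ^ 2)⁻¹ * (a / NFun d m T * NFun d m t) := by gcongr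
      _ = _ := by ring

/-- The term `w_0` is constant, so only `w_1, …, w_m` contribute, and their sources are the
convolution sums of orders 0 to m-1. -/
theorem SolutionData.hasTimeDeriv_rem_ampl
    (D : SolutionData d K Y llow κ μ γ T k a A ρ ν p wplus w φ wm φm) (hT : 1 ≤ T) (hm : m ≤ p) :
    HasTimeDeriv (Ici T) (rem w wm (m + 1)) fun t =>
      (Complex.I * (2 * t ^ 2 : ℂ)⁻¹) • Δ (w t) + (2 * t ^ 2 : ℂ)⁻¹ • (transport (φ t) (w t) -
        ∑ i ∈ Finset.range m, ∑ j ∈ Finset.range (i + 1), transport (φm j t) (wm (i - j) t)) := by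
  have hsub : Ici T ⊆ Ici 1 := Ici_subset_Ici.2 hT
  have h1 := D.aux.eq_w.sub ((HasTimeDeriv.sum (Finset.range m) (u := fun j => wm (j + 1))
    fun j hj => D.fam.eq_w j (by have := Finset.mem_range.1 hj; omega)).mono hsub)
  intro t ht θ
  have h2 := (h1 t ht θ).sub_const (wplus θ)
  have e (s : ℝ) (hs : s ∈ Ici T) : rem w wm (m + 1) s θ =
      (w s - ∑ j ∈ Finset.range m, wm (j + 1) s) θ - wplus θ := by
    rw [rem, Finset.sum_range_succ', D.fam.w_zero s (hsub hs), sub_add_eq_sub_sub]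
    rfl
  refine (h2.congr e (e t ht)).congr_deriv ?_
  simp only [amplRHS]
  rw [smul_sub, Finset.smul_sum, add_sub_assoc]

/-- The phase `φ_0` has no gradient source. Removing `φ_0, …, φ_m` thus subtracts m gradient sums
but m+1 sums of `g0`, which is why the two expansions are later used at different orders. -/
theorem SolutionData.hasTimeDeriv_rem_phase
    (D : SolutionData d K Y llow κ μ γ T k a A ρ ν p wplus w φ wm φm) (hT : 1 ≤ T) (hm : m ≤ p) :
    HasTimeDeriv (Ici T) (rem φ φm (m + 1)) fun t =>
      (2 * t ^ 2 : ℂ)⁻¹ • (gradDot (φ t) (φ t) -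
        ∑ i ∈ Finset.range m, ∑ j ∈ Finset.range (i + 1), gradDot (φm j t) (φm (i - j) t)) +
      ((t ^ (-γ) : ℝ) : ℂ) • (g0 κ μ (w t) (w t) - ∑ i ∈ Finset.range (m + 1),
        ∑ j ∈ Finset.range (i + 1), g0 κ μ (wm j t) (wm (i - j) t)) := by
  have hsub : Ici T ⊆ Ici 1 := Ici_subset_Ici.2 hT
  have h1 := D.aux.eq_φ.sub ((HasTimeDeriv.sum (Finset.range (m + 1)) (u := fun j => φm j)
    fun j hj => D.fam.eq_φ j (by have := Finset.mem_range.1 hj; omega)).mono hsub)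
  refine h1.congr_deriv fun t ht => ?_
  simp only [phaseRHS]
  rw [smul_sub, smul_sub, Finset.sum_add_distrib, Finset.smul_sum, Finset.smul_sum,
    Finset.sum_range_succ' _ m]
  have e0 : (2 * t ^ 2 : ℂ)⁻¹ • (∑ j ∈ Finset.range 0, gradDot (φm j t) (φm (0 - 1 - j) t)) = 0 := by
    ext θ
    simp
  rw [e0, add_zero]
  simp only [Nat.add_sub_cancel]
  abel

theorem SolutionData.tendsto_rem
    (D : SolutionData d K Y llow κ μ γ T k a A ρ ν p wplus w φ wm φm) (hm : m ≤ p) (θ) :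
    Tendsto (fun t => rem w wm (m + 1) t θ) atTop (𝓝 0) := by
  have h1 : Tendsto (fun t => w t θ - (∑ j ∈ Finset.range m, wm (j + 1) t θ + wplus θ)) atTop
      (𝓝 (wplus θ - (∑ j ∈ Finset.range m, 0 + wplus θ))) :=
    (D.w_lim θ).sub ((tendsto_finsetSum _ fun j hj => D.fam.w_infty j
      (by have := Finset.mem_range.1 hj; omega) θ).add_const _)
  rw [Finset.sum_const_zero, zero_add, sub_self] at h1
  refine h1.congr' ?_
  filter_upwards [eventually_ge_atTop 1] with t ht
  rw [rem, Finset.sum_range_succ', D.fam.w_zero t ht]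
  simp

theorem RemBound.lt_top_w {a b : ℕ} (h : RemBound d K Y llow T ρ ν A a b w φ wm φm) {j : ℕ}
    (hj : j ≤ a) {t : ℝ} (ht : T ≤ t) : gevreyNorm ρ ν (K j) 0 (rem w wm j t) < ⊤ :=
  (h.w j hj t ht).trans_lt ENNReal.ofReal_lt_top

theorem RemBound.lt_top_φ {a b : ℕ} (h : RemBound d K Y llow T ρ ν A a b w φ wm φm) {j : ℕ}
    (hj : j ≤ b) {t : ℝ} (ht : T ≤ t) : gevreyNorm ρ ν (Y j) llow (rem φ φm j t) < ⊤ :=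
  (h.φ j hj t ht).trans_lt ENNReal.ofReal_lt_top

/-- By `bilin_remainder` the source is a transport sum of order m in which `φ_m` is replaced by the
phase remainder of order m and every amplitude by a remainder. All these factors are already
bounded, and integration from infinity gives the next order. -/
theorem SolutionData.succ_ampl (S : Scheme n p K Y llow κ μ C) (hd : IsDensity d)
    (hpos : ∀ t, 0 < d t) (hT : 1 < T) (ha : 0 ≤ a)
    (hρ : 0 ≤ ρ) (hν : 0 ≤ ν) (hν1 : ν ≤ 1) (hA : 0 ≤ A) (hm : m ≤ p) (hK : K (m + 1) ≤ k - 2)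
    (D : SolutionData d K Y llow κ μ γ T k a A ρ ν p wplus w φ wm φm)
    (h : RemBound d K Y llow T ρ ν A m m w φ wm φm) :
    RemBound d K Y llow T ρ ν (A + (a / NFun d m T + C * A ^ 2 * (m + 1))) (m + 1) m w φ wm φm := by
  have hC := S.nonneg
  have hNT := NFun_pos hd hpos m hT
  have hB : 0 ≤ a / NFun d m T + C * A ^ 2 * (m + 1) := by positivity
  have hd1 : HasTimeDeriv (Ici T) (rem w wm (m + 1)) fun t =>
      (Complex.I * (2 * t ^ 2 : ℂ)⁻¹) • Δ (w t) + (2 * t ^ 2 : ℂ)⁻¹ •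
        ∑ j ∈ Finset.range (m + 1),
          transport (if j < m then φm j t else rem φ φm m t) (rem w wm (m - j) t) := by
    refine (D.hasTimeDeriv_rem_ampl hT.le hm).congr_deriv fun t ht => ?_
    have ht1 : 1 ≤ t := hT.le.trans ht
    have := bilin_remainder transport (X := fun j => φm j t) (W := fun j => wm j t)
      (ψ := fun j => rem φ φm j t) (v := fun j => rem w wm j t) (fun j => rem_succ φ φm j t)
      (fun j => rem_succ w wm j t) m
      (fun j hj => (S.tr 0 j (by omega)).sub_left ρ ν hρ hν hν1 _ _ _ (h.lt_top_φ hj.le ht)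
        ((D.bd.φ_cont j (by omega)).lt_top t ht1) (h.lt_top_w (by omega) ht))
      (fun i j hij => (S.tr i j (by omega)).sub_right ρ ν hρ hν hν1 _ _ _
        ((D.bd.φ_cont j (by omega)).lt_top t ht1) (h.lt_top_w (by omega) ht)
        ((D.bd.w_cont i (by omega)).lt_top t ht1))
    rw [← this, rem_zero, rem_zero]
  have h1 (s : ℝ) (hs : T ≤ s) : gevreyNorm ρ ν (K (m + 1)) 0 (rem w wm (m + 1) s) ≤
      ENNReal.ofReal ((a / NFun d m T + C * A ^ 2 * (m + 1)) * QFun d m s) := by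
    refine S.ampl_bound_of_tendsto hd hρ hB m hT.le hd1 (D.tendsto_rem hm) (fun t ht => ?_) hs
    refine S.aux_ampl_le hd hpos hT ha hρ hν hν1 hA hm hK ht
      (x := fun j => if j < m then φm j t else rem φ φm m t) (y := fun j => rem w wm j t)
      (D.w_le t ht) (fun j hj => ?_) (fun j hj => h.w j hj t ht)
    split_ifs with hjm
    · exact D.bd.φ j (by omega) t (hT.le.trans ht)
    · obtain rfl : j = m := by omega
      exact h.φ j le_rfl t ht
  have h' := h.mono hd hT.le (show A ≤ A + (a / NFun d m T + C * A ^ 2 * (m + 1)) by linarith)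
  refine ⟨fun j hj t ht => ?_, h'.φ⟩
  rcases Nat.le_succ_iff.1 hj with hj | rfl
  · exact h'.w j hj t ht
  · exact (h1 t ht).trans (ENNReal.ofReal_le_ofReal
      (mul_le_mul_of_nonneg_right (by linarith) (QFun_nonneg hd m (hT.le.trans ht))))

/-- The amplitude remainder of order m+1 enters through `g0`, so it must be bounded first.
Increments are kept because they serve twice: starting at `T` for the bound by `N_{m+1}`, and near
infinity for the limit of the phase. -/
theorem SolutionData.rem_phase_sub_le (S : Scheme n p K Y llow κ μ C) (hd : IsDensity d)
    (hc : 0 ≤ c) (hγ : ∀ t, 1 ≤ t → t ^ (-γ) ≤ c * d t) (hT : 1 ≤ T)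
    (hρ : 0 ≤ ρ) (hν : 0 ≤ ν) (hν1 : ν ≤ 1) (hA : 0 ≤ A) (hm : m ≤ p)
    (D : SolutionData d K Y llow κ μ γ T k a A ρ ν p wplus w φ wm φm)
    (h : RemBound d K Y llow T ρ ν A (m + 1) m w φ wm φm) {s t : ℝ} (hs : T ≤ s) (hst : s ≤ t) :
    gevreyNorm ρ ν (Y (m + 1)) llow (rem φ φm (m + 1) t - rem φ φm (m + 1) s) ≤
      ENNReal.ofReal (C * A ^ 2 * ((m + 1 : ℕ) + 1) * (1 + 4 * c) * phaseBound d m t -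
        C * A ^ 2 * ((m + 1 : ℕ) + 1) * (1 + 4 * c) * phaseBound d m s) := by
  have hC := S.nonneg
  have hd1 : HasTimeDeriv (Ici T) (rem φ φm (m + 1)) fun t =>
      (2 * t ^ 2 : ℂ)⁻¹ • ∑ j ∈ Finset.range (m + 1),
        gradDot (if j < m then φm j t else rem φ φm m t) (rem φ φm (m + 1 - 1 - j) t) +
      ((t ^ (-γ) : ℝ) : ℂ) • ∑ j ∈ Finset.range (m + 1 + 1),
        g0 κ μ (if j < m + 1 then wm j t else rem w wm (m + 1) t) (rem w wm (m + 1 - j) t) := by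
    refine (D.hasTimeDeriv_rem_phase hT hm).congr_deriv fun t ht => ?_
    have ht1 : 1 ≤ t := hT.trans ht
    have e1 := bilin_remainder gradDot (X := fun j => φm j t) (W := fun j => φm j t)
      (ψ := fun j => rem φ φm j t) (v := fun j => rem φ φm j t) (fun j => rem_succ φ φm j t)
      (fun j => rem_succ φ φm j t) m
      (fun j hj => (S.gr j 0 (by omega)).sub_left ρ ν hρ hν hν1 _ _ _ (h.lt_top_φ hj.le ht)
        ((D.bd.φ_cont j (by omega)).lt_top t ht1) (h.lt_top_φ (by omega) ht))
      (fun i j hij => (S.gr j i (by omega)).sub_right ρ ν hρ hν hν1 _ _ _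
        ((D.bd.φ_cont j (by omega)).lt_top t ht1) (h.lt_top_φ (by omega) ht)
        ((D.bd.φ_cont i (by omega)).lt_top t ht1))
    have e2 := bilin_remainder (g0 κ μ) (X := fun j => wm j t) (W := fun j => wm j t)
      (ψ := fun j => rem w wm j t) (v := fun j => rem w wm j t) (fun j => rem_succ w wm j t)
      (fun j => rem_succ w wm j t) (m + 1)
      (fun j hj => (S.gz j 0 (by omega)).sub_left ρ ν hρ hν hν1 _ _ _ (h.lt_top_w hj.le ht)
        ((D.bd.w_cont j (by omega)).lt_top t ht1) (h.lt_top_w (by omega) ht))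
      (fun i j hij => (S.gz j i (by omega)).sub_right ρ ν hρ hν hν1 _ _ _
        ((D.bd.w_cont j (by omega)).lt_top t ht1) (h.lt_top_w (by omega) ht)
        ((D.bd.w_cont i (by omega)).lt_top t ht1))
    simp only [Nat.add_sub_cancel]
    rw [← e1, ← e2, rem_zero, rem_zero]
  refine S.phase_sub_le hd hρ (mul_nonneg (mul_nonneg (mul_nonneg S.nonneg (by positivity))
    (by positivity)) (by positivity)) (m + 1) hT hd1 (fun t ht => ?_) hs hst
  have ht1 : 1 ≤ t := hT.trans ht
  refine S.phase_le hd hc hρ hν hν1 hA (by omega) ht1 (hγ t ht1)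
    (x := fun j => if j < m then φm j t else rem φ φm m t) (y := fun j => rem φ φm j t)
    (x' := fun j => if j < m + 1 then wm j t else rem w wm (m + 1) t)
    (y' := fun j => rem w wm j t) (fun j hj => ?_) (fun j hj => h.φ j (by omega) t ht)
    (fun j hj => ?_) (fun j hj => h.w j hj t ht)
  · split_ifs with hjm
    · exact D.bd.φ j (by omega) t ht1
    · obtain rfl : j = m := by omega
      exact h.φ j le_rfl t ht
  · split_ifs with hjm
    · exact D.bd.w j (by omega) t ht1
    · obtain rfl : j = m + 1 := by omega
      exact h.w _ le_rfl t ht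

/-- Unlike the corrections, the remainder does not vanish initially. Its value at `T` is controlled
by the preceding order, and since `N_{m+1}(T) > 0` that constant is absorbed in `N_{m+1}(t)`. -/
theorem SolutionData.succ_phase (S : Scheme n p K Y llow κ μ C) (hd : IsDensity d)
    (hpos : ∀ t, 0 < d t) (hc : 0 ≤ c) (hγ : ∀ t, 1 ≤ t → t ^ (-γ) ≤ c * d t) (hT : 1 < T)
    (hρ : 0 ≤ ρ) (hν : 0 ≤ ν) (hν1 : ν ≤ 1) (hA : 0 ≤ A) (hm : m ≤ p) (hY : Y (m + 1) ≤ Y m)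
    (D : SolutionData d K Y llow κ μ γ T k a A ρ ν p wplus w φ wm φm)
    (h : RemBound d K Y llow T ρ ν A (m + 1) m w φ wm φm) :
    RemBound d K Y llow T ρ ν (A + (5 * (C * A ^ 2 * ((m + 1 : ℕ) + 1) * (1 + 4 * c)) +
      2 * (A * NFun d m T) / NFun d (m + 1) T)) (m + 1) (m + 1) w φ wm φm := by
  have hC := S.nonneg
  set E := C * A ^ 2 * ((m + 1 : ℕ) + 1) * (1 + 4 * c) with hE
  have hE0 : 0 ≤ E := by positivity
  have hNT := NFun_pos hd hpos (m + 1) hT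
  have hNT' := NFun_nonneg hd m hT.le
  have hB : 0 ≤ 5 * E + 2 * (A * NFun d m T) / NFun d (m + 1) T := by positivity
  have h' := h.mono hd hT.le
    (show A ≤ A + (5 * E + 2 * (A * NFun d m T) / NFun d (m + 1) T) by linarith)
  refine ⟨h'.w, fun j hj t ht => ?_⟩
  rcases Nat.le_succ_iff.1 hj with hj | rfl
  · exact h'.φ j hj t ht
  have ht1 := hT.le.trans ht
  have h1 := D.rem_phase_sub_le S hd hc hγ hT.le hρ hν hν1 hA hm h le_rfl ht
  have h2 : gevreyNorm ρ ν (Y (m + 1)) llow (rem φ φm (m + 1) T) ≤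
      ENNReal.ofReal (2 * (A * NFun d m T)) := by
    rw [rem_succ, two_mul, ENNReal.ofReal_add (by positivity) (by positivity)]
    refine (gevreyNorm_mono _ _ _ hY _).trans ((gevreyNorm_sub_le _ _ _ _ _ _).trans ?_)
    exact add_le_add (h.φ m le_rfl T le_rfl) (D.bd.φ m (by omega) T hT.le)
  have e : rem φ φm (m + 1) t =
      rem φ φm (m + 1) t - rem φ φm (m + 1) T + rem φ φm (m + 1) T := by abel
  have hmono := phaseBound_monotone hd m hT.le ht
  have hp0 := phaseBound_monotone hd m le_rfl hT.le
  rw [phaseBound_one] at hp0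
  rw [e]
  refine (gevreyNorm_add_le_ofReal ?_ (by positivity) h1 h2).trans (ENNReal.ofReal_le_ofReal ?_)
  · rw [← mul_sub]
    exact mul_nonneg hE0 (by linarith)
  · have h3 : E * phaseBound d m t ≤ E * (5 * NFun d (m + 1) t) :=
      mul_le_mul_of_nonneg_left (phaseBound_le hd m ht1) hE0
    have h4 := mul_nonneg hE0 hp0
    have h5 : 2 * (A * NFun d m T) ≤
        2 * (A * NFun d m T) / NFun d (m + 1) T * NFun d (m + 1) t := by
      rw [div_mul_eq_mul_div, le_div_iff₀ hNT]
      have := NFun_monotone hd (m + 1) hT.le ht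
      gcongr
    have h6 := mul_nonneg hA (NFun_nonneg hd (m + 1) ht1)
    linarith

/-- Uniform bounds on the remainders. -/
theorem Scheme.exists_remBound (S : Scheme n p K Y llow κ μ C) (hd : IsDensity d)
    (hpos : ∀ t, 0 < d t) (hc : 0 ≤ c) (hγ : ∀ t, 1 ≤ t → t ^ (-γ) ≤ c * d t) (hT : 1 < T)
    (hK : ∀ m ≤ p, K (m + 1) ≤ k - 2) (hY : ∀ m ≤ p, Y (m + 1) ≤ Y m) (ha : 0 ≤ a) (hA : 0 ≤ A) :
    ∀ m ≤ p + 1, ∃ B : ℝ, A ≤ B ∧ ∀ ρ ν : ℝ, 0 ≤ ρ → 0 ≤ ν → ν ≤ 1 →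
      ∀ (wplus : TD n) (w φ : ℝ → TD n) (wm φm : ℕ → ℝ → TD n),
      SolutionData d K Y llow κ μ γ T k a A ρ ν p wplus w φ wm φm →
      RemBound d K Y llow T ρ ν A 0 0 w φ wm φm →
      RemBound d K Y llow T ρ ν B m m w φ wm φm ∧ ∀ j < m, ∀ s t, T ≤ s → s ≤ t →
        gevreyNorm ρ ν (Y (j + 1)) llow (rem φ φm (j + 1) t - rem φ φm (j + 1) s) ≤
          ENNReal.ofReal (B * (phaseBound d j t - phaseBound d j s)) := by
  intro m
  induction m with
  | zero =>
    exact fun _ => ⟨A, le_rfl, fun ρ ν _ _ _ wplus w φ wm φm _ h =>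
      ⟨h, fun j hj => absurd hj (by omega)⟩⟩
  | succ m ih =>
    intro hm
    obtain ⟨B, hAB, hB⟩ := ih (by omega)
    have hC := S.nonneg
    have hB0 : 0 ≤ B := hA.trans hAB
    have hNT := NFun_pos hd hpos m hT
    have hNT' := NFun_pos hd hpos (m + 1) hT
    -- The new constants for the amplitude and then the phase are fixed before `ρ`, `ν` and the
    -- solution are introduced, which is the required uniformity.
    obtain ⟨B₁, hB₁⟩ : ∃ B₁, B₁ = B + (a / NFun d m T + C * B ^ 2 * (m + 1)) := ⟨_, rfl⟩
    have hBB₁ : B ≤ B₁ := by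
      rw [hB₁]
      exact le_add_of_nonneg_right (by positivity)
    have hB₁0 : 0 ≤ B₁ := hB0.trans hBB₁
    obtain ⟨E, hE⟩ : ∃ E, E = C * B₁ ^ 2 * ((m + 1 : ℕ) + 1) * (1 + 4 * c) := ⟨_, rfl⟩
    have hE0 : 0 ≤ E := by
      rw [hE]
      positivity
    have hq : 0 ≤ 2 * (B₁ * NFun d m T) / NFun d (m + 1) T := by positivity
    refine ⟨B₁ + (5 * E + 2 * (B₁ * NFun d m T) / NFun d (m + 1) T), by linarith,
      fun ρ ν hρ hν hν1 wplus w φ wm φm D h => ?_⟩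
    obtain ⟨h1, h2⟩ := hB ρ ν hρ hν hν1 wplus w φ wm φm D h
    have D₁ : SolutionData d K Y llow κ μ γ T k a B ρ ν p wplus w φ wm φm :=
      ⟨D.aux, D.w_le, D.w_lim, D.fam, D.bd.mono hd hAB⟩
    have D₂ : SolutionData d K Y llow κ μ γ T k a B₁ ρ ν p wplus w φ wm φm :=
      ⟨D.aux, D.w_le, D.w_lim, D.fam, D₁.bd.mono hd hBB₁⟩
    have h3 := D₁.succ_ampl S hd hpos hT ha hρ hν hν1 hB0 (by omega) (hK m (by omega)) h1
    rw [← hB₁] at h3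
    have h4 := D₂.succ_phase S hd hpos hc hγ hT hρ hν hν1 hB₁0 (by omega) (hY m (by omega)) h3
    rw [← hE] at h4
    refine ⟨h4, fun j hj s t hs hst => ?_⟩
    have hmono := sub_nonneg.2 (phaseBound_monotone hd j (hT.le.trans hs) hst)
    rcases Nat.lt_succ_iff_lt_or_eq.1 hj with hj | rfl
    · exact (h2 j hj s t hs hst).trans (ENNReal.ofReal_le_ofReal
        (mul_le_mul_of_nonneg_right (by linarith) hmono))
    · have h5 := D₂.rem_phase_sub_le S hd hc hγ hT.le hρ hν hν1 hB₁0 (by omega) h3 hs hst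
      rw [← hE, ← mul_sub] at h5
      exact h5.trans (ENNReal.ofReal_le_ofReal
        (mul_le_mul_of_nonneg_right (by linarith) hmono))

end

/-! ### Asymptotics of solutions -/

section

variable {n p : ℕ} {K Y : ℕ → ℝ} {llow κ μ C : ℝ} {d : ℝ → ℝ} {γ c T k a b ρ ν : ℝ}
  {w φ : ℝ → TD n}

theorem tendsto_gevreyNorm_zero {hi lo E : ℝ} {q : ℝ → ℝ} {u : ℝ → TD n}
    (hq : Tendsto q atTop (𝓝 0))
    (hu : ∀ t, T ≤ t → gevreyNorm ρ ν hi lo (u t) ≤ ENNReal.ofReal (E * q t)) :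
    Tendsto (fun t => gevreyNorm ρ ν hi lo (u t)) atTop (𝓝 0) := by
  have h1 := ENNReal.tendsto_ofReal (hq.const_mul E)
  rw [mul_zero, ENNReal.ofReal_zero] at h1
  refine tendsto_of_tendsto_of_tendsto_of_le_of_le' tendsto_const_nhds h1
    (Eventually.of_forall fun _ => zero_le) ?_
  filter_upwards [eventually_ge_atTop T] with t ht using hu t ht

/-- Convergence in a weaker norm and boundedness imply convergence in intermediate norms. -/
theorem tendsto_gevreyNorm_of_interpolation {k₁ k' : ℝ} (hk : k' < k) (ha : 0 ≤ a) {u : ℝ → TD n}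
    (hb : ∀ t, T ≤ t → gevreyNorm ρ ν k 0 (u t) ≤ ENNReal.ofReal a)
    (hu : Tendsto (fun t => gevreyNorm ρ ν k₁ 0 (u t)) atTop (𝓝 0)) :
    Tendsto (fun t => gevreyNorm ρ ν k' 0 (u t)) atTop (𝓝 0) := by
  rw [ENNReal.tendsto_nhds_zero]
  intro ε hε
  obtain ⟨δ, hδ0, hδ⟩ := ENNReal.lt_iff_exists_nnreal_btwn.1 hε
  have hδ0' : (0 : ℝ) < δ := by exact_mod_cast hδ0
  obtain ⟨M, hM, h⟩ := exists_gevreyNorm_interpolation hk k₁ (ε := δ / (2 * (a + 1)))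
    (by positivity)
  have h1 := ENNReal.Tendsto.const_mul (a := ENNReal.ofReal M) hu (Or.inr ENNReal.ofReal_ne_top)
  rw [mul_zero] at h1
  have h2 := (ENNReal.tendsto_nhds_zero.1 h1) (ENNReal.ofReal (δ / 2))
    (ENNReal.ofReal_pos.2 (by positivity))
  filter_upwards [h2, eventually_ge_atTop T] with t ht1 ht2
  refine ((h n ρ ν (u t)).trans (add_le_add (mul_le_mul_right (hb t ht2) _) ht1)).trans ?_
  rw [← ENNReal.ofReal_mul (by positivity), ← ENNReal.ofReal_add (by positivity) (by positivity)]
  refine le_trans ?_ hδ.le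
  rw [← ENNReal.ofReal_coe_nnreal]
  refine ENNReal.ofReal_le_ofReal ?_
  have : (δ : ℝ) / (2 * (a + 1)) * a ≤ δ / 2 := by
    rw [div_mul_eq_mul_div, div_le_div_iff₀ (by positivity) (by positivity)]
    nlinarith
  linarith

/-- The time derivative of `w` is `O(t⁻² N_0)` in the weak norm of index 1, so `w(t)` is Cauchy
there with rate `Q_0 → 0`. Lower semicontinuity puts the limit in the strong space, and
interpolation gives convergence in every `k' < k`. -/
theorem Scheme.exists_asymptoticState (S : Scheme n p K Y llow κ μ C) (hd : IsDensity d)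
    (hpos : ∀ t, 0 < d t) (hT : 1 < T) (hK : K 1 ≤ k - 2) (hK0 : K 0 ≤ k) (ha : 0 ≤ a)
    (hb : 0 ≤ b) (hρ : 0 ≤ ρ) (hν : 0 ≤ ν) (hν1 : ν ≤ 1) (haux : IsAuxSolution κ μ γ (Ici T) w φ)
    (hw : ∀ t, T ≤ t → gevreyNorm ρ ν k 0 (w t) ≤ ENNReal.ofReal a)
    (hφ : ∀ t, T ≤ t → gevreyNorm ρ ν (Y 0) llow (φ t) ≤ ENNReal.ofReal (b * NFun d 0 t)) :
    ∃ wplus, IsAsymptoticState ρ ν k w wplus := by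
  have hn := S.dim_pos
  have hn2 : (0 : ℝ) < (n : ℝ) / 2 := by positivity
  have hC := S.nonneg
  have hNT := NFun_pos hd hpos 0 hT
  obtain ⟨E, hE⟩ : ∃ E, E = a / NFun d 0 T + C * (a + b) ^ 2 * ((0 : ℕ) + 1) := ⟨_, rfl⟩
  have hE0 : 0 ≤ E := by
    rw [hE]
    positivity
  have hsub (s t : ℝ) (hs : T ≤ s) (hst : s ≤ t) :
      gevreyNorm ρ ν (K 1) 0 (w t - w s) ≤ ENNReal.ofReal (E * QFun d 0 s) := by
    refine (S.ampl_sub_le hd hρ hE0 0 hT.le haux.eq_w (fun t ht => ?_) hs hst).trans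
      (ENNReal.ofReal_le_ofReal ?_)
    · have ht1 := hT.le.trans ht
      have := S.aux_ampl_le hd hpos hT ha hρ hν hν1 (add_nonneg ha hb) (Nat.zero_le p) hK ht
        (x := fun _ => φ t) (y := fun _ => w t) (hw t ht) (fun j hj => ?_) (fun j hj => ?_)
      · rw [Finset.sum_range_one, ← hE] at this
        exact this
      · obtain rfl : j = 0 := by omega
        exact (hφ t ht).trans (ENNReal.ofReal_le_ofReal
          (mul_le_mul_of_nonneg_right (by linarith) (NFun_nonneg hd 0 ht1)))
      · obtain rfl : j = 0 := by omega
        refine (gevreyNorm_mono _ _ _ hK0 _).trans ((hw t ht).trans (ENNReal.ofReal_le_ofReal ?_))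
        rw [ampl]
        linarith
    · have := mul_nonneg hE0 (QFun_nonneg hd 0 (hT.le.trans (hs.trans hst)))
      linarith
  have hQ := tendsto_QFun hd 0
  obtain ⟨wplus, hlim, hle⟩ := exists_limit_of_gevreyNorm hn hρ hn2 (t₀ := T) (u := w)
    (b := fun s => E * QFun d 0 s) (fun s hs => mul_nonneg hE0 (QFun_nonneg hd 0 (hT.le.trans hs)))
    (by simpa using hQ.const_mul E) hsub
  have hwp : gevreyNorm ρ ν k 0 wplus ≤ ENNReal.ofReal a := by
    refine gevreyNorm_le_of_tendsto (C := fun _ => a) hn hρ hn2 hlim tendsto_const_nhds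
      (fun _ => ha) ?_
    filter_upwards [eventually_ge_atTop T] with t ht using hw t ht
  refine ⟨wplus, hwp.trans_lt ENNReal.ofReal_lt_top, fun k' hk' => ?_⟩
  refine tendsto_gevreyNorm_of_interpolation (T := T) (a := a + a) (k₁ := K 1) hk' (by positivity)
    (fun t ht => ?_) (tendsto_gevreyNorm_zero hQ hle)
  rw [ENNReal.ofReal_add ha ha]
  exact (gevreyNorm_sub_le _ _ _ _ _ _).trans (add_le_add (hw t ht) hwp)

/-- Asymptotic behaviour of the solutions of the auxiliary system, with uniform constants. -/
theorem Scheme.exists_asymptotics (S : Scheme n p K Y llow κ μ C) (hd : IsDensity d)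
    (hpos : ∀ t, 0 < d t) (hc : 0 ≤ c) (hγ : ∀ t, 1 ≤ t → t ^ (-γ) ≤ c * d t) (hT : 1 < T)
    (hK : ∀ m ≤ p, K (m + 1) ≤ k - 2) (hK0 : K 0 ≤ k) (hY : ∀ m ≤ p, Y (m + 1) ≤ Y m)
    (ha : 0 ≤ a) (hb : 0 ≤ b) :
    ∃ B : ℝ, ∀ ρ ν : ℝ, 0 ≤ ρ → 0 ≤ ν → ν ≤ 1 → ∀ w φ : ℝ → TD n,
      IsAuxSolution κ μ γ (Ici T) w φ →
      (∀ t, T ≤ t → gevreyNorm ρ ν k 0 (w t) ≤ ENNReal.ofReal a) →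
      (∀ t, T ≤ t → gevreyNorm ρ ν (Y 0) llow (φ t) ≤ ENNReal.ofReal (b * NFun d 0 t)) →
      (∃ wplus, IsAsymptoticState ρ ν k w wplus) ∧
      ∀ wplus, IsAsymptoticState ρ ν k w wplus →
        (∃ wm φm : ℕ → ℝ → TD n, IsAsymptoticFamily κ μ γ p wplus wm φm) ∧
        ∀ wm φm : ℕ → ℝ → TD n, IsAsymptoticFamily κ μ γ p wplus wm φm →
          (∀ m ≤ p, ∀ t, T ≤ t →
            gevreyNorm ρ ν (K (m + 1)) 0 (rem w wm (m + 1) t) ≤ ENNReal.ofReal (B * QFun d m t) ∧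
            gevreyNorm ρ ν (Y (m + 1)) llow (rem φ φm (m + 1) t) ≤
              ENNReal.ofReal (B * NFun d (m + 1) t)) ∧
          (PFinite d p → ∃ ψplus : TD n,
            gevreyNorm ρ ν (Y (p + 1)) llow ψplus < ⊤ ∧
            Tendsto (fun t => gevreyNorm ρ ν (Y (p + 1)) llow (rem φ φm (p + 1) t - ψplus))
              atTop (𝓝 0) ∧
            ∀ t, T ≤ t → gevreyNorm ρ ν (Y (p + 1)) llow (rem φ φm (p + 1) t - ψplus) ≤
              ENNReal.ofReal (B * PFun d p t)) := by
  obtain ⟨A₁, hA₁, hfam⟩ := S.exists_familyBound hd hc hγ ha (p + 1) le_rfl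
  obtain ⟨A, hA⟩ : ∃ A, A = A₁ + a + b := ⟨_, rfl⟩
  have hA0 : 0 ≤ A := by
    rw [hA]
    positivity
  obtain ⟨B, hAB, hrem⟩ := S.exists_remBound hd hpos hc hγ hT hK hY ha hA0 (p + 1) le_rfl
  have hB0 : 0 ≤ B := hA0.trans hAB
  have hn := S.dim_pos
  have hn2 : (0 : ℝ) < (n : ℝ) / 2 := by positivity
  -- `B` already bounds the remainders; the factor 5 is needed for the limit of the phase and comes
  -- from `phaseBound_sub_le`.
  refine ⟨5 * B, fun ρ ν hρ hν hν1 w φ haux hw hφ => ⟨S.exists_asymptoticState hd hpos hT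
    (hK 0 (Nat.zero_le p)) hK0 ha hb hρ hν hν1 haux hw hφ, fun wplus hwp => ?_⟩⟩
  have hlim := tendsto_apply_of_gevreyNorm hn hρ hn2 (hwp.2 (k - 1) (by linarith))
  have hwpk : gevreyNorm ρ ν k 0 wplus ≤ ENNReal.ofReal a := by
    refine gevreyNorm_le_of_tendsto (C := fun _ => a) hn hρ hn2 hlim tendsto_const_nhds
      (fun _ => ha) ?_
    filter_upwards [eventually_ge_atTop T] with t ht using hw t ht
  have hwp0 := (gevreyNorm_mono ρ ν 0 hK0 wplus).trans hwpk
  refine ⟨?_, fun wm φm hF => ?_⟩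
  · obtain ⟨wm, φm, h⟩ := S.exists_family hd hc hγ hρ hν hν1 ha hwp0 (p + 1) le_rfl
    exact ⟨wm, φm, partialFamily_iff.1 h⟩
  have hF' := partialFamily_iff.2 hF
  have D : SolutionData d K Y llow κ μ γ T k a A ρ ν p wplus w φ wm φm :=
    ⟨haux, hw, hlim, hF', (hfam ρ ν hρ hν hν1 wplus wm φm hwp0 hF').mono hd (by linarith)⟩
  have hbase : RemBound d K Y llow T ρ ν A 0 0 w φ wm φm := by
    refine ⟨fun j hj t ht => ?_, fun j hj t ht => ?_⟩
    · obtain rfl : j = 0 := by omega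
      rw [rem_zero, ampl]
      exact (gevreyNorm_mono _ _ _ hK0 _).trans
        ((hw t ht).trans (ENNReal.ofReal_le_ofReal (by linarith)))
    · obtain rfl : j = 0 := by omega
      rw [rem_zero]
      exact (hφ t ht).trans (ENNReal.ofReal_le_ofReal
        (mul_le_mul_of_nonneg_right (by linarith) (NFun_nonneg hd 0 (hT.le.trans ht))))
  obtain ⟨h1, h2⟩ := hrem ρ ν hρ hν hν1 wplus w φ wm φm D hbase
  have h1' := h1.mono hd hT.le (show B ≤ 5 * B by linarith)
  refine ⟨fun m hm t ht => ⟨h1'.w (m + 1) (by omega) t ht, h1'.φ (m + 1) (by omega) t ht⟩,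
    fun hP => ?_⟩
  have hPt := tendsto_PFun hd p hP
  obtain ⟨ψ, -, hψ⟩ := exists_limit_of_gevreyNorm hn hρ S.low_lt (t₀ := T) (u := rem φ φm (p + 1))
    (b := fun s => 5 * B * PFun d p s) (fun s hs => mul_nonneg (by positivity) (PFun_nonneg hd p s))
    (by simpa using hPt.const_mul (5 * B)) (fun s t hs hst =>
      (h2 p (by omega) s t hs hst).trans (ENNReal.ofReal_le_ofReal (by
        have := mul_le_mul_of_nonneg_left (phaseBound_sub_le hd p hP (hT.le.trans hs) hst) hB0
        linarith)))
  refine ⟨ψ, ?_, tendsto_gevreyNorm_zero hPt hψ, hψ⟩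
  -- Both terms on the right have finite norm, hence so does the limit.
  have e : ψ = rem φ φm (p + 1) T - (rem φ φm (p + 1) T - ψ) := by abel
  rw [e]
  exact (gevreyNorm_sub_le _ _ _ _ _ _).trans_lt (ENNReal.add_lt_top.2
    ⟨h1.lt_top_φ le_rfl le_rfl, (hψ T le_rfl).trans_lt ENNReal.ofReal_lt_top⟩)

end

/-! ### Densities on the half line -/

section

variable {d : ℝ → ℝ}

theorem hFun_congr {d' : ℝ → ℝ} (h : ∀ s, 1 < s → d s = d' s) : hFun d = hFun d' := by
  funext t
  exact setIntegral_congr_fun measurableSet_Ioi fun s hs => by simp only [h s hs]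

theorem NFun_congr {d' : ℝ → ℝ} (h : ∀ s, 1 < s → d s = d' s) (m : ℕ) {t : ℝ} (ht : 1 ≤ t) :
    NFun d m t = NFun d' m t := by
  rw [NFun, NFun, hFun_congr h, intervalIntegral.integral_of_le ht,
    intervalIntegral.integral_of_le ht]
  exact setIntegral_congr_fun measurableSet_Ioc fun s hs => by simp only [h s hs.1]

theorem QFun_congr {d' : ℝ → ℝ} (h : ∀ s, 1 < s → d s = d' s) (m : ℕ) : QFun d m = QFun d' m := by
  funext t
  rw [QFun, QFun, hFun_congr h]
  exact setIntegral_congr_fun measurableSet_Ioi fun s hs => by simp only [h s hs]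

theorem PFun_congr {d' : ℝ → ℝ} (h : ∀ s, 1 < s → d s = d' s) (m : ℕ) : PFun d m = PFun d' m := by
  funext t
  rw [PFun, PFun, hFun_congr h]
  exact setIntegral_congr_fun measurableSet_Ioi fun s hs => by simp only [h s hs]

theorem PFinite.congr {d' : ℝ → ℝ} (h : ∀ s, 1 < s → d s = d' s) {m : ℕ} (hP : PFinite d m) :
    PFinite d' m := by
  rw [PFinite, ← hFun_congr h]
  exact IntegrableOn.congr_fun hP (fun s hs => by simp only [h s hs]) measurableSet_Ioi

end

/-! ### The scale of spaces of the main result -/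

/-- A unit of index costs `lamb`, which pays for the one derivative lost by a gradient (`1 ≤ lamb`)
and for `Δφ` (`lam ≤ lamb`). In the excess of regularity of each product the indices cancel, leaving
at least `k₀ > n/2`. The lower bound on `k₀` in terms of `p` keeps the output exponents nonnegative
up to index p+1. The shift by 2 in the phase exponents is the one in `YNorm`. -/
theorem exists_scheme {n : ℕ} (p : ℕ) (hn : 0 < n) {μ llow k₀ lam lamb : ℝ} (κ : ℝ) (hμn : μ ≤ n)
    (hllow : 0 ≤ llow) (hllow_lt : llow < (n : ℝ) / 2) (hllow_gt : (n : ℝ) / 2 - μ < llow)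
    (hlam : lam = μ - n + 2) (hlamb : lam ≤ lamb) (hlamb1 : 1 ≤ lamb)
    (hk₀ : (n : ℝ) / 2 < k₀) (hk₀p : ((p : ℝ) + 2) * lamb - 1 ≤ k₀) :
    ∃ C, Scheme n p (fun m => k₀ - m * lamb) (fun m => k₀ - lam - m * lamb + 2) llow κ μ C := by
  have hmul (i : ℕ) : 0 ≤ (i : ℝ) * lamb := by positivity
  have hle (i : ℕ) (hi : i ≤ p + 1) : (i : ℝ) * lamb ≤ ((p : ℝ) + 1) * lamb := by
    have : (i : ℝ) ≤ p + 1 := by exact_mod_cast hi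
    gcongr
  -- Keeping the range condition inside the existential gives a constant for every pair, so that the
  -- constants can be chosen as functions and majorised over a finite grid.
  have h1 (q : ℕ × ℕ) : ∃ C, q.1 + q.2 ≤ p →
      BddBilin (transport : TD n → TD n → TD n) (k₀ - lam - q.2 * lamb + 2) llow
        (k₀ - q.1 * lamb) 0 (k₀ - (q.1 + q.2 + 1 : ℕ) * lamb) 0 C := by
    by_cases hq : q.1 + q.2 ≤ p
    · have a1 := hle (q.1 + q.2 + 1) (by omega)
      have a2 := hmul q.1
      have a3 := hmul q.2
      push_cast at a1 ⊢
      obtain ⟨C, hC⟩ := exists_bddBilin_transport hn hllow hllow_lt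
        (ℓ := k₀ - lam - q.2 * lamb) (k := k₀ - q.1 * lamb)
        (K := k₀ - ((q.1 : ℝ) + q.2 + 1) * lamb) (by linarith) (by linarith) (by linarith)
        (by linarith)
      exact ⟨C, fun _ => hC⟩
    · exact ⟨0, fun h => absurd h hq⟩
  have h2 (q : ℕ × ℕ) : ∃ C, q.1 + q.2 ≤ p →
      BddBilin (gradDot : TD n → TD n → TD n) (k₀ - lam - q.1 * lamb + 2) llow
        (k₀ - lam - q.2 * lamb + 2) llow (k₀ - lam - (q.1 + q.2 + 1 : ℕ) * lamb + 2) llow C := by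
    by_cases hq : q.1 + q.2 ≤ p
    · have a1 := hle (q.1 + q.2 + 1) (by omega)
      have a2 := hmul q.1
      have a3 := hmul q.2
      push_cast at a1 ⊢
      obtain ⟨C, hC⟩ := exists_bddBilin_gradDot hn hllow hllow_lt
        (ℓ₁ := k₀ - lam - q.1 * lamb) (ℓ₂ := k₀ - lam - q.2 * lamb)
        (L := k₀ - lam - ((q.1 : ℝ) + q.2 + 1) * lamb) (by linarith) (by linarith) (by linarith)
        (by linarith)
      exact ⟨C, fun _ => hC⟩
    · exact ⟨0, fun h => absurd h hq⟩
  have h3 (q : ℕ × ℕ) : ∃ C, q.1 + q.2 ≤ p + 1 →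
      BddBilin (g0 κ μ : TD n → TD n → TD n) (k₀ - q.1 * lamb) 0 (k₀ - q.2 * lamb) 0
        (k₀ - lam - (q.1 + q.2 : ℕ) * lamb + 2) llow C := by
    by_cases hq : q.1 + q.2 ≤ p + 1
    · have a1 := hle (q.1 + q.2) hq
      have a2 := hmul q.1
      have a3 := hmul q.2
      push_cast at a1 ⊢
      obtain ⟨C, hC⟩ := exists_bddBilin_g0 (κ := κ) hn hμn hllow_lt hllow_gt
        (k₁ := k₀ - q.1 * lamb) (k₂ := k₀ - q.2 * lamb)
        (K := k₀ - ((q.1 : ℝ) + q.2) * lamb) (by linarith) (by linarith) (by linarith)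
        (by linarith)
      refine ⟨C, fun _ => ?_⟩
      have e : k₀ - ((q.1 : ℝ) + q.2) * lamb - (μ - n) =
        k₀ - lam - ((q.1 : ℝ) + q.2) * lamb + 2 := by
        rw [hlam]
        ring
      rwa [e] at hC
    · exact ⟨0, fun h => absurd h hq⟩
  choose C₁ hC₁ using h1
  choose C₂ hC₂ using h2
  choose C₃ hC₃ using h3
  let R := Finset.range (p + 2) ×ˢ Finset.range (p + 2)
  obtain ⟨M, hM⟩ := Finset.exists_le (R.image C₁ ∪ R.image C₂ ∪ R.image C₃)
  have hmem (q : ℕ × ℕ) (hq : q.1 + q.2 ≤ p + 1) : q ∈ R := by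
    simp only [R, Finset.mem_product, Finset.mem_range]
    omega
  have hM₁ (q : ℕ × ℕ) (hq : q.1 + q.2 ≤ p + 1) : C₁ q ≤ M := hM _ (by
    have := Finset.mem_image_of_mem C₁ (hmem q hq)
    simp only [Finset.mem_union]
    tauto)
  have hM₂ (q : ℕ × ℕ) (hq : q.1 + q.2 ≤ p + 1) : C₂ q ≤ M := hM _ (by
    have := Finset.mem_image_of_mem C₂ (hmem q hq)
    simp only [Finset.mem_union]
    tauto)
  have hM₃ (q : ℕ × ℕ) (hq : q.1 + q.2 ≤ p + 1) : C₃ q ≤ M := hM _ (by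
    have := Finset.mem_image_of_mem C₃ (hmem q hq)
    simp only [Finset.mem_union]
    tauto)
  exact ⟨M, hn, hllow_lt, (hC₃ (0, 0) (by simp)).nonneg.trans (hM₃ (0, 0) (by simp)),
    fun i j hij => (hC₁ (i, j) hij).mono (hM₁ (i, j) (by simp only; omega)),
    fun i j hij => (hC₂ (i, j) hij).mono (hM₂ (i, j) (by simp only; omega)),
    fun i j hij => (hC₃ (i, j) hij).mono (hM₃ (i, j) hij)⟩

end GinibreVelo

end

/-! ### The main result. -/

open GinibreVelo in
theorem proposition5p3 (n p : ℕ) (μ γ κ llow k l k₀ lam lamb c T : ℝ)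
    (hμ : 0 < μ) (hμn : μ ≤ n) (hγ : 0 < γ) (hγ1 : γ ≤ 1)
    (hllow : 0 ≤ llow) (hllow_lt : llow < (n : ℝ) / 2) (hllow_gt : (n : ℝ) / 2 - μ < llow)
    (hlam : lam = μ - n + 2) (hlamb : lamb = max lam 1)
    (hk : (n : ℝ) / 2 + ((p : ℝ) - 2) * lamb + max lam 0 < k)
    (hkk₀ : k₀ - lamb + 2 ≤ k) (hlk₀ : k₀ - lam ≤ l)
    (hk₀ : (n : ℝ) / 2 < k₀) (hk₀p : ((p : ℝ) + 2) * lamb - 1 ≤ k₀)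
    (h₀ d : ℝ → ℝ) (hd : ∀ t ∈ Set.Ici (1 : ℝ), HasDerivWithinAt h₀ (d t) (Set.Ici 1) t)
    (hd_cont : ContinuousOn d (Set.Ici 1))
    (hh₀_pos : ∀ t ∈ Set.Ici (1 : ℝ), 0 < h₀ t) (hh₀_mono : MonotoneOn h₀ (Set.Ici 1))
    (hh₀_int : MeasureTheory.IntegrableOn (fun t => (t ^ 2)⁻¹ * h₀ t) (Set.Ici 1))
    (hd_int : MeasureTheory.IntegrableOn (fun t => t⁻¹ * d t) (Set.Ici 1))
    (hc : ∀ t ∈ Set.Ici (1 : ℝ), t ^ (-γ) ≤ c * d t)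
    (hT : 2 ≤ T) :
    ∃ A : ℝ → ℝ → ℝ, ∀ ν ρ : ℝ, 0 ≤ ν → ν ≤ 1 → 0 ≤ ρ →
      ∀ w φ : ℝ → TD n, IsAuxSolution κ μ γ (Set.Ici T) w φ →
      MemCalY ρ ν llow k l (Set.Ici T) w (fun t => ((h₀ t)⁻¹ : ℂ) • φ t) →
      ∀ a b : ℝ, a = (⨆ t ∈ Set.Ici T, KNorm ρ ν k (w t)).toReal →
      b = (⨆ t ∈ Set.Ici T, YNorm ρ ν llow l (((h₀ t)⁻¹ : ℂ) • φ t)).toReal →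
      (∃ wplus : TD n, IsAsymptoticState ρ ν k w wplus) ∧
      ∀ wplus : TD n, IsAsymptoticState ρ ν k w wplus →
        (∃ wm φm : ℕ → ℝ → TD n, IsAsymptoticFamily κ μ γ p wplus wm φm) ∧
        ∀ wm φm : ℕ → ℝ → TD n, IsAsymptoticFamily κ μ γ p wplus wm φm →
          (∀ m ≤ p, ∀ t ∈ Set.Ici T,
            KNorm ρ ν (k₀ - ((m : ℝ) + 1) * lamb)
                (w t - ∑ j ∈ Finset.range (m + 1), wm j t) ≤
              ENNReal.ofReal (A a b * QFun d m t) ∧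
            YNorm ρ ν llow (k₀ - lam - ((m : ℝ) + 1) * lamb)
                (φ t - ∑ j ∈ Finset.range (m + 1), φm j t) ≤
              ENNReal.ofReal (A a b * NFun d (m + 1) t)) ∧
          (1 < ((p : ℝ) + 2) * γ → PFinite d p →
            ∃ ψplus : TD n,
              YNorm ρ ν llow (k₀ - lam - ((p : ℝ) + 1) * lamb) ψplus < ⊤ ∧
              Filter.Tendsto (fun t => YNorm ρ ν llow (k₀ - lam - ((p : ℝ) + 1) * lamb)
                (φ t - ∑ j ∈ Finset.range (p + 1), φm j t - ψplus)) Filter.atTop (nhds 0) ∧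
              ∀ t ∈ Set.Ici T, YNorm ρ ν llow (k₀ - lam - ((p : ℝ) + 1) * lamb)
                (φ t - ∑ j ∈ Finset.range (p + 1), φm j t - ψplus) ≤
                  ENNReal.ofReal (A a b * PFun d p t)) := by
  have hn0 : (0 : ℝ) < n := hμ.trans_le hμn
  have hn : 0 < n := by exact_mod_cast hn0
  have hlamb_le : lam ≤ lamb := hlamb ▸ le_max_left _ _
  have hlamb1 : 1 ≤ lamb := hlamb ▸ le_max_right _ _
  -- This follows from `μ ≤ n`. Combined with `hkk₀` it gives `k₀ ≤ k`, so the solution starts in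
  -- the top space of the scale.
  have hlamb2 : lamb ≤ 2 := by
    rw [hlamb]
    exact max_le (by linarith) one_le_two
  have hT1 : 1 < T := by linarith
  obtain ⟨C, S⟩ := exists_scheme p hn κ hμn hllow hllow_lt hllow_gt hlam hlamb_le hlamb1 hk₀ hk₀p
  -- Monotonicity gives only `0 ≤ d t`; equality is excluded because `t ^ (-γ)` is positive. Strict
  -- positivity is what makes every `N_m(T)` a legitimate divisor.
  have hd_pos (t : ℝ) (ht : 1 ≤ t) : 0 < d t := by
    refine lt_of_le_of_ne ((hd t ht).nonneg_of_monotoneOn ?_ hh₀_mono) fun h => ?_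
    · exact accPt_principal_iff_nhdsWithin.2 ((nhdsGT_neBot t).mono
        (nhdsWithin_mono t fun y hy => ⟨ht.trans (le_of_lt hy), ne_of_gt hy⟩))
    · have h1 := hc t ht
      rw [← h, mul_zero] at h1
      exact absurd h1 (not_le.2 (Real.rpow_pos_of_pos (by linarith) _))
  have hc0 : 0 ≤ c := by
    have h1 := hc 1 (Set.mem_Ici.2 le_rfl)
    rw [Real.one_rpow] at h1
    by_contra h2
    have := mul_neg_of_neg_of_pos (not_le.1 h2) (hd_pos 1 le_rfl)
    linarith
  -- A continuous positive extension to the line; the functions `h`, `N_m`, `Q_m`, `P_m` on `[1, ∞)`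
  -- only use the density on `(1, ∞)`.
  set D : ℝ → ℝ := fun t => d (max t 1) with hD
  have hDd (t : ℝ) (ht : 1 ≤ t) : D t = d t := by
    simp only [hD, max_eq_left ht]
  have hcongr (s : ℝ) (hs : 1 < s) : d s = D s := (hDd s hs.le).symm
  have hDpos (t : ℝ) : 0 < D t := hd_pos _ (le_max_right t 1)
  have hDd' : IsDensity D :=
    { cont := hd_cont.comp_continuous (by fun_prop) fun t => le_max_right t 1
      nonneg := fun t => (hDpos t).le
      int := (hd_int.mono_set Set.Ioi_subset_Ici_self).congr_fun
        (fun s hs => by simp only [hcongr s hs]) measurableSet_Ioi }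
  have hNT := NFun_pos hDd' hDpos 0 hT1
  -- Since `N_0(t) = h₀(t) - h₀(1)`, the constant `h₀(1)` is absorbed for `t ≥ T`. This converts the
  -- assumed growth of `φ` into the rate `N_0` used by the scheme.
  have hh₀T : ∀ t, T ≤ t → h₀ t ≤ (h₀ 1 / NFun D 0 T + 1) * NFun D 0 t := by
    intro t ht
    have ht1 : 1 ≤ t := hT1.le.trans ht
    have h1 : NFun D 0 t = h₀ t - h₀ 1 := by
      have := intervalIntegral.integral_eq_sub_of_hasDeriv_right_of_le ht1 (f := h₀) (f' := D)
        (fun x hx => (hd x hx.1).continuousWithinAt.mono fun y hy => hy.1)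
        (fun x hx => by
          rw [hDd x hx.1.le]
          exact (hd x hx.1.le).mono fun y hy => hx.1.le.trans (le_of_lt hy))
        (hDd'.cont.intervalIntegrable _ _)
      rw [← this, NFun]
      simp
    have h2 : h₀ 1 ≤ h₀ 1 / NFun D 0 T * NFun D 0 t := by
      rw [div_mul_eq_mul_div, le_div_iff₀ hNT]
      exact mul_le_mul_of_nonneg_left (NFun_monotone hDd' 0 hT1.le ht)
        (hh₀_pos 1 (Set.mem_Ici.2 le_rfl)).le
    linarith
  have hH : 0 ≤ h₀ 1 / NFun D 0 T + 1 := by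
    have := hh₀_pos 1 (Set.mem_Ici.2 le_rfl)
    positivity
  -- Absolute values make the constant available for all real arguments; at the actual suprema they
  -- change nothing.
  have key (a b : ℝ) := S.exists_asymptotics hDd' hDpos hc0
    (fun t ht => by rw [hDd t ht]; exact hc t ht) hT1 (k := k)
    (fun m _ => by
      have : 0 ≤ (m : ℝ) * lamb := by positivity
      push_cast
      linarith)
    (by push_cast; linarith)
    (fun m _ => by push_cast; linarith)
    (abs_nonneg a) (mul_nonneg (abs_nonneg b) hH)
  choose A hA using key
  refine ⟨A, fun ν ρ hν hν1 hρ w φ haux hmem a b ha hb => ?_⟩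
  have ha0 : |a| = a := abs_of_nonneg (ha ▸ ENNReal.toReal_nonneg)
  have hb0 : |b| = b := abs_of_nonneg (hb ▸ ENNReal.toReal_nonneg)
  have hb0' : 0 ≤ b := hb0 ▸ abs_nonneg b
  have hw (t : ℝ) (ht : T ≤ t) : gevreyNorm ρ ν k 0 (w t) ≤ ENNReal.ofReal |a| := by
    rw [ha0, ha, ENNReal.ofReal_toReal hmem.bdd_w.ne]
    exact le_iSup₂ (f := fun t (_ : t ∈ Set.Ici T) => KNorm ρ ν k (w t)) t ht
  have hφ (t : ℝ) (ht : T ≤ t) : gevreyNorm ρ ν (k₀ - lam - (0 : ℕ) * lamb + 2) llow (φ t) ≤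
      ENNReal.ofReal (|b| * (h₀ 1 / NFun D 0 T + 1) * NFun D 0 t) := by
    have hpos := hh₀_pos t (Set.mem_Ici.2 (hT1.le.trans ht))
    have h1 : gevreyNorm ρ ν (l + 2) llow (((h₀ t)⁻¹ : ℂ) • φ t) ≤ ENNReal.ofReal b := by
      rw [hb, ENNReal.ofReal_toReal hmem.bdd_φ.ne]
      exact le_iSup₂ (f := fun t (_ : t ∈ Set.Ici T) =>
        YNorm ρ ν llow l (((h₀ t)⁻¹ : ℂ) • φ t)) t ht
    have h2 := gevreyNorm_smul_le_ofReal (c := (h₀ t : ℂ)) (r := h₀ t)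
      (by rw [Complex.norm_real, Real.norm_of_nonneg hpos.le]) h1
    have e : (h₀ t : ℂ) • ((h₀ t)⁻¹ : ℂ) • φ t = φ t :=
      smul_inv_smul₀ (Complex.ofReal_ne_zero.2 hpos.ne') (φ t)
    rw [e] at h2
    refine (gevreyNorm_mono ρ ν llow (by push_cast; linarith) _).trans
      (h2.trans (ENNReal.ofReal_le_ofReal ?_))
    rw [hb0, mul_assoc, mul_comm]
    exact mul_le_mul_of_nonneg_left (hh₀T t ht) hb0'
  obtain ⟨h1, h2⟩ := hA a b ρ ν hρ hν hν1 w φ haux hw hφ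
  refine ⟨h1, fun wplus hwp => ?_⟩
  obtain ⟨h3, h4⟩ := h2 wplus hwp
  refine ⟨h3, fun wm φm hF => ?_⟩
  obtain ⟨h5, h6⟩ := h4 wm φm hF
  refine ⟨fun m hm t ht => ?_, fun _ hP => ?_⟩
  · have := h5 m hm t ht
    push_cast at this
    rw [QFun_congr hcongr, NFun_congr hcongr _ (hT1.le.trans ht)]
    exact this
  · have := h6 (hP.congr hcongr)
    push_cast at this
    rw [PFun_congr hcongr]
    exact this
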